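/- Let $d\ge 0$ be an integer, $\nu>0$, let $\Gamma$ be a discrete subgroup (of arbitrary rank) of $(\mathbb R^d,+)$ and $\chi:\Gamma\to\{|w|=1\}\subset\mathbb C$ a character, i.e. $\chi(\gamma+\gamma')=\chi(\gamma)\chi(\gamma')$. Write $\langle\cdot,\cdot\rangle$ for the usual scalar product of $\mathbb R^d$ and also for its complex bilinear extension $\langle z,w\rangle=\sum_j z_jw_j$ to $\mathbb C^d$, and $H(z,w)=\langle z,\overline w\rangle$; regard $\mathbb R^d\subset\mathbb C^d$. Let $L^{2,\nu}_{\Gamma,\chi}(\mathbb R^d)$ be the space of measurable functions $f:\mathbb R^d\to\mathbb C$, modulo equality almost everywhere, such that for every $\gamma\in\Gamma$ $$f(x+\gamma)=\chi(\gamma)\,e^{\nu\langle x+\gamma/2,\gamma\rangle}f(x)\quad\text{for a.e. }x,\qquad \|f\|^2:=\int_{\Lambda}|f(x)|^2e^{-\nu\|x\|^2}\,dx<\infty,$$ with scalar product $\int_\Lambda f\,\overline g\,e^{-\nu\|x\|^2}dx$, where $\Lambda$ is any fundamental domain of $\Gamma$ in $\mathbb R^d$. For a discrete subgroup $\Gamma'$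 of $\mathbb R^d$ with a character $\chi'$, let the theta Bargmann–Fock space $\mathcal F^{2,\nu}_{\Gamma',\chi'}(\mathbb C^d)$ be the space of holomorphic functions $f$ on $\mathbb C^d$ such that for all $z\in\mathbb C^d$ and $\gamma\in\Gamma'$ $$f(z+\gamma)=\chi'(\gamma)\,e^{\nu H(z+\gamma/2,\gamma)}f(z),\qquad \|f\|^2:=\int_{\Lambda'}|f(z)|^2e^{-\nu H(z,z)}\,dz<\infty,$$ with scalar product $\int_{\Lambda'} f\,\overline g\,e^{-\nu H(z,z)}dz$, where $\Lambda'$ is any fundamental domain of $\Gamma'$ in $\mathbb C^d=\mathbb R^{2d}$ and $dz$ is Lebesgue measure. Theorem 2.2. There is a vector $v_\chi\in\mathrm{Span}_{\mathbb R}(\Gamma)$ with $\chi(\gamma)=e^{2i\pi\langle\gamma,v_\chi\rangle}$ for all $\gamma\in\Gamma$. For every $v_\chi\in\mathbb R^d$ with this last property, put $\widetilde\Gamma=\Gamma/\sqrt2$ and $\widetilde\chi(\widetilde\gamma)=e^{2i\pi\langle\widetilde\gamma,\sqrt2\,v_\chi\rangle}$ for $\widetilde\gamma\in\widetilde\Gamma$.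 Then the Segal–Bargmann transform $$[\mathcal B\varphi](z)=\left(\frac{\nu}{\pi}\right)^{3d/4}\int_{\mathbb R^d}e^{\sqrt2\,\nu\langle z,x\rangle-\frac{\nu}{2}\langle z,z\rangle}\,\varphi(x)\,e^{-\nu\|x\|^2}\,dx,\qquad z\in\mathbb C^d,$$ is well defined on $L^{2,\nu}_{\Gamma,\chi}(\mathbb R^d)$ (the integral converges absolutely for every $z$), and it is an isometric isomorphism from $L^{2,\nu}_{\Gamma,\chi}(\mathbb R^d)$ onto $\mathcal F^{2,\nu}_{\widetilde\Gamma,\widetilde\chi}(\mathbb C^d)$: it is linear and bijective and preserves norms and scalar products. -/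

import Mathlib

open MeasureTheory
open scoped Pointwise

noncomputable section

/-- The standard inclusion of `ℝ^d` into `ℂ^d = ℝ^d + i ℝ^d`. -/
def complexify (d : ℕ) : EuclideanSpace ℝ (Fin d) →+ EuclideanSpace ℂ (Fin d) where
  toFun x := WithLp.toLp 2 fun i => (x i : ℂ)
  map_zero' := by ext i; simp
  map_add' x y := by ext i; simp

/-- The complex bilinear extension to `ℂ^d` of the scalar product of `ℝ^d`. -/
def bilin {d : ℕ} (z w : EuclideanSpace ℂ (Fin d)) : ℂ := ∑ i, z i * w i

/-- The standard hermitian scalar product on `ℂ^d`, linear in the first variable. -/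
def herm {d : ℕ} (z w : EuclideanSpace ℂ (Fin d)) : ℂ := ∑ i, z i * starRingEnd ℂ (w i)

lemma integrable_weighted_sq_add {X : Type*} [MeasurableSpace X] {μ : Measure X}
    {f g : X → ℂ} {w : X → ℝ} (hw : ∀ x, 0 ≤ w x) (hwm : AEStronglyMeasurable w μ)
    (hfm : AEStronglyMeasurable f μ) (hgm : AEStronglyMeasurable g μ)
    (hf : Integrable (fun x => ‖f x‖ ^ 2 * w x) μ)
    (hg : Integrable (fun x => ‖g x‖ ^ 2 * w x) μ) :
    Integrable (fun x => ‖f x + g x‖ ^ 2 * w x) μ := by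
  refine ((hf.add hg).const_mul 2).mono' (((hfm.add hgm).norm.pow 2).mul hwm) ?_
  refine Filter.Eventually.of_forall fun x => ?_
  have h1 : 0 ≤ ‖f x + g x‖ ^ 2 * w x := mul_nonneg (sq_nonneg _) (hw x)
  have h2 : ‖f x + g x‖ ^ 2 ≤ 2 * (‖f x‖ ^ 2 + ‖g x‖ ^ 2) := by
    have := norm_add_le (f x) (g x)
    nlinarith [sq_nonneg (‖f x‖ - ‖g x‖), norm_nonneg (f x + g x), norm_nonneg (f x),
      norm_nonneg (g x)]
  rw [Real.norm_of_nonneg h1]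
  calc ‖f x + g x‖ ^ 2 * w x ≤ 2 * (‖f x‖ ^ 2 + ‖g x‖ ^ 2) * w x :=
        mul_le_mul_of_nonneg_right h2 (hw x)
    _ = 2 * (‖f x‖ ^ 2 * w x + ‖g x‖ ^ 2 * w x) := by ring

/-- The space `L^{2,ν}_{Γ,χ}(ℝ^d)`: almost everywhere classes of measurable functions `f` with
`f (x + γ) = χ(γ) e^{ν ⟨x + γ/2, γ⟩} f(x)` for all `γ ∈ Γ` and almost all `x`, and with
`∫_Λ |f(x)|² e^{-ν ‖x‖²} dx < ∞`, where `Λ` is a fundamental domain of `Γ` in `ℝ^d`. -/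
def likewiseThetaSpace {d : ℕ} (ν : ℝ) (Γ : AddSubgroup (EuclideanSpace ℝ (Fin d))) (χ : Γ → ℂ)
    (Λ : Set (EuclideanSpace ℝ (Fin d))) :
    Submodule ℂ (EuclideanSpace ℝ (Fin d) →ₘ[volume] ℂ) where
  carrier := {f |
    (∀ γ : Γ, ∀ᵐ x : EuclideanSpace ℝ (Fin d), f (x + (γ : EuclideanSpace ℝ (Fin d))) =
      χ γ * Complex.exp (((ν * inner ℝ (x + (2⁻¹ : ℝ) • (γ : EuclideanSpace ℝ (Fin d)))
        (γ : EuclideanSpace ℝ (Fin d)) : ℝ) : ℂ)) * f x) ∧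
    IntegrableOn (fun x => ‖f x‖ ^ 2 * Real.exp (-ν * ‖x‖ ^ 2)) Λ}
  zero_mem' := by
    have h0 := AEEqFun.coeFn_zero (α := EuclideanSpace ℝ (Fin d)) (β := ℂ) (μ := volume)
    refine ⟨fun γ => ?_, ?_⟩
    · filter_upwards [h0, (measurePreserving_add_right volume
        (γ : EuclideanSpace ℝ (Fin d))).quasiMeasurePreserving.ae h0] with x hx hx'
      rw [hx, hx']; simp
    · refine (integrable_zero _ _ _).congr ?_
      filter_upwards [ae_restrict_of_ae h0] with x hx
      rw [hx]; simp
  add_mem' := by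
    rintro f g ⟨hf, hf'⟩ ⟨hg, hg'⟩
    have h0 := AEEqFun.coeFn_add f g
    refine ⟨fun γ => ?_, ?_⟩
    · filter_upwards [h0, (measurePreserving_add_right volume
        (γ : EuclideanSpace ℝ (Fin d))).quasiMeasurePreserving.ae h0, hf γ, hg γ] with x hx hx' h1 h2
      rw [hx, hx', Pi.add_apply, Pi.add_apply, h1, h2]; ring
    · refine (integrable_weighted_sq_add (fun x => (Real.exp_pos (-ν * ‖x‖ ^ 2)).le)
        (Continuous.aestronglyMeasurable (by fun_prop)) f.aestronglyMeasurable.restrict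
        g.aestronglyMeasurable.restrict hf' hg').congr ?_
      filter_upwards [ae_restrict_of_ae h0] with x hx
      rw [hx]; rfl
  smul_mem' := by
    rintro c f ⟨hf, hf'⟩
    have h0 := AEEqFun.coeFn_smul c f
    refine ⟨fun γ => ?_, ?_⟩
    · filter_upwards [h0, (measurePreserving_add_right volume
        (γ : EuclideanSpace ℝ (Fin d))).quasiMeasurePreserving.ae h0, hf γ] with x hx hx' h1
      rw [hx, hx', Pi.smul_apply, Pi.smul_apply, h1, smul_eq_mul, smul_eq_mul]; ring
    · refine (hf'.const_mul (‖c‖ ^ 2)).congr ?_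
      filter_upwards [ae_restrict_of_ae h0] with x hx
      rw [hx, Pi.smul_apply, norm_smul]; ring

/-- The scalar product `∫_Λ f(x) conj(g(x)) e^{-ν ‖x‖²} dx` of `L^{2,ν}_{Γ,χ}(ℝ^d)`. -/
def likewiseThetaInner {d : ℕ} (ν : ℝ) (Λ : Set (EuclideanSpace ℝ (Fin d)))
    (f g : EuclideanSpace ℝ (Fin d) →ₘ[volume] ℂ) : ℂ :=
  ∫ x in Λ, f x * starRingEnd ℂ (g x) * Real.exp (-ν * ‖x‖ ^ 2)

/-- The norm of `L^{2,ν}_{Γ,χ}(ℝ^d)`. -/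
def likewiseThetaNorm {d : ℕ} (ν : ℝ) (Λ : Set (EuclideanSpace ℝ (Fin d)))
    (f : EuclideanSpace ℝ (Fin d) →ₘ[volume] ℂ) : ℝ :=
  √(∫ x in Λ, ‖f x‖ ^ 2 * Real.exp (-ν * ‖x‖ ^ 2))

/-- The theta Bargmann–Fock space `F^{2,ν}_{Γ,χ}(ℂ^d)` of a subgroup `Γ` of `ℝ^d ⊆ ℂ^d`: entire
functions `f` on `ℂ^d` with `f (z + γ) = χ(γ) e^{ν H(z + γ/2, γ)} f(z)` for all `γ ∈ Γ`, `z ∈ ℂ^d`,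
and with `∫_Λ |f(z)|² e^{-ν H(z,z)} dz < ∞`, where `Λ` is a fundamental domain of `Γ` in `ℂ^d`. -/
def thetaFockSpace {d : ℕ} (ν : ℝ) (Γ : AddSubgroup (EuclideanSpace ℝ (Fin d))) (χ : Γ → ℂ)
    (Λ : Set (EuclideanSpace ℂ (Fin d))) :
    Submodule ℂ (EuclideanSpace ℂ (Fin d) → ℂ) where
  carrier := {f |
    Differentiable ℂ f ∧
    (∀ (γ : Γ) (z : EuclideanSpace ℂ (Fin d)), f (z + complexify d γ) =
      χ γ * Complex.exp (ν * herm (z + (2⁻¹ : ℂ) • complexify d γ) (complexify d γ)) * f z) ∧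
    IntegrableOn (fun z => ‖f z‖ ^ 2 * Real.exp (-ν * (herm z z).re)) Λ}
  zero_mem' := ⟨differentiable_const 0, fun γ z => by simp, by simp⟩
  add_mem' := by
    rintro f g ⟨hf, hf', hf''⟩ ⟨hg, hg', hg''⟩
    refine ⟨hf.add hg, fun γ z => ?_, ?_⟩
    · rw [Pi.add_apply, Pi.add_apply, hf', hg']; ring
    · exact integrable_weighted_sq_add (fun z => (Real.exp_pos (-ν * (herm z z).re)).le)
        (Continuous.aestronglyMeasurable (by
          unfold herm
          have : Continuous (starRingEnd ℂ) := Complex.continuous_conj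
          fun_prop))
        hf.continuous.aestronglyMeasurable hg.continuous.aestronglyMeasurable hf'' hg''
  smul_mem' := by
    rintro c f ⟨hf, hf', hf''⟩
    refine ⟨hf.const_smul c, fun γ z => ?_, ?_⟩
    · rw [Pi.smul_apply, Pi.smul_apply, hf', smul_eq_mul, smul_eq_mul]; ring
    · refine (hf''.const_mul (‖c‖ ^ 2)).congr (Filter.Eventually.of_forall fun z => ?_)
      simp only [Pi.smul_apply, norm_smul]; ring

/-- The scalar product `∫_Λ f(z) conj(g(z)) e^{-ν H(z,z)} dz` of `F^{2,ν}_{Γ,χ}(ℂ^d)`. -/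
def thetaFockInner {d : ℕ} (ν : ℝ) (Λ : Set (EuclideanSpace ℂ (Fin d)))
    (f g : EuclideanSpace ℂ (Fin d) → ℂ) : ℂ :=
  ∫ z in Λ, f z * starRingEnd ℂ (g z) * Real.exp (-ν * (herm z z).re)

/-- The norm of `F^{2,ν}_{Γ,χ}(ℂ^d)`. -/
def thetaFockNorm {d : ℕ} (ν : ℝ) (Λ : Set (EuclideanSpace ℂ (Fin d)))
    (f : EuclideanSpace ℂ (Fin d) → ℂ) : ℝ :=
  √(∫ z in Λ, ‖f z‖ ^ 2 * Real.exp (-ν * (herm z z).re))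

/-- The integrand
`e^{√2 ν ⟨z,x⟩ - (ν/2) ⟨z,z⟩} φ(x) e^{-ν ‖x‖²}` of the Segal–Bargmann transform. -/
def bargmannIntegrand {d : ℕ} (ν : ℝ) (φ : EuclideanSpace ℝ (Fin d) →ₘ[volume] ℂ)
    (z : EuclideanSpace ℂ (Fin d)) (x : EuclideanSpace ℝ (Fin d)) : ℂ :=
  Complex.exp (√2 * ν * bilin z (complexify d x) - ν / 2 * bilin z z) * φ x *
    Real.exp (-ν * ‖x‖ ^ 2)

/-- The Segal–Bargmann transform
`[Bφ](z) = (ν/π)^{3d/4} ∫_{ℝ^d} e^{√2 ν ⟨z,x⟩ - (ν/2) ⟨z,z⟩} φ(x) e^{-ν ‖x‖²} dx`. -/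
def segalBargmann {d : ℕ} (ν : ℝ) (φ : EuclideanSpace ℝ (Fin d) →ₘ[volume] ℂ)
    (z : EuclideanSpace ℂ (Fin d)) : ℂ :=
  (((ν / Real.pi) ^ (3 * (d : ℝ) / 4) : ℝ) : ℂ) * ∫ x, bargmannIntegrand ν φ z x

/-- The shifted lattice `Γ/√2`. -/
def shiftedLattice {d : ℕ} (Γ : AddSubgroup (EuclideanSpace ℝ (Fin d))) :
    AddSubgroup (EuclideanSpace ℝ (Fin d)) :=
  (√2)⁻¹ • Γ

/-- The character `γ ↦ e^{2iπ ⟨γ, √2 v⟩}` of `Γ/√2`. -/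
def shiftedChar {d : ℕ} (Γ : AddSubgroup (EuclideanSpace ℝ (Fin d)))
    (v : EuclideanSpace ℝ (Fin d)) (γ : shiftedLattice Γ) : ℂ :=
  Complex.exp (2 * Complex.I * Real.pi *
    ((inner ℝ (γ : EuclideanSpace ℝ (Fin d)) (√2 • v) : ℝ) : ℂ))

end

/-!
A function `φ` of the space `L^{2,ν}_{Γ,χ}(ℝ^d)` has a `Γ`-periodic density `|φ|² e^{-ν ‖x‖²}`,
and a function `F` of the theta Bargmann–Fock space has a `Γ/√2`-periodic density
`|F|² e^{-ν ‖z‖²}`. The Segal–Bargmann transform is a Laplace transform in disguise: up to a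
constant, `[Bφ](z) e^{ν ⟨z,z⟩ / 2}` is the Laplace transform of `φ e^{-ν ‖t‖²}` at `√2 ν z`, so
that its restriction to a vertical slice `x + i ℝ^d` is a rescaled Fourier transform of
`t ↦ e^{√2 ν ⟨x,t⟩} φ(t) e^{-ν ‖t‖²}` (`laplaceTransform_tubePoint`).

Well-definedness: averaging the mass of the periodic density against translated Gaussians over a
fundamental domain shows that it has finite mass against every Gaussian, so `φ e^{-ν ‖t‖²}` decays
faster than any exponential in `L¹ ∩ L²` (`lintegral_realDensity_mul_gaussian_ne_top`,
`integrable_and_memLp_exp_mul`).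

Isometry: the set of `z` with `√2 Re z` in a fundamental domain of `Γ` is a fundamental domain of
`Γ/√2` in `ℂ^d`. Tonelli's theorem and Plancherel's formula on every slice turn the norm of `Bφ`
into the integral over `Λ` of the convolution of `|φ|² e^{-ν ‖x‖²}` with a Gaussian, and this is
the norm of `φ`, since translating a periodic density does not change its integral over a
fundamental domain (`setLIntegral_density_eq`). Scalar products follow by polarization.

Surjectivity: let `K = F e^{ν ⟨z,z⟩ / 2}` for `F` in the Fock space. A thin tube around a vertical
slice embeds into the quotient by `Γ/√2`, so `K` is square integrable on tubes; the mean value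
inequality bounds it there, and almost all its slices are square integrable. Shifting vertical
contours against Gaussians shows that the inverse Fourier transforms of these slices differ by
real exponentials only, that is, they come from one function `φ` (`fourierInv_slice_ae_eq`). The
quasi-periodicity of `φ` results from that of `F`, its norm is finite by the norm identity, and
its transform is `F` (`exists_segalBargmann_eq`).

The vector that induces the character is found on a `ℤ`-basis of `Γ`, which is an `ℝ`-basis of its
real span (`exists_vector_of_character`).
-/

noncomputable section

open scoped FourierTransform SchwartzMap ENNReal

/-! ### The Fourier transform on `L¹ ∩ L²` -/

section Fourier

open scoped ContDiff

variable {W : Type*} [NormedAddCommGroup W] [InnerProductSpace ℝ W] [FiniteDimensional ℝ W]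
  [MeasurableSpace W] [BorelSpace W]

lemma continuous_fourier {f : W → ℂ} (hf : Integrable f) : Continuous (𝓕 f) :=
  VectorFourier.fourierIntegral_continuous Real.continuous_fourierChar
    (by exact continuous_inner) hf

lemma integral_mul_fourier {f g : W → ℂ} (hf : Integrable f) (hg : Integrable g) :
    ∫ x, 𝓕 f x * g x = ∫ x, f x * 𝓕 g x := by
  have := VectorFourier.integral_fourierIntegral_smul_eq_flip (L := innerₗ W) (μ := volume)
    (ν := volume) Real.continuous_fourierChar (by exact continuous_inner) hf hg
  rw [flip_innerₗ] at this
  exact this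

/-- Two locally integrable functions with the same integrals against Schwartz functions agree
almost everywhere. -/
lemma ae_eq_of_integral_schwartz_mul_eq {f g : W → ℂ} (hf : LocallyIntegrable f)
    (hg : LocallyIntegrable g) (h : ∀ ψ : 𝓢(W, ℂ), ∫ x, ψ x * f x = ∫ x, ψ x * g x) :
    f =ᵐ[volume] g := by
  refine ae_eq_of_integral_contDiff_smul_eq hf hg fun ψ hψ hc => ?_
  have h₁ : HasCompactSupport (Complex.ofRealCLM ∘ ψ) := hc.comp_left rfl
  have h₂ : ContDiff ℝ ∞ (Complex.ofRealCLM ∘ ψ) := by fun_prop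
  simpa using h (h₁.toSchwartzMap h₂)

/-- The `L²` Fourier transform of an integrable function is given by the Fourier integral. -/
lemma coeFn_fourier_toLp {f : W → ℂ} (hf : Integrable f) (hf2 : MemLp f 2) :
    ((𝓕 (hf2.toLp f) : Lp ℂ 2 (volume : Measure W)) : W → ℂ) =ᵐ[volume] 𝓕 f := by
  refine ae_eq_of_integral_schwartz_mul_eq ((Lp.memLp _).locallyIntegrable (by norm_num))
    (continuous_fourier hf).locallyIntegrable fun ψ => ?_
  have h1 : ∫ x, ψ x * (𝓕 (hf2.toLp f) : Lp ℂ 2 (volume : Measure W)) x =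
      ∫ x, (𝓕 ψ) x * (hf2.toLp f) x := by
    have := Lp.fourier_toTemperedDistribution_eq (hf2.toLp f)
    have := congrArg (fun T => T ψ) this
    simpa using this.symm
  rw [h1, SchwartzMap.fourier_coe, ← integral_mul_fourier ψ.integrable hf]
  refine integral_congr_ae ?_
  filter_upwards [hf2.coeFn_toLp] with x hx
  rw [hx]

/-- Plancherel's formula for functions in `L¹ ∩ L²`. -/
lemma lintegral_enorm_fourier_sq {f : W → ℂ} (hf : Integrable f) (hf2 : MemLp f 2) :
    ∫⁻ x, ‖𝓕 f x‖ₑ ^ 2 = ∫⁻ x, ‖f x‖ₑ ^ 2 := by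
  have key : eLpNorm (𝓕 f) 2 volume = eLpNorm f 2 volume := by
    rw [← eLpNorm_congr_ae (coeFn_fourier_toLp hf hf2), ← Lp.enorm_def,
      ← eLpNorm_congr_ae hf2.coeFn_toLp, ← Lp.enorm_def]
    rw [← ofReal_norm, ← ofReal_norm, Lp.norm_fourier_eq]
  have h := congrArg (fun a : ℝ≥0∞ => a ^ (2 : ℝ)) key
  have h2 : ∀ a : ℝ≥0∞, (a ^ (2 : ℝ)⁻¹) ^ 2 = a := fun a => by
    rw [← ENNReal.rpow_natCast, ← ENNReal.rpow_mul]; simp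
  simpa [eLpNorm_eq_lintegral_rpow_enorm_toReal, h2] using h

lemma ae_eq_zero_of_fourier_eq_zero {f : W → ℂ} (hf : Integrable f) (h : ∀ x, 𝓕 f x = 0) :
    f =ᵐ[volume] 0 := by
  refine ae_eq_of_integral_schwartz_mul_eq hf.locallyIntegrable
    (integrable_zero _ _ _).locallyIntegrable fun ψ => ?_
  have h1 := integral_mul_fourier hf (𝓕⁻ ψ).integrable
  have h2 : 𝓕 ((𝓕⁻ ψ : 𝓢(W, ℂ)) : W → ℂ) = ψ := by
    rw [← SchwartzMap.fourier_coe, FourierTransform.fourier_fourierInv_eq]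
  rw [h2] at h1
  simp only [h, zero_mul, integral_zero] at h1
  simpa [mul_comm] using h1.symm

lemma conj_fourier_conj (f : W → ℂ) (w : W) :
    starRingEnd ℂ (𝓕 (fun t => starRingEnd ℂ (f t)) w) = 𝓕⁻ f w := by
  rw [Real.fourier_eq', Real.fourierInv_eq', ← integral_conj]
  congr 1
  ext t
  simp [← Complex.exp_conj, Complex.conj_ofNat]

lemma memLp_conj {f : W → ℂ} (hf : MemLp f 2) : MemLp (fun t => starRingEnd ℂ (f t)) 2 :=
  hf.of_le (Complex.continuous_conj.comp_aestronglyMeasurable hf.1)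
    (Filter.Eventually.of_forall fun x => by simp)

/-- The inverse `L²` Fourier transform may be moved to a factor in `L¹ ∩ L²`. -/
lemma integral_fourierInv_mul {u : Lp ℂ 2 (volume : Measure W)} {θ : W → ℂ}
    (hθ : Integrable θ) (hθ2 : MemLp θ 2) :
    ∫ t, (𝓕⁻ u : Lp ℂ 2 (volume : Measure W)) t * θ t = ∫ w, u w * 𝓕⁻ θ w := by
  have hc2 := memLp_conj hθ2
  have hc : Integrable (fun t => starRingEnd ℂ (θ t)) :=
    hθ.mono (Complex.continuous_conj.comp_aestronglyMeasurable hθ.1)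
      (Filter.Eventually.of_forall fun x => by simp)
  have h := Lp.inner_fourier_eq (hc2.toLp _) (𝓕⁻ u : Lp ℂ 2 (volume : Measure W))
  rw [FourierTransform.fourier_fourierInv_eq, L2.inner_def, L2.inner_def] at h
  calc _ = ∫ t, inner ℂ ((hc2.toLp _ : Lp ℂ 2 (volume : Measure W)) t)
        ((𝓕⁻ u : Lp ℂ 2 (volume : Measure W)) t) := by
        refine integral_congr_ae ?_
        filter_upwards [hc2.coeFn_toLp] with t ht
        rw [ht]; simp
    _ = _ := by
        rw [← h]
        refine integral_congr_ae ?_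
        filter_upwards [coeFn_fourier_toLp hc hc2] with t ht
        rw [ht, ← conj_fourier_conj]; simp

end Fourier

/-! ### The decomposition `ℂ^d = ℝ^d + i ℝ^d` -/

section Tube

variable {d : ℕ}

/-- The point `x + i y` of `ℂ^d`. -/
def tubePoint (x y : EuclideanSpace ℝ (Fin d)) : EuclideanSpace ℂ (Fin d) :=
  complexify d x + Complex.I • complexify d y

@[simp] lemma complexify_apply (x : EuclideanSpace ℝ (Fin d)) (i : Fin d) :
    complexify d x i = (x i : ℂ) := rfl

lemma tubePoint_apply (x y : EuclideanSpace ℝ (Fin d)) (i : Fin d) :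
    tubePoint x y i = (x i : ℂ) + Complex.I * y i := by
  simp [tubePoint]

lemma tubePoint_add (x y x' y' : EuclideanSpace ℝ (Fin d)) :
    tubePoint (x + x') (y + y') = tubePoint x y + tubePoint x' y' := by
  ext i; simp [tubePoint_apply]; ring

lemma tubePoint_smul (c : ℝ) (x y : EuclideanSpace ℝ (Fin d)) :
    tubePoint (c • x) (c • y) = (c : ℂ) • tubePoint x y := by
  ext i; simp [tubePoint_apply]; ring

lemma tubePoint_zero_right (x : EuclideanSpace ℝ (Fin d)) : tubePoint x 0 = complexify d x := by
  simp [tubePoint]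

/-- The coordinatewise real part. -/
def rePart (z : EuclideanSpace ℂ (Fin d)) : EuclideanSpace ℝ (Fin d) :=
  WithLp.toLp 2 fun i => (z i).re

/-- The coordinatewise imaginary part. -/
def imPart (z : EuclideanSpace ℂ (Fin d)) : EuclideanSpace ℝ (Fin d) :=
  WithLp.toLp 2 fun i => (z i).im

lemma tubePoint_rePart_imPart (z : EuclideanSpace ℂ (Fin d)) :
    tubePoint (rePart z) (imPart z) = z := by
  ext i
  simp only [tubePoint_apply, rePart, imPart]
  rw [mul_comm, Complex.re_add_im]

@[simp] lemma rePart_tubePoint (x y : EuclideanSpace ℝ (Fin d)) : rePart (tubePoint x y) = x := by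
  ext i; simp [rePart, tubePoint_apply]

@[simp] lemma imPart_tubePoint (x y : EuclideanSpace ℝ (Fin d)) : imPart (tubePoint x y) = y := by
  ext i; simp [imPart, tubePoint_apply]

lemma norm_tubePoint_sq (x y : EuclideanSpace ℝ (Fin d)) :
    ‖tubePoint x y‖ ^ 2 = ‖x‖ ^ 2 + ‖y‖ ^ 2 := by
  rw [EuclideanSpace.norm_sq_eq, EuclideanSpace.norm_sq_eq, EuclideanSpace.norm_sq_eq,
    ← Finset.sum_add_distrib]
  refine Finset.sum_congr rfl fun i _ => ?_
  rw [tubePoint_apply, ← Complex.normSq_eq_norm_sq, Complex.normSq_apply]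
  simp; ring

/-- The isometric identification of `ℝ^d × ℝ^d` with `ℂ^d`. -/
def tubeEquiv (d : ℕ) : WithLp 2 (EuclideanSpace ℝ (Fin d) × EuclideanSpace ℝ (Fin d)) ≃ₗᵢ[ℝ]
    EuclideanSpace ℂ (Fin d) where
  toFun p := tubePoint p.fst p.snd
  invFun z := WithLp.toLp 2 (rePart z, imPart z)
  map_add' p q := tubePoint_add _ _ _ _
  map_smul' c p := by
    rw [WithLp.smul_fst, WithLp.smul_snd, tubePoint_smul]
    ext i; simp
  left_inv p := by
    simp only [rePart_tubePoint, imPart_tubePoint]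
    rfl
  right_inv z := tubePoint_rePart_imPart z
  norm_map' p := by
    have h := norm_tubePoint_sq p.fst p.snd
    rw [← sq_eq_sq₀ (norm_nonneg _) (norm_nonneg _), WithLp.prod_norm_sq_eq_of_L2]
    exact h

lemma measurePreserving_tubePoint :
    MeasurePreserving (fun p : EuclideanSpace ℝ (Fin d) × EuclideanSpace ℝ (Fin d) =>
      tubePoint p.1 p.2) :=
  (tubeEquiv d).measurePreserving.comp (WithLp.volume_preserving_toLp _ _)

lemma continuous_tubePoint :
    Continuous (fun p : EuclideanSpace ℝ (Fin d) × EuclideanSpace ℝ (Fin d) =>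
      tubePoint p.1 p.2) :=
  (tubeEquiv d).continuous.comp (WithLp.prod_continuous_toLp 2 _ _)

lemma continuous_complexify : Continuous (complexify d) := by
  have := continuous_tubePoint.comp
    (continuous_id.prodMk (continuous_const (y := (0 : EuclideanSpace ℝ (Fin d)))))
  simpa [Function.comp_def, tubePoint_zero_right] using this

lemma continuous_rePart : Continuous (rePart (d := d)) := by
  have h : Continuous (fun z => (((tubeEquiv d).symm z).fst)) := by fun_prop
  exact h

/-- Tonelli's theorem for the decomposition `ℂ^d = ℝ^d + i ℝ^d`. -/
lemma lintegral_tube {f : EuclideanSpace ℂ (Fin d) → ℝ≥0∞} (hf : AEMeasurable f) :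
    ∫⁻ z, f z = ∫⁻ x, ∫⁻ y, f (tubePoint x y) := by
  have he : MeasurableEmbedding fun p : EuclideanSpace ℝ (Fin d) × EuclideanSpace ℝ (Fin d) =>
      tubePoint p.1 p.2 :=
    (tubeEquiv d).toHomeomorph.measurableEmbedding.comp
      (MeasurableEquiv.toLp 2 _).measurableEmbedding
  rw [← measurePreserving_tubePoint.lintegral_comp_emb he, Measure.volume_eq_prod]
  exact lintegral_prod _ (hf.comp_quasiMeasurePreserving
    measurePreserving_tubePoint.quasiMeasurePreserving)

lemma quasiMeasurePreserving_rePart :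
    Measure.QuasiMeasurePreserving (rePart (d := d)) volume volume := by
  have h1 : MeasurePreserving (fun z => WithLp.ofLp ((tubeEquiv d).symm z)) :=
    (WithLp.volume_preserving_ofLp _ _).comp (tubeEquiv d).symm.measurePreserving
  exact Measure.quasiMeasurePreserving_fst.comp h1.quasiMeasurePreserving

/-! ### The bilinear and the hermitian form -/

lemma bilin_add_left (z z' w : EuclideanSpace ℂ (Fin d)) :
    bilin (z + z') w = bilin z w + bilin z' w := by
  simp [bilin, add_mul, Finset.sum_add_distrib]

lemma bilin_smul_left (c : ℂ) (z w : EuclideanSpace ℂ (Fin d)) :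
    bilin (c • z) w = c * bilin z w := by
  simp [bilin, Finset.mul_sum, mul_assoc]

lemma bilin_comm (z w : EuclideanSpace ℂ (Fin d)) : bilin z w = bilin w z := by
  simp [bilin, mul_comm]

lemma bilin_add_right (z w w' : EuclideanSpace ℂ (Fin d)) :
    bilin z (w + w') = bilin z w + bilin z w' := by
  rw [bilin_comm, bilin_add_left, bilin_comm w, bilin_comm w']

lemma bilin_smul_right (c : ℂ) (z w : EuclideanSpace ℂ (Fin d)) :
    bilin z (c • w) = c * bilin z w := by
  rw [bilin_comm, bilin_smul_left, bilin_comm w]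

lemma bilin_complexify (x y : EuclideanSpace ℝ (Fin d)) :
    bilin (complexify d x) (complexify d y) = (inner ℝ x y : ℝ) := by
  simp [bilin, PiLp.inner_apply, mul_comm]

lemma bilin_tubePoint_complexify (x y t : EuclideanSpace ℝ (Fin d)) :
    bilin (tubePoint x y) (complexify d t) =
      (inner ℝ x t : ℝ) + Complex.I * (inner ℝ y t : ℝ) := by
  rw [tubePoint, bilin_add_left, bilin_smul_left, bilin_complexify, bilin_complexify]

lemma bilin_tubePoint_self (x y : EuclideanSpace ℝ (Fin d)) :
    bilin (tubePoint x y) (tubePoint x y) =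
      ((‖x‖ ^ 2 - ‖y‖ ^ 2 : ℝ) : ℂ) + 2 * Complex.I * (inner ℝ x y : ℝ) := by
  have h : tubePoint x y = complexify d x + Complex.I • complexify d y := rfl
  rw [h]
  simp only [bilin_add_left, bilin_smul_left, bilin_add_right, bilin_smul_right, bilin_complexify,
    real_inner_self_eq_norm_sq, real_inner_comm x y]
  push_cast
  linear_combination ((‖y‖ : ℂ) ^ 2) * Complex.I_mul_I

lemma herm_self (z : EuclideanSpace ℂ (Fin d)) : herm z z = ((‖z‖ ^ 2 : ℝ) : ℂ) := by
  rw [EuclideanSpace.norm_sq_eq]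
  push_cast
  refine Finset.sum_congr rfl fun i _ => ?_
  rw [Complex.mul_conj, Complex.normSq_eq_norm_sq]; push_cast; rfl

lemma herm_complexify (z : EuclideanSpace ℂ (Fin d)) (x : EuclideanSpace ℝ (Fin d)) :
    herm z (complexify d x) = bilin z (complexify d x) := by
  simp [herm, bilin]

lemma norm_complexify (x : EuclideanSpace ℝ (Fin d)) : ‖complexify d x‖ = ‖x‖ := by
  have h := norm_tubePoint_sq x 0
  rw [tubePoint_zero_right] at h
  rw [← sq_eq_sq₀ (norm_nonneg _) (norm_nonneg _), h]; simp

lemma norm_bilin_le (z w : EuclideanSpace ℂ (Fin d)) : ‖bilin z w‖ ≤ ‖z‖ * ‖w‖ := by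
  have h : bilin z w = inner ℂ (WithLp.toLp 2 fun i => starRingEnd ℂ (z i)) w := by
    simp [bilin, PiLp.inner_apply, mul_comm]
  have h2 : ‖(WithLp.toLp 2 fun i => starRingEnd ℂ (z i) : EuclideanSpace ℂ (Fin d))‖ = ‖z‖ := by
    rw [EuclideanSpace.norm_eq, EuclideanSpace.norm_eq]; simp
  rw [h, ← h2]
  exact norm_inner_le_norm _ _

/-- The form `bilin` as a continuous linear map in the first variable. -/
def bilinCLM (w : EuclideanSpace ℂ (Fin d)) : EuclideanSpace ℂ (Fin d) →L[ℂ] ℂ :=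
  LinearMap.mkContinuous
    { toFun := fun z => bilin z w
      map_add' := fun z z' => bilin_add_left z z' w
      map_smul' := fun c z => bilin_smul_left c z w } ‖w‖ fun z => by
    rw [mul_comm]; exact norm_bilin_le z w

@[simp] lemma bilinCLM_apply (z w : EuclideanSpace ℂ (Fin d)) : bilinCLM w z = bilin z w := rfl

lemma norm_bilinCLM_le (w : EuclideanSpace ℂ (Fin d)) : ‖bilinCLM w‖ ≤ ‖w‖ :=
  LinearMap.mkContinuous_norm_le _ (norm_nonneg _) _

lemma differentiable_bilin_self :
    Differentiable ℂ fun z : EuclideanSpace ℂ (Fin d) => bilin z z := by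
  unfold bilin; fun_prop

lemma continuous_bilin :
    Continuous fun p : EuclideanSpace ℂ (Fin d) × EuclideanSpace ℂ (Fin d) => bilin p.1 p.2 := by
  unfold bilin; fun_prop

end Tube

/-! ### Entire functions: mean values and vertical integrals -/

section MeanValue

variable {d : ℕ}

/-- Multiplication by `e^{iθ}` as a real linear isometry of `ℂ^d`. -/
def phaseRotation (θ : ℝ) : EuclideanSpace ℂ (Fin d) ≃ₗᵢ[ℝ] EuclideanSpace ℂ (Fin d) where
  toFun u := Complex.exp (θ * Complex.I) • u
  invFun u := Complex.exp (-(θ * Complex.I)) • u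
  map_add' := smul_add _
  map_smul' c u := smul_comm _ _ _
  left_inv u := by simp [smul_smul, ← Complex.exp_add]
  right_inv u := by simp [smul_smul, ← Complex.exp_add]
  norm_map' u := by
    change ‖Complex.exp (θ * Complex.I) • u‖ = ‖u‖
    rw [norm_smul, Complex.norm_exp_ofReal_mul_I, one_mul]

/-- The mean value property over balls of `ℂ^d`: average the one-variable mean value property on
the circles `z + e^{iθ} u` over `u`, and use the rotation invariance of the ball. -/
lemma setIntegral_ball_of_differentiable {f : EuclideanSpace ℂ (Fin d) → ℂ}
    (hf : Differentiable ℂ f) (z : EuclideanSpace ℂ (Fin d)) (r : ℝ) :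
    ∫ u in Metric.ball 0 r, f (z + u) =
      volume.real (Metric.ball (0 : EuclideanSpace ℂ (Fin d)) r) * f z := by
  set b : Set (EuclideanSpace ℂ (Fin d)) := Metric.ball 0 r with hb
  have hcirc : ∀ u, ∫ θ in (0)..(2 * Real.pi), f (z + phaseRotation θ u) = 2 * Real.pi * f z := by
    intro u
    have hg : Differentiable ℂ fun s : ℂ => f (z + s • u) := by fun_prop
    have h := hg.diffContOnCl.circleAverage (c := 0) (R := 1)
    rw [Real.circleAverage_def] at h
    have hpi : (2 * Real.pi : ℂ) ≠ 0 := by exact_mod_cast Real.two_pi_pos.ne'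
    simp only [circleMap, zero_add, Complex.ofReal_one, one_mul, zero_smul, add_zero] at h
    rw [← h, Complex.real_smul]
    push_cast
    rw [mul_inv_cancel_left₀ hpi]
    rfl
  have hrot : ∀ θ, ∫ u in b, f (z + phaseRotation θ u) = ∫ u in b, f (z + u) := by
    intro θ
    have hpre : (phaseRotation θ : EuclideanSpace ℂ (Fin d) → _) ⁻¹' b = b := by
      ext u; simp [hb]
    have h := (phaseRotation (d := d) θ).measurePreserving.setIntegral_preimage_emb
      (phaseRotation (d := d) θ).toHomeomorph.measurableEmbedding (fun u => f (z + u)) b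
    rw [hpre] at h
    exact h
  have hcont : Continuous (Function.uncurry fun (θ : ℝ) u => f (z + phaseRotation θ u)) := by
    have h1 : Continuous fun p : ℝ × EuclideanSpace ℂ (Fin d) =>
        Complex.exp (p.1 * Complex.I) • p.2 := by fun_prop
    exact hf.continuous.comp (continuous_const.add h1)
  have hint : Integrable (Function.uncurry fun (θ : ℝ) u => f (z + phaseRotation θ u))
      ((volume.restrict (Set.uIoc 0 (2 * Real.pi))).prod (volume.restrict b)) := by
    rw [Measure.prod_restrict]
    refine (hcont.continuousOn.integrableOn_compact (K := Set.uIcc 0 (2 * Real.pi) ×ˢ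
      Metric.closedBall 0 r) (isCompact_uIcc.prod (isCompact_closedBall _ _))).mono_set ?_
    exact Set.prod_mono Set.uIoc_subset_uIcc Metric.ball_subset_closedBall
  have hswap := intervalIntegral_integral_swap hint
  simp only [hrot, hcirc] at hswap
  simp only [intervalIntegral.integral_const, setIntegral_const, sub_zero] at hswap
  have hpi : (2 * Real.pi : ℂ) ≠ 0 := by exact_mod_cast Real.two_pi_pos.ne'
  simp only [Complex.real_smul] at hswap
  push_cast at hswap
  apply mul_left_cancel₀ hpi
  rw [hswap]; ring

/-- A pointwise bound for an entire function by its `L²` norm over a ball. -/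
lemma enorm_sq_le_lintegral_ball {f : EuclideanSpace ℂ (Fin d) → ℂ}
    (hf : Differentiable ℂ f) (z : EuclideanSpace ℂ (Fin d)) {r : ℝ} (hr : 0 < r) :
    ‖f z‖ₑ ^ 2 ≤ (volume (Metric.ball (0 : EuclideanSpace ℂ (Fin d)) r))⁻¹ *
      ∫⁻ u in Metric.ball z r, ‖f u‖ₑ ^ 2 := by
  set b : Set (EuclideanSpace ℂ (Fin d)) := Metric.ball 0 r with hb
  have hb0 : volume b ≠ 0 := (Metric.measure_ball_pos _ _ hr).ne'
  have hbt : volume b ≠ ∞ := measure_ball_lt_top.ne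
  have h := setIntegral_ball_of_differentiable (hf.pow 2) z r
  have h1 : volume b * ‖f z‖ₑ ^ 2 = ‖∫ u in b, (f ^ 2) (z + u)‖ₑ := by
    rw [h, enorm_mul]
    simp only [Pi.pow_apply, enorm_pow]
    congr 1
    rw [← ofReal_norm, Complex.norm_real, Real.norm_of_nonneg measureReal_nonneg, measureReal_def,
      ENNReal.ofReal_toReal hbt]
  have h2 : ∫⁻ u in b, ‖f (z + u)‖ₑ ^ 2 = ∫⁻ u in Metric.ball z r, ‖f u‖ₑ ^ 2 := by
    have hpre : (fun u => z + u) ⁻¹' Metric.ball z r = b := by ext u; simp [hb]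
    rw [← hpre]
    exact (measurePreserving_add_left volume z).setLIntegral_comp_preimage
      Metric.isOpen_ball.measurableSet (f := fun u => ‖f u‖ₑ ^ 2)
      (hf.continuous.enorm.measurable.pow_const 2)
  rw [← ENNReal.mul_le_mul_iff_right hb0 hbt, ← mul_assoc, ENNReal.mul_inv_cancel hb0 hbt, one_mul,
    h1, ← h2]
  refine (enorm_integral_le_lintegral_enorm _).trans_eq ?_
  simp [enorm_pow]

/-- Vertical integrals of an entire function do not depend on the real part. The integral over
`a + σ b + i ℝ^d`, with `b` real, is a holomorphic function of `σ ∈ ℂ` which does not change when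
`σ` is shifted by an imaginary number, so it is constant. -/
lemma integral_vertical_eq {P : EuclideanSpace ℂ (Fin d) → ℂ} (hP : Differentiable ℂ P)
    (hbound : ∀ z₀, ∃ δ > 0, ∃ g : EuclideanSpace ℝ (Fin d) → ℝ, Integrable g ∧
      ∀ z ∈ Metric.ball z₀ δ, ∀ y, ‖P (z + tubePoint 0 y)‖ ≤ g y)
    (s s' : EuclideanSpace ℝ (Fin d)) :
    ∫ y, P (tubePoint s y) = ∫ y, P (tubePoint s' y) := by
  set c : ℂ → EuclideanSpace ℂ (Fin d) := fun σ => complexify d s + σ • complexify d (s' - s)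
    with hc
  have hcd : Differentiable ℂ c := by fun_prop
  have hct : Continuous fun y : EuclideanSpace ℝ (Fin d) => tubePoint 0 y :=
    continuous_tubePoint.comp (continuous_const.prodMk continuous_id)
  have hmeas : ∀ σ, AEStronglyMeasurable (fun y => P (c σ + tubePoint 0 y)) volume := fun σ =>
    (hP.continuous.comp (continuous_const.add hct)).aestronglyMeasurable
  set h : ℂ → ℂ := fun σ => ∫ y, P (c σ + tubePoint 0 y) with hh
  have hdiff : Differentiable ℂ h := by
    intro σ₀
    obtain ⟨δ, hδ, g, hg, hgb⟩ := hbound (c σ₀)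
    obtain ⟨ρ, hρ, hρb⟩ := Metric.mem_nhds_iff.1
      (hcd.continuous.continuousAt (x := σ₀) |>.preimage_mem_nhds (Metric.ball_mem_nhds _ hδ))
    have hderiv : ∀ y, ∀ σ ∈ Metric.ball σ₀ (ρ / 2),
        HasDerivAt (fun σ => P (c σ + tubePoint 0 y))
          (deriv (fun σ => P (c σ + tubePoint 0 y)) σ) σ := fun y σ _ =>
      ((hP.comp (hcd.add_const _)) σ).hasDerivAt
    have hsub : ∀ σ ∈ Metric.ball σ₀ (ρ / 2), Metric.closedBall σ (ρ / 4) ⊆ Metric.ball σ₀ ρ := by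
      intro σ hσ w hw
      rw [Metric.mem_ball] at *
      rw [Metric.mem_closedBall] at hw
      linarith [dist_triangle w σ σ₀]
    have hdb : ∀ y, ∀ σ ∈ Metric.ball σ₀ (ρ / 2),
        ‖deriv (fun σ => P (c σ + tubePoint 0 y)) σ‖ ≤ g y / (ρ / 4) := by
      intro y σ hσ
      refine Complex.norm_deriv_le_of_forall_mem_sphere_norm_le (by positivity)
        (Differentiable.diffContOnCl (hP.comp (hcd.add_const _))) fun w hw => ?_
      exact hgb _ (hρb (hsub σ hσ (Metric.sphere_subset_closedBall hw))) y
    refine (hasDerivAt_integral_of_dominated_loc_of_deriv_le (μ := volume)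
      (bound := fun y => g y / (ρ / 4)) (Metric.ball_mem_nhds σ₀ (half_pos hρ))
      (Filter.Eventually.of_forall hmeas)
      (hg.mono' (hmeas σ₀) (Filter.Eventually.of_forall fun y =>
        hgb _ (Metric.mem_ball_self hδ) y)) ?_
      (Filter.Eventually.of_forall hdb) (hg.div_const _)
      (Filter.Eventually.of_forall hderiv)).2.differentiableAt
    -- the derivative is measurable in `y`, as a value of the continuous function `z ↦ P' z`
    have hd : ∀ y, deriv (fun σ => P (c σ + tubePoint 0 y)) σ₀ =
        fderiv ℂ P (c σ₀ + tubePoint 0 y) (complexify d (s' - s)) := by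
      intro y
      have h1 : HasDerivAt (fun σ => c σ + tubePoint 0 y) (complexify d (s' - s)) σ₀ := by
        have := ((hasDerivAt_id σ₀).smul_const (complexify d (s' - s))).const_add (complexify d s)
        simpa [hc] using this.add_const (tubePoint 0 y)
      exact ((hP _).hasFDerivAt.comp_hasDerivAt σ₀ h1).deriv
    simp only [hd]
    have hm : Measurable fun y => fderiv ℂ P (c σ₀ + tubePoint 0 y) :=
      (measurable_fderiv ℂ P).comp ((continuous_const.add hct).measurable)
    exact (hm.apply_continuousLinearMap _).aestronglyMeasurable
  have hinv : ∀ (σ : ℂ) (τ : ℝ), h (σ + τ * Complex.I) = h σ := by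
    intro σ τ
    have : ∀ y, c (σ + τ * Complex.I) + tubePoint 0 y =
        c σ + tubePoint 0 (y + τ • (s' - s)) := by
      intro y
      ext i; simp [hc, tubePoint_apply]; ring
    simp only [hh, this]
    exact integral_add_right_eq_self (fun y => P (c σ + tubePoint 0 y)) (τ • (s' - s))
  -- the derivative along the imaginary axis vanishes, and it is `i` times the derivative
  have hderiv0 : ∀ σ, deriv h σ = 0 := by
    intro σ
    have h1 : HasDerivAt (fun τ : ℝ => h (σ + τ * Complex.I)) (deriv h σ * Complex.I) 0 := by
      have h2 : HasDerivAt (fun τ : ℝ => σ + τ * Complex.I) Complex.I 0 := by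
        simpa using ((Complex.ofRealCLM.hasDerivAt (x := (0 : ℝ))).mul_const Complex.I).const_add σ
      have h3 : HasDerivAt h (deriv h σ) (σ + (0 : ℝ) * Complex.I) := by
        simpa using (hdiff σ).hasDerivAt
      exact h3.comp_of_eq 0 h2 rfl
    simp only [hinv] at h1
    have := h1.unique (hasDerivAt_const (0 : ℝ) (h σ))
    simpa using this
  have hconst := is_const_of_deriv_eq_zero hdiff hderiv0 0 1
  have e0 : ∀ y, c 0 + tubePoint 0 y = tubePoint s y := by
    intro y; ext i; simp [hc, tubePoint_apply]
  have e1 : ∀ y, c 1 + tubePoint 0 y = tubePoint s' y := by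
    intro y; ext i; simp [hc, tubePoint_apply]
  simpa only [hh, e0, e1] using hconst

end MeanValue

/-! ### A Paley–Wiener lemma -/

section PaleyWiener

variable {d : ℕ}

lemma integrable_exp_neg_mul_sq_add_inner {b : ℝ} (hb : 0 < b) (s : EuclideanSpace ℝ (Fin d)) :
    Integrable fun t => Real.exp (-b * ‖t‖ ^ 2 + inner ℝ s t) := by
  have h := (GaussianFourier.integrable_cexp_neg_mul_sq_norm_add (b := (b : ℂ)) (by simpa using hb)
    1 s).norm
  refine h.congr (Filter.Eventually.of_forall fun t => ?_)
  simp only [Complex.norm_exp]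
  congr 1
  rw [one_mul]
  norm_cast

lemma memLp_exp_neg_mul_sq_add_inner {b : ℝ} (hb : 0 < b) (s : EuclideanSpace ℝ (Fin d)) :
    MemLp (fun t => Real.exp (-b * ‖t‖ ^ 2 + inner ℝ s t)) 2 := by
  rw [memLp_two_iff_integrable_sq (Continuous.aestronglyMeasurable (by fun_prop))]
  refine (integrable_exp_neg_mul_sq_add_inner (b := 2 * b) (by positivity)
    ((2 : ℝ) • s)).congr (Filter.Eventually.of_forall fun t => ?_)
  simp only [← Real.exp_nat_mul, inner_smul_left]
  congr 1
  simp; ring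

lemma integral_cexp_neg_pi_mul_sq_add_bilin (z : EuclideanSpace ℂ (Fin d)) :
    ∫ t : EuclideanSpace ℝ (Fin d), Complex.exp (-Real.pi * ‖t‖ ^ 2 + bilin z (complexify d t)) =
      Complex.exp (bilin z z / (4 * Real.pi)) := by
  have hpi : (Real.pi : ℂ) ≠ 0 := by exact_mod_cast Real.pi_ne_zero
  have h := GaussianFourier.integral_cexp_neg_mul_sum_add (b := (Real.pi : ℂ))
    (by simpa using Real.pi_pos) (fun i => z i)
  rw [div_self hpi, Complex.one_cpow, one_mul] at h
  have h2 : bilin z z = ∑ i, z i ^ 2 := by simp [bilin, sq]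
  rw [h2, ← h, ← (PiLp.volume_preserving_toLp (Fin d)).integral_comp
    (MeasurableEquiv.toLp 2 _).measurableEmbedding]
  congr 1
  ext t
  simp only [bilin, complexify_apply]
  rw [← Complex.ofReal_pow, EuclideanSpace.real_norm_sq_eq]
  push_cast
  rfl

/-- The entire function `ζ ↦ exp ((ζ + 2πiη)² / 4π)`, the Laplace transform of a modulated
Gaussian. -/
def gaussianLaplace (η : EuclideanSpace ℝ (Fin d)) (ζ : EuclideanSpace ℂ (Fin d)) : ℂ :=
  Complex.exp (bilin (ζ + tubePoint 0 ((2 * Real.pi) • η)) (ζ + tubePoint 0 ((2 * Real.pi) • η)) /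
    (4 * Real.pi))

/-- The Gaussian whose inverse Fourier transform is a vertical slice of `gaussianLaplace η`. -/
def modulatedGaussian (s η t : EuclideanSpace ℝ (Fin d)) : ℂ :=
  Real.exp (-Real.pi * ‖t‖ ^ 2 + inner ℝ (-s) t) *
    Complex.exp (-(2 * Real.pi * Complex.I * (inner ℝ η t : ℝ)))

lemma norm_modulatedGaussian (s η t : EuclideanSpace ℝ (Fin d)) :
    ‖modulatedGaussian s η t‖ = Real.exp (-Real.pi * ‖t‖ ^ 2 + inner ℝ (-s) t) := by
  rw [modulatedGaussian, norm_mul, Complex.norm_real, Real.norm_of_nonneg (Real.exp_pos _).le,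
    Complex.norm_exp]
  simp

lemma continuous_modulatedGaussian (s η : EuclideanSpace ℝ (Fin d)) :
    Continuous (modulatedGaussian s η) := by
  unfold modulatedGaussian; fun_prop

lemma integrable_modulatedGaussian (s η : EuclideanSpace ℝ (Fin d)) :
    Integrable (modulatedGaussian s η) :=
  (integrable_exp_neg_mul_sq_add_inner Real.pi_pos (-s)).mono'
    (continuous_modulatedGaussian s η).aestronglyMeasurable
    (Filter.Eventually.of_forall fun t => (norm_modulatedGaussian s η t).le)

lemma memLp_modulatedGaussian (s η : EuclideanSpace ℝ (Fin d)) :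
    MemLp (modulatedGaussian s η) 2 :=
  (memLp_exp_neg_mul_sq_add_inner Real.pi_pos (-s)).of_le
    (continuous_modulatedGaussian s η).aestronglyMeasurable
    (Filter.Eventually.of_forall fun t => by
      rw [norm_modulatedGaussian]; exact le_abs_self _)

lemma fourierInv_modulatedGaussian (s η w : EuclideanSpace ℝ (Fin d)) :
    𝓕⁻ (modulatedGaussian s η) w = gaussianLaplace η (tubePoint s (-(2 * Real.pi) • w)) := by
  have h := integral_cexp_neg_pi_mul_sq_add_bilin (tubePoint (-s) ((2 * Real.pi) • (w - η)))
  have h2 : bilin (tubePoint (-s) ((2 * Real.pi) • (w - η)))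
      (tubePoint (-s) ((2 * Real.pi) • (w - η))) =
      bilin (tubePoint s (-(2 * Real.pi) • w) + tubePoint 0 ((2 * Real.pi) • η))
        (tubePoint s (-(2 * Real.pi) • w) + tubePoint 0 ((2 * Real.pi) • η)) := by
    have : tubePoint s (-(2 * Real.pi) • w) + tubePoint 0 ((2 * Real.pi) • η) =
        (-1 : ℂ) • tubePoint (-s) ((2 * Real.pi) • (w - η)) := by
      ext i; simp [tubePoint_apply]; ring
    rw [this, bilin_smul_left, bilin_smul_right]; ring
  rw [gaussianLaplace, ← h2, ← h, Real.fourierInv_eq']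
  congr 1
  ext t
  rw [modulatedGaussian, smul_eq_mul, bilin_tubePoint_complexify]
  rw [Complex.ofReal_exp, ← Complex.exp_add, ← Complex.exp_add]
  congr 1
  simp only [inner_smul_left, inner_sub_left, inner_neg_left, real_inner_comm w t]
  simp
  ring

lemma differentiable_gaussianLaplace (η : EuclideanSpace ℝ (Fin d)) :
    Differentiable ℂ (gaussianLaplace η) := by
  unfold gaussianLaplace
  have h := (differentiable_bilin_self (d := d)).comp
    (differentiable_id.add_const (tubePoint 0 ((2 * Real.pi) • η)))
  simp only [div_eq_mul_inv]
  exact (h.mul_const _).cexp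

lemma norm_gaussianLaplace (η x y : EuclideanSpace ℝ (Fin d)) :
    ‖gaussianLaplace η (tubePoint x y)‖ =
      Real.exp ((‖x‖ ^ 2 - ‖y + (2 * Real.pi) • η‖ ^ 2) / (4 * Real.pi)) := by
  rw [gaussianLaplace, ← tubePoint_add, add_zero, bilin_tubePoint_self, Complex.norm_exp]
  congr 1
  have : (4 * (Real.pi : ℂ)) = ((4 * Real.pi : ℝ) : ℂ) := by push_cast; rfl
  rw [this, Complex.div_ofReal_re, Complex.add_re, Complex.ofReal_re]
  simp

/-- The function `L` on `ℂ^d` is bounded on tubes `U + i ℝ^d`, for some neighbourhood `U` of each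
point of `ℝ^d`. -/
def BoundedOnTubes (L : EuclideanSpace ℂ (Fin d) → ℂ) : Prop :=
  ∀ x₀, ∃ r > 0, ∃ C : ℝ, ∀ x ∈ Metric.ball x₀ r, ∀ y, ‖L (tubePoint x y)‖ ≤ C

lemma norm_rePart_le (z : EuclideanSpace ℂ (Fin d)) : ‖rePart z‖ ≤ ‖z‖ := by
  have h := norm_tubePoint_sq (rePart z) (imPart z)
  rw [tubePoint_rePart_imPart] at h
  exact abs_le_of_sq_le_sq' (by nlinarith [sq_nonneg ‖imPart z‖]) (norm_nonneg _) |>.2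

lemma norm_imPart_le (z : EuclideanSpace ℂ (Fin d)) : ‖imPart z‖ ≤ ‖z‖ := by
  have h := norm_tubePoint_sq (rePart z) (imPart z)
  rw [tubePoint_rePart_imPart] at h
  exact abs_le_of_sq_le_sq' (by nlinarith [sq_nonneg ‖rePart z‖]) (norm_nonneg _) |>.2

lemma rePart_sub (z z' : EuclideanSpace ℂ (Fin d)) : rePart (z - z') = rePart z - rePart z' := by
  ext i; simp [rePart]

lemma imPart_sub (z z' : EuclideanSpace ℂ (Fin d)) : imPart (z - z') = imPart z - imPart z' := by
  ext i; simp [imPart]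

/-- Vertical integrals of a function that is bounded on tubes, against the Gaussian
`gaussianLaplace η`, can be shifted: the decay of the Gaussian in the imaginary directions provides
the integrable bound that `integral_vertical_eq` asks for. -/
lemma integral_vertical_mul_gaussianLaplace_eq {L : EuclideanSpace ℂ (Fin d) → ℂ}
    (hL : Differentiable ℂ L) (hb : BoundedOnTubes L) (η s s' : EuclideanSpace ℝ (Fin d)) :
    ∫ y, L (tubePoint s y) * gaussianLaplace η (tubePoint s y) =
      ∫ y, L (tubePoint s' y) * gaussianLaplace η (tubePoint s' y) := by
  refine integral_vertical_eq (P := fun z => L z * gaussianLaplace η z)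
    (hL.mul (differentiable_gaussianLaplace η)) (fun z₀ => ?_) s s'
  obtain ⟨r, hr, C, hC⟩ := hb (rePart z₀)
  set a := imPart z₀ + (2 * Real.pi) • η with ha
  refine ⟨min r 1, by positivity, fun y => C * (Real.exp (((‖rePart z₀‖ + 1) ^ 2 + 1) /
    (4 * Real.pi)) * Real.exp (-(1 / (8 * Real.pi)) * ‖y + a‖ ^ 2)), ?_, ?_⟩
  · refine Integrable.const_mul (Integrable.const_mul ?_ _) _
    have h := integrable_exp_neg_mul_sq_add_inner (d := d) (b := 1 / (8 * Real.pi))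
      (by have := Real.pi_pos; positivity) 0
    simp only [inner_zero_left, add_zero] at h
    exact h.comp_add_right a
  · intro z hz y
    rw [Metric.mem_ball, dist_eq_norm] at hz
    have hre : ‖rePart z - rePart z₀‖ < min r 1 :=
      (rePart_sub z z₀ ▸ norm_rePart_le (z - z₀)).trans_lt hz
    have him : ‖imPart z - imPart z₀‖ < min r 1 :=
      (imPart_sub z z₀ ▸ norm_imPart_le (z - z₀)).trans_lt hz
    have hz' : z + tubePoint 0 y = tubePoint (rePart z) (imPart z + y) := by
      conv_lhs => rw [← tubePoint_rePart_imPart z, ← tubePoint_add, add_zero]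
    have h1 := hC (rePart z) (by
      rw [Metric.mem_ball, dist_eq_norm]; exact hre.trans_le (min_le_left _ _)) (imPart z + y)
    rw [hz', norm_mul, norm_gaussianLaplace]
    have hC0 : 0 ≤ C := (norm_nonneg _).trans h1
    refine mul_le_mul h1 ?_ (Real.exp_pos _).le hC0
    rw [← Real.exp_add, Real.exp_le_exp]
    have hx : ‖rePart z‖ ≤ ‖rePart z₀‖ + 1 := by
      have := norm_le_norm_add_norm_sub' (rePart z) (rePart z₀)
      linarith [min_le_right r 1]
    have hx2 : ‖rePart z‖ ^ 2 ≤ (‖rePart z₀‖ + 1) ^ 2 :=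
      pow_le_pow_left₀ (norm_nonneg _) hx 2
    have hy : ‖y + a‖ ≤ ‖imPart z + y + (2 * Real.pi) • η‖ + 1 := by
      have e : y + a = (imPart z + y + (2 * Real.pi) • η) - (imPart z - imPart z₀) := by
        rw [ha]; abel
      rw [e]
      refine (norm_sub_le _ _).trans ?_
      linarith [min_le_right r 1]
    have hy2 : ‖y + a‖ ^ 2 ≤ 2 * ‖imPart z + y + (2 * Real.pi) • η‖ ^ 2 + 2 := by
      nlinarith [norm_nonneg (y + a), norm_nonneg (imPart z + y + (2 * Real.pi) • η),
        sq_nonneg (‖imPart z + y + (2 * Real.pi) • η‖ - 1)]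
    have hpi := Real.pi_pos
    have e2 : ((‖rePart z₀‖ + 1) ^ 2 + 1) / (4 * Real.pi) + -(1 / (8 * Real.pi)) * ‖y + a‖ ^ 2 =
        ((‖rePart z₀‖ + 1) ^ 2 + 1 - ‖y + a‖ ^ 2 / 2) / (4 * Real.pi) := by
      field_simp; ring
    rw [e2]
    exact div_le_div_of_nonneg_right (by linarith) (by positivity)

/-- A Paley–Wiener statement: if an entire function is bounded on tubes and two of its vertical
slices are square integrable, then the inverse Fourier transforms of these slices differ by the
expected real exponential, so that both are slices of the Laplace transform of one function. Both
sides are tested against modulated Gaussians, which on the Fourier side is a vertical integral that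
can be shifted. -/
lemma fourierInv_slice_ae_eq {L : EuclideanSpace ℂ (Fin d) → ℂ}
    (hL : Differentiable ℂ L) (hb : BoundedOnTubes L) {s s' : EuclideanSpace ℝ (Fin d)}
    (hs : MemLp (fun w => L (tubePoint s (-(2 * Real.pi) • w))) 2)
    (hs' : MemLp (fun w => L (tubePoint s' (-(2 * Real.pi) • w))) 2) :
    ∀ᵐ t, Real.exp (-inner ℝ s t) * (𝓕⁻ (hs.toLp _) : Lp ℂ 2 (volume : Measure _)) t =
      Real.exp (-inner ℝ s' t) * (𝓕⁻ (hs'.toLp _) : Lp ℂ 2 (volume : Measure _)) t := by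
  -- the Fourier transform of the left side times a Gaussian, as a vertical integral of `L`
  have hpair : ∀ {s : EuclideanSpace ℝ (Fin d)}
      (hs : MemLp (fun w => L (tubePoint s (-(2 * Real.pi) • w))) 2) (η : EuclideanSpace ℝ (Fin d)),
      𝓕 (fun t => (𝓕⁻ (hs.toLp _) : Lp ℂ 2 (volume : Measure _)) t * modulatedGaussian s 0 t) η =
      |((-(2 * Real.pi)) ^ Module.finrank ℝ (EuclideanSpace ℝ (Fin d)))⁻¹| •
        ∫ y, L (tubePoint s y) * gaussianLaplace η (tubePoint s y) := by
    intro s hs η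
    rw [← Measure.integral_comp_smul volume
      (fun y => L (tubePoint s y) * gaussianLaplace η (tubePoint s y)), Real.fourier_eq']
    calc _ = ∫ t, (𝓕⁻ (hs.toLp _) : Lp ℂ 2 (volume : Measure _)) t * modulatedGaussian s η t := by
          congr 1
          ext t
          have : modulatedGaussian s η t = Complex.exp (↑(-2 * Real.pi * inner ℝ t η) * Complex.I) *
              modulatedGaussian s 0 t := by
            simp only [modulatedGaussian, inner_zero_left]
            rw [real_inner_comm η t]
            simp
            ring_nf
          rw [this, smul_eq_mul]; ring
      _ = _ := by
          rw [integral_fourierInv_mul (integrable_modulatedGaussian s η)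
            (memLp_modulatedGaussian s η)]
          refine integral_congr_ae ?_
          filter_upwards [hs.coeFn_toLp] with w hw
          rw [hw, fourierInv_modulatedGaussian]
  have hint : ∀ {s : EuclideanSpace ℝ (Fin d)}
      (hs : MemLp (fun w => L (tubePoint s (-(2 * Real.pi) • w))) 2),
      Integrable (fun t => (𝓕⁻ (hs.toLp _) : Lp ℂ 2 (volume : Measure _)) t *
        modulatedGaussian s 0 t) := fun {s} hs =>
    (Lp.memLp _).integrable_mul (memLp_modulatedGaussian s 0)
  have h0 := ae_eq_zero_of_fourier_eq_zero ((hint hs).sub (hint hs')) fun η => by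
    have := VectorFourier.fourierIntegral_add (V := EuclideanSpace ℝ (Fin d))
      (W := EuclideanSpace ℝ (Fin d)) (L := innerₗ _) (μ := volume)
      Real.continuous_fourierChar (by exact continuous_inner) ((hint hs).sub (hint hs')) (hint hs')
    have h2 := congrFun this η
    rw [sub_add_cancel, Pi.add_apply] at h2
    have h3 : 𝓕 (fun t => (𝓕⁻ (hs.toLp _) : Lp ℂ 2 (volume : Measure _)) t *
        modulatedGaussian s 0 t) η = 𝓕 (fun t => (𝓕⁻ (hs'.toLp _) : Lp ℂ 2 (volume : Measure _)) t *
        modulatedGaussian s' 0 t) η := by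
      rw [hpair hs, hpair hs', integral_vertical_mul_gaussianLaplace_eq hL hb η s s']
    have h4 : ∀ a b c : ℂ, b = a + c → b = c → a = 0 := fun a b c h h' => by
      rw [h'] at h; simpa using h
    exact h4 _ _ _ h2 h3
  filter_upwards [h0] with t ht
  have h5 := sub_eq_zero.1 ht
  have h6 : ∀ s, modulatedGaussian s 0 t =
      Real.exp (-inner ℝ s t) * Real.exp (-Real.pi * ‖t‖ ^ 2) := by
    intro s
    simp only [modulatedGaussian, inner_zero_left, inner_neg_left]
    rw [Real.exp_add]; push_cast; simp; ring
  beta_reduce at h5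
  rw [h6, h6] at h5
  have h7 : (Real.exp (-Real.pi * ‖t‖ ^ 2) : ℂ) ≠ 0 := by
    exact_mod_cast (Real.exp_pos _).ne'
  apply mul_right_cancel₀ h7
  linear_combination h5

end PaleyWiener

/-! ### Invariant densities and fundamental domains -/

section FundamentalDomain

variable {d : ℕ}

lemma lintegral_comp_smul_euclidean (f : EuclideanSpace ℝ (Fin d) → ℝ≥0∞) {c : ℝ} (hc : c ≠ 0) :
    ∫⁻ x, f (c • x) = ENNReal.ofReal (|(c ^ d)⁻¹|) * ∫⁻ x, f x := by
  have h := Measure.map_addHaar_smul (volume : Measure (EuclideanSpace ℝ (Fin d))) hc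
  have he : MeasurableEmbedding fun x : EuclideanSpace ℝ (Fin d) => c • x :=
    (Homeomorph.smulOfNeZero c hc).measurableEmbedding
  rw [← he.lintegral_map, h, lintegral_smul_measure, finrank_euclideanSpace_fin, smul_eq_mul]

lemma countable_of_discreteTopology (Γ : AddSubgroup (EuclideanSpace ℝ (Fin d)))
    [DiscreteTopology Γ] : Countable Γ :=
  TopologicalSpace.separableSpace_iff_countable.1 inferInstance

/-- A function invariant under each translation of a countable group almost everywhere agrees
almost everywhere with a strictly invariant one: take the supremum of its translates. -/
lemma exists_invariant_ae_eq (Γ : AddSubgroup (EuclideanSpace ℝ (Fin d))) [Countable Γ]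
    {ρ : EuclideanSpace ℝ (Fin d) → ℝ≥0∞} (hρ : ∀ γ : Γ, ∀ᵐ x, ρ (x + γ) = ρ x) :
    ∃ ρ' : EuclideanSpace ℝ (Fin d) → ℝ≥0∞, (∀ (γ : Γ) x, ρ' (x + γ) = ρ' x) ∧
      ρ' =ᵐ[volume] ρ := by
  refine ⟨fun x => ⨆ γ : Γ, ρ (x + γ), fun γ x => ?_, ?_⟩
  · refine (Equiv.addLeft γ).iSup_congr fun γ' => ?_
    simp [add_assoc]
  · filter_upwards [ae_all_iff.2 hρ] with x hx
    simp [hx]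

/-- The integral of an invariant density over a fundamental domain does not change when the density
is translated, since the translate of the domain is again a fundamental domain. -/
lemma setLIntegral_add_right (Γ : AddSubgroup (EuclideanSpace ℝ (Fin d))) [Countable Γ]
    {ρ : EuclideanSpace ℝ (Fin d) → ℝ≥0∞} (hρ : ∀ γ : Γ, ∀ᵐ x, ρ (x + γ) = ρ x)
    {Λ : Set (EuclideanSpace ℝ (Fin d))} (hΛ : IsAddFundamentalDomain Γ Λ volume)
    (u : EuclideanSpace ℝ (Fin d)) :
    ∫⁻ x in Λ, ρ (x + u) = ∫⁻ x in Λ, ρ x := by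
  obtain ⟨ρ', hinv, hae⟩ := exists_invariant_ae_eq Γ hρ
  have h1 : (fun x => ρ (x + u)) =ᵐ[volume.restrict Λ] fun x => ρ' (x + u) :=
    ae_restrict_of_ae (((measurePreserving_add_right volume u).quasiMeasurePreserving.ae hae).mono
      fun x hx => hx.symm)
  rw [lintegral_congr_ae h1, ← lintegral_congr_ae (ae_restrict_of_ae hae)]
  have hΛu : IsAddFundamentalDomain Γ ((fun x => x - u) ⁻¹' Λ) volume :=
    hΛ.preimage_of_equiv (measurePreserving_sub_right volume u).quasiMeasurePreserving
      (e := id) Function.bijective_id fun γ x => by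
        simp only [AddSubgroup.vadd_def, vadd_eq_add, id]; abel
  have h2 := hΛ.setLIntegral_eq hΛu ρ' fun γ x => by
    rw [AddSubgroup.vadd_def, vadd_eq_add, add_comm, hinv]
  have h3 := (measurePreserving_add_right volume u).setLIntegral_comp_preimage_emb
    (measurableEmbedding_addRight u) ρ' ((fun x => x - u) ⁻¹' Λ)
  rw [h2, ← h3]
  congr 2
  ext x
  simp

/-- Integrating translates of a kernel against an invariant density, over a fundamental domain. -/
lemma setLIntegral_lintegral_mul_sub (Γ : AddSubgroup (EuclideanSpace ℝ (Fin d))) [Countable Γ]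
    {ρ : EuclideanSpace ℝ (Fin d) → ℝ≥0∞} (hρ : ∀ γ : Γ, ∀ᵐ x, ρ (x + γ) = ρ x)
    (hm : AEMeasurable ρ) {Λ : Set (EuclideanSpace ℝ (Fin d))}
    (hΛ : IsAddFundamentalDomain Γ Λ volume) {k : EuclideanSpace ℝ (Fin d) → ℝ≥0∞}
    (hk : Measurable k) :
    ∫⁻ s in Λ, ∫⁻ t, ρ t * k (t - s) = (∫⁻ u, k u) * ∫⁻ x in Λ, ρ x := by
  have h1 : ∀ s, ∫⁻ t, ρ t * k (t - s) = ∫⁻ u, ρ (s + u) * k u := fun s => by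
    rw [← lintegral_add_left_eq_self (fun t => ρ t * k (t - s)) s]
    simp
  simp only [h1]
  rw [lintegral_lintegral_swap]
  · rw [← lintegral_mul_const _ hk]
    refine lintegral_congr fun u => ?_
    have hmu : AEMeasurable (fun x => ρ (x + u)) (volume.restrict Λ) :=
      (hm.comp_quasiMeasurePreserving
        (measurePreserving_add_right volume u).quasiMeasurePreserving).restrict
    rw [lintegral_mul_const'' _ hmu, setLIntegral_add_right Γ hρ hΛ u, mul_comm]
  · have hq : Measure.QuasiMeasurePreserving
        (fun p : EuclideanSpace ℝ (Fin d) × EuclideanSpace ℝ (Fin d) => p.1 + p.2)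
        ((volume.restrict Λ).prod volume) volume := by
      refine ⟨measurable_fst.add measurable_snd, ?_⟩
      have h0 : Measure.QuasiMeasurePreserving
        (fun p : EuclideanSpace ℝ (Fin d) × EuclideanSpace ℝ (Fin d) => p.1 + p.2)
        (volume.prod volume) volume := quasiMeasurePreserving_add volume volume
      refine Measure.AbsolutelyContinuous.trans (Measure.AbsolutelyContinuous.map ?_ h0.1) h0.2
      exact Measure.restrict_le_self.absolutelyContinuous.prod
        (Measure.AbsolutelyContinuous.refl _)
    exact (hm.comp_quasiMeasurePreserving hq).mul (hk.comp measurable_snd).aemeasurable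

lemma lintegral_exp_neg_mul_sq {ν : ℝ} (hν : 0 < ν) :
    ∫⁻ u : EuclideanSpace ℝ (Fin d), ENNReal.ofReal (Real.exp (-ν * ‖u‖ ^ 2)) =
      ENNReal.ofReal ((Real.pi / ν) ^ ((d : ℝ) / 2)) := by
  have h := integrable_exp_neg_mul_sq_add_inner (d := d) hν 0
  simp only [inner_zero_left, add_zero] at h
  rw [← ofReal_integral_eq_lintegral_ofReal h
    (Filter.Eventually.of_forall fun u => (Real.exp_pos _).le),
    GaussianFourier.integral_rexp_neg_mul_sq_norm hν, finrank_euclideanSpace_fin]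

lemma inv_sqrt_two_smul_mem {Γ : AddSubgroup (EuclideanSpace ℝ (Fin d))}
    {γ : EuclideanSpace ℝ (Fin d)} (h : γ ∈ Γ) : (√2 : ℝ)⁻¹ • γ ∈ shiftedLattice Γ :=
  AddSubgroup.smul_mem_pointwise_smul _ _ _ h

lemma sqrt_two_ne_zero : (√2 : ℝ) ≠ 0 := by positivity

lemma exists_of_mem_shiftedLattice {Γ : AddSubgroup (EuclideanSpace ℝ (Fin d))}
    {γ : EuclideanSpace ℝ (Fin d)} (h : γ ∈ shiftedLattice Γ) :
    ∃ γ' ∈ Γ, γ = (√2 : ℝ)⁻¹ • γ' := by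
  obtain ⟨γ', h1, h2⟩ := (AddSubgroup.mem_smul_pointwise_iff_exists _ _ _).1 h
  exact ⟨γ', h1, h2.symm⟩

lemma complexify_injective : Function.Injective (complexify d) := fun x y h => by
  have h2 := congrArg rePart h
  rwa [← tubePoint_zero_right, ← tubePoint_zero_right, rePart_tubePoint, rePart_tubePoint] at h2

/-- The set of `z` with `√2 Re z` in a fundamental domain of `Γ` is a fundamental domain of `Γ/√2`
in `ℂ^d`. -/
lemma isAddFundamentalDomain_tube {Γ : AddSubgroup (EuclideanSpace ℝ (Fin d))}
    {Λ : Set (EuclideanSpace ℝ (Fin d))} (hΛ : IsAddFundamentalDomain Γ Λ volume) :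
    IsAddFundamentalDomain ((shiftedLattice Γ).map (complexify d))
      ((fun z => (√2 : ℝ) • rePart z) ⁻¹' Λ) volume := by
  have hq : Measure.QuasiMeasurePreserving (fun z : EuclideanSpace ℂ (Fin d) =>
      (√2 : ℝ) • rePart z) volume volume := by
    refine Measure.QuasiMeasurePreserving.comp (g := fun x => (√2 : ℝ) • x) ?_
      quasiMeasurePreserving_rePart
    refine ⟨measurable_const_smul _, ?_⟩
    rw [Measure.map_addHaar_smul _ sqrt_two_ne_zero]
    exact Measure.smul_absolutelyContinuous
  refine hΛ.preimage_of_equiv hq (e := fun γ => ⟨complexify d ((√2 : ℝ)⁻¹ • (γ : _)),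
    AddSubgroup.mem_map_of_mem _ (inv_sqrt_two_smul_mem γ.2)⟩) ⟨?_, ?_⟩ ?_
  · intro γ γ' h
    have h1 := complexify_injective (Subtype.mk.inj h)
    exact Subtype.ext (smul_right_injective _ (inv_ne_zero sqrt_two_ne_zero) h1)
  · rintro ⟨w, hw⟩
    obtain ⟨x, hx, rfl⟩ := AddSubgroup.mem_map.1 hw
    obtain ⟨γ, hγ, rfl⟩ := exists_of_mem_shiftedLattice hx
    exact ⟨⟨γ, hγ⟩, rfl⟩
  · intro γ z
    simp only [AddSubgroup.vadd_def, vadd_eq_add]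
    ext i
    simp [rePart, mul_add]
    linear_combination ((γ : EuclideanSpace ℝ (Fin d)) i / 2) *
      Real.mul_self_sqrt (show (0 : ℝ) ≤ 2 by norm_num)

end FundamentalDomain

/-! ### The norm identity -/

section Slices

variable {d : ℕ}

/-- `F(z) e^{ν ⟨z,z⟩ / 2}`, which turns the Segal–Bargmann transform into a Laplace transform. -/
def laplaceLift (ν : ℝ) (F : EuclideanSpace ℂ (Fin d) → ℂ) (z : EuclideanSpace ℂ (Fin d)) : ℂ :=
  F z * Complex.exp (ν / 2 * bilin z z)

/-- The function `t ↦ e^{√2 ν ⟨x,t⟩} φ(t) e^{-ν ‖t‖²}`, whose Fourier transform is a vertical slice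
of the Laplace transform of `φ(t) e^{-ν ‖t‖²}`. -/
def laplaceSlice (ν : ℝ) (φ : EuclideanSpace ℝ (Fin d) → ℂ) (x t : EuclideanSpace ℝ (Fin d)) : ℂ :=
  Real.exp (√2 * ν * inner ℝ x t) * (φ t * Real.exp (-ν * ‖t‖ ^ 2))

/-- The density `|φ(x)|² e^{-ν ‖x‖²}`. -/
def realDensity (ν : ℝ) (φ : EuclideanSpace ℝ (Fin d) → ℂ) (x : EuclideanSpace ℝ (Fin d)) : ℝ≥0∞ :=
  ‖φ x‖ₑ ^ 2 * ENNReal.ofReal (Real.exp (-ν * ‖x‖ ^ 2))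

lemma aemeasurable_realDensity {ν : ℝ} {φ : EuclideanSpace ℝ (Fin d) → ℂ}
    (hφ : AEStronglyMeasurable φ) : AEMeasurable (realDensity ν φ) := by
  unfold realDensity
  exact (hφ.enorm.pow_const 2).mul (by fun_prop)

/-- The density `|F(z)|² e^{-ν ‖z‖²}`. -/
def complexDensity (ν : ℝ) (F : EuclideanSpace ℂ (Fin d) → ℂ) (z : EuclideanSpace ℂ (Fin d)) :
    ℝ≥0∞ :=
  ‖F z‖ₑ ^ 2 * ENNReal.ofReal (Real.exp (-ν * ‖z‖ ^ 2))

lemma measurable_complexDensity {ν : ℝ} {F : EuclideanSpace ℂ (Fin d) → ℂ} (hF : Continuous F) :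
    Measurable (complexDensity ν F) := by
  unfold complexDensity
  exact (hF.measurable.enorm.pow_const 2).mul (by fun_prop)

lemma ofReal_sq_exp (a : ℝ) :
    ENNReal.ofReal (Real.exp a) ^ 2 = ENNReal.ofReal (Real.exp (2 * a)) := by
  rw [← ENNReal.ofReal_pow (Real.exp_pos _).le, ← Real.exp_nat_mul]; norm_num

lemma ofReal_exp_mul (a b : ℝ) : ENNReal.ofReal (Real.exp a) * ENNReal.ofReal (Real.exp b) =
    ENNReal.ofReal (Real.exp (a + b)) := by
  rw [← ENNReal.ofReal_mul (Real.exp_pos _).le, ← Real.exp_add]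

lemma enorm_ofReal_exp (a : ℝ) : ‖(Real.exp a : ℂ)‖ₑ = ENNReal.ofReal (Real.exp a) := by
  rw [← ofReal_norm, Complex.norm_real, Real.norm_of_nonneg (Real.exp_pos _).le]

lemma enorm_cexp (w : ℂ) : ‖Complex.exp w‖ₑ = ENNReal.ofReal (Real.exp w.re) := by
  rw [← ofReal_norm, Complex.norm_exp]

lemma complexDensity_tubePoint (ν : ℝ) (F : EuclideanSpace ℂ (Fin d) → ℂ)
    (x y : EuclideanSpace ℝ (Fin d)) :
    complexDensity ν F (tubePoint x y) =
      ‖laplaceLift ν F (tubePoint x y)‖ₑ ^ 2 * ENNReal.ofReal (Real.exp (-2 * ν * ‖x‖ ^ 2)) := by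
  rw [complexDensity, laplaceLift, enorm_mul, mul_pow, enorm_cexp, ofReal_sq_exp, mul_assoc,
    ofReal_exp_mul, norm_tubePoint_sq, bilin_tubePoint_self]
  congr 3
  have : ((ν : ℂ) / 2) = ((ν / 2 : ℝ) : ℂ) := by push_cast; rfl
  rw [this, Complex.re_ofReal_mul, Complex.add_re, Complex.ofReal_re]
  simp
  ring

/-- Completing the square: the exponential weights of a slice combine into a Gaussian centred at
`√2 x`. -/
lemma enorm_laplaceSlice_sq (ν : ℝ) (φ : EuclideanSpace ℝ (Fin d) → ℂ)
    (x t : EuclideanSpace ℝ (Fin d)) :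
    ‖laplaceSlice ν φ x t‖ₑ ^ 2 * ENNReal.ofReal (Real.exp (-2 * ν * ‖x‖ ^ 2)) =
      realDensity ν φ t * ENNReal.ofReal (Real.exp (-ν * ‖t - (√2 : ℝ) • x‖ ^ 2)) := by
  rw [laplaceSlice, realDensity, enorm_mul, enorm_mul, enorm_ofReal_exp, enorm_ofReal_exp, mul_pow,
    mul_pow, ofReal_sq_exp, ofReal_sq_exp]
  rw [mul_assoc (‖φ t‖ₑ ^ 2), ofReal_exp_mul, mul_left_comm, mul_assoc, mul_assoc, ofReal_exp_mul,
    ofReal_exp_mul]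
  congr 3
  rw [@norm_sub_sq_real, norm_smul, inner_smul_right, real_inner_comm, mul_pow, Real.norm_eq_abs,
    sq_abs, Real.sq_sqrt (by norm_num)]
  ring

/-- The Plancherel constant between `laplaceSlice ν φ x` and the vertical slice over `x` of the
lifted Segal–Bargmann transform of `φ`: the square of the constant of the transform, times the
Jacobian of the passage to frequencies. -/
def sliceConst (d : ℕ) (ν : ℝ) : ℝ :=
  ((ν / Real.pi) ^ (3 * (d : ℝ) / 4)) ^ 2 * (2 * Real.pi / (√2 * ν)) ^ d

/-- The constant of the Segal–Bargmann transform normalizes the Plancherel constant of the slices,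
the Jacobian of `x ↦ √2 x` and the mass of the Gaussian. -/
lemma sliceConst_mul {ν : ℝ} (hν : 0 < ν) :
    sliceConst d ν * (((√2 : ℝ) ^ d)⁻¹ * (Real.pi / ν) ^ ((d : ℝ) / 2)) = 1 := by
  have hpi := Real.pi_pos
  have hq : 0 < ν / Real.pi := by positivity
  have h2 : (0 : ℝ) < √2 := by positivity
  have e1 : (2 * Real.pi / (√2 * ν)) ^ d = √2 ^ d * (ν / Real.pi) ^ (-(d : ℝ)) := by
    rw [Real.rpow_neg hq.le, Real.rpow_natCast, ← inv_pow, ← mul_pow]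
    congr 1
    field_simp
    norm_num
  have e2 : (Real.pi / ν) ^ ((d : ℝ) / 2) = (ν / Real.pi) ^ (-((d : ℝ) / 2)) := by
    rw [Real.rpow_neg hq.le, ← Real.inv_rpow hq.le, inv_div]
  have e3 : ((ν / Real.pi) ^ (3 * (d : ℝ) / 4)) ^ 2 = (ν / Real.pi) ^ (3 * (d : ℝ) / 2) := by
    rw [← Real.rpow_natCast, ← Real.rpow_mul hq.le]
    congr 1
    push_cast; ring
  have e4 : (ν / Real.pi) ^ (3 * (d : ℝ) / 2) * (ν / Real.pi) ^ (-(d : ℝ)) *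
      (ν / Real.pi) ^ (-((d : ℝ) / 2)) = 1 := by
    rw [← Real.rpow_add hq, ← Real.rpow_add hq]
    have : 3 * (d : ℝ) / 2 + -(d : ℝ) + -((d : ℝ) / 2) = 0 := by ring
    rw [this, Real.rpow_zero]
  have h2d : (√2 : ℝ) ^ d ≠ 0 := (pow_pos h2 d).ne'
  rw [sliceConst, e1, e2, e3]
  calc _ = ((√2 : ℝ) ^ d * (√2 ^ d)⁻¹) * ((ν / Real.pi) ^ (3 * (d : ℝ) / 2) *
        (ν / Real.pi) ^ (-(d : ℝ)) * (ν / Real.pi) ^ (-((d : ℝ) / 2))) := by ring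
    _ = 1 := by rw [mul_inv_cancel₀ h2d, e4, one_mul]

lemma sliceConst_pos {ν : ℝ} (hν : 0 < ν) : 0 < sliceConst d ν := by
  have := Real.pi_pos
  unfold sliceConst; positivity

/-- The norm identity: if the vertical slices of `F` satisfy Plancherel's formula with respect to
`φ`, then `F` and `φ` have the same norm over any fundamental domains. The fundamental domain of
`Γ/√2` may be taken to be a union of vertical slices; Tonelli's theorem and Plancherel's formula
then express the norm of `F` as the integral of a convolution of `realDensity ν φ` with a
Gaussian. -/
lemma setLIntegral_density_eq {ν : ℝ} (hν : 0 < ν) {Γ : AddSubgroup (EuclideanSpace ℝ (Fin d))}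
    [Countable Γ] {Λ : Set (EuclideanSpace ℝ (Fin d))} (hΛ : IsAddFundamentalDomain Γ Λ volume)
    {Λ' : Set (EuclideanSpace ℂ (Fin d))}
    (hΛ' : IsAddFundamentalDomain ((shiftedLattice Γ).map (complexify d)) Λ' volume)
    {φ : EuclideanSpace ℝ (Fin d) → ℂ} (hφ : AEStronglyMeasurable φ)
    (hinv : ∀ γ : Γ, ∀ᵐ x, realDensity ν φ (x + γ) = realDensity ν φ x)
    {F : EuclideanSpace ℂ (Fin d) → ℂ} (hF : Continuous F)
    (hFinv : ∀ γ ∈ shiftedLattice Γ, ∀ z,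
      complexDensity ν F (z + complexify d γ) = complexDensity ν F z)
    (hslice : ∀ᵐ x, ∫⁻ y, ‖laplaceLift ν F (tubePoint x y)‖ₑ ^ 2 =
      ENNReal.ofReal (sliceConst d ν) * ∫⁻ t, ‖laplaceSlice ν φ x t‖ₑ ^ 2) :
    ∫⁻ z in Λ', complexDensity ν F z = ∫⁻ x in Λ, realDensity ν φ x := by
  have : Countable ((shiftedLattice Γ).map (complexify d)) := by
    have h1 : Function.Surjective (fun γ : Γ => (⟨complexify d ((√2 : ℝ)⁻¹ • (γ : _)),
      AddSubgroup.mem_map_of_mem _ (inv_sqrt_two_smul_mem γ.2)⟩ :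
        (shiftedLattice Γ).map (complexify d))) := by
      rintro ⟨w, hw⟩
      obtain ⟨x, hx, rfl⟩ := AddSubgroup.mem_map.1 hw
      obtain ⟨γ, hγ, rfl⟩ := exists_of_mem_shiftedLattice hx
      exact ⟨⟨γ, hγ⟩, rfl⟩
    exact h1.countable
  have hT := isAddFundamentalDomain_tube hΛ
  have hcm : Measurable (complexDensity ν F) := measurable_complexDensity hF
  have hrm : AEMeasurable (realDensity ν φ) := aemeasurable_realDensity hφ
  rw [hΛ'.setLIntegral_eq hT _ fun γ z => by
    obtain ⟨x, hx, hxγ⟩ := AddSubgroup.mem_map.1 γ.2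
    rw [AddSubgroup.vadd_def, vadd_eq_add, add_comm, ← hxγ, hFinv x hx]]
  rw [← lintegral_indicator₀ hT.nullMeasurableSet,
    lintegral_tube (hcm.aemeasurable.indicator₀ hT.nullMeasurableSet)]
  set k : EuclideanSpace ℝ (Fin d) → ℝ≥0∞ := fun u => ENNReal.ofReal (Real.exp (-ν * ‖u‖ ^ 2))
    with hk
  set g : EuclideanSpace ℝ (Fin d) → ℝ≥0∞ := Λ.indicator fun s =>
    ENNReal.ofReal (sliceConst d ν) * ∫⁻ t, realDensity ν φ t * k (t - s) with hg
  have h1 : ∀ᵐ x : EuclideanSpace ℝ (Fin d),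
      ∫⁻ y, Set.indicator ((fun z => (√2 : ℝ) • rePart z) ⁻¹' Λ)
        (complexDensity ν F) (tubePoint x y) = g ((√2 : ℝ) • x) := by
    filter_upwards [hslice] with x hx
    by_cases hxΛ : (√2 : ℝ) • x ∈ Λ
    · have : ∀ y, Set.indicator ((fun z => (√2 : ℝ) • rePart z) ⁻¹' Λ)
          (complexDensity ν F) (tubePoint x y) = complexDensity ν F (tubePoint x y) := fun y =>
        Set.indicator_of_mem (by simpa using hxΛ) _
      simp only [this, complexDensity_tubePoint]
      rw [hg, Set.indicator_of_mem hxΛ, lintegral_mul_const' _ _ ENNReal.ofReal_ne_top, hx,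
        mul_assoc, ← lintegral_mul_const' _ _ ENNReal.ofReal_ne_top]
      simp only [enorm_laplaceSlice_sq, hk]
    · have : ∀ y, Set.indicator ((fun z => (√2 : ℝ) • rePart z) ⁻¹' Λ)
          (complexDensity ν F) (tubePoint x y) = 0 := fun y =>
        Set.indicator_of_notMem (by simpa using hxΛ) _
      simp only [this, lintegral_zero]
      rw [hg, Set.indicator_of_notMem hxΛ]
  have hkm : Measurable k := by rw [hk]; fun_prop
  rw [lintegral_congr_ae h1, lintegral_comp_smul_euclidean g sqrt_two_ne_zero, hg,
    lintegral_indicator₀ hΛ.nullMeasurableSet, lintegral_const_mul' _ _ ENNReal.ofReal_ne_top,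
    setLIntegral_lintegral_mul_sub Γ hinv hrm hΛ hkm, hk, lintegral_exp_neg_mul_sq hν, ← mul_assoc,
    ← mul_assoc, abs_of_pos (by positivity), ← ENNReal.ofReal_mul (by positivity),
    ← ENNReal.ofReal_mul (by have := sliceConst_pos (d := d) hν; positivity)]
  have := sliceConst_mul (d := d) hν
  rw [show (√2 ^ d)⁻¹ * sliceConst d ν * (Real.pi / ν) ^ ((d : ℝ) / 2) = 1 by rw [← this]; ring]
  simp

end Slices

/-! ### The Segal–Bargmann transform of a quasi-periodic function -/

section Forward

variable {d : ℕ}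

/-- The function `φ(t) e^{-ν ‖t‖²}`. -/
def gaussianWeighted (ν : ℝ) (φ : EuclideanSpace ℝ (Fin d) → ℂ) (t : EuclideanSpace ℝ (Fin d)) :
    ℂ :=
  φ t * Real.exp (-ν * ‖t‖ ^ 2)

/-- The Laplace transform `ζ ↦ ∫ e^{⟨ζ,t⟩} m(t) dt`. -/
def laplaceTransform (m : EuclideanSpace ℝ (Fin d) → ℂ) (ζ : EuclideanSpace ℂ (Fin d)) : ℂ :=
  ∫ t, Complex.exp (bilin ζ (complexify d t)) * m t

lemma aestronglyMeasurable_gaussianWeighted (ν : ℝ) {φ : EuclideanSpace ℝ (Fin d) → ℂ}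
    (hφ : AEStronglyMeasurable φ) : AEStronglyMeasurable (gaussianWeighted ν φ) :=
  hφ.mul (Continuous.aestronglyMeasurable (by fun_prop))

/-- An invariant density with finite mass on a fundamental domain has finite mass against every
Gaussian: the mass against the translate by `s` of a Gaussian is integrable in `s` over the
fundamental domain, hence finite for some `s`, and up to a constant this translate dominates a
narrower Gaussian centred at `0`. -/
lemma lintegral_realDensity_mul_gaussian_ne_top {ν : ℝ}
    {Γ : AddSubgroup (EuclideanSpace ℝ (Fin d))} [Countable Γ]
    {Λ : Set (EuclideanSpace ℝ (Fin d))} (hΛ : IsAddFundamentalDomain Γ Λ volume)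
    {φ : EuclideanSpace ℝ (Fin d) → ℂ} (hφ : AEStronglyMeasurable φ)
    (hinv : ∀ γ : Γ, ∀ᵐ x, realDensity ν φ (x + γ) = realDensity ν φ x)
    (hfin : ∫⁻ x in Λ, realDensity ν φ x ≠ ∞) {b : ℝ} (hb : 0 < b) :
    ∫⁻ t, realDensity ν φ t * ENNReal.ofReal (Real.exp (-b * ‖t‖ ^ 2)) ≠ ∞ := by
  have hrm : AEMeasurable (realDensity ν φ) := aemeasurable_realDensity hφ
  set k : EuclideanSpace ℝ (Fin d) → ℝ≥0∞ := fun u => ENNReal.ofReal (Real.exp (-(b / 2) * ‖u‖ ^ 2))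
    with hk
  have h1 := setLIntegral_lintegral_mul_sub Γ hinv hrm hΛ (k := k) (by rw [hk]; fun_prop)
  rw [hk, lintegral_exp_neg_mul_sq (half_pos hb)] at h1
  have h2 : ∫⁻ s in Λ, ∫⁻ t, realDensity ν φ t * k (t - s) ≠ ∞ := by
    rw [h1]
    exact ENNReal.mul_ne_top ENNReal.ofReal_ne_top hfin
  have h3 : volume Λ ≠ 0 := hΛ.measure_ne_zero (NeZero.ne _)
  obtain ⟨s, hs⟩ : ∃ s, ∫⁻ t, realDensity ν φ t * k (t - s) ≠ ∞ := by
    by_contra! hcon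
    simp only [hcon] at h2
    rw [setLIntegral_const, ENNReal.top_mul h3] at h2
    exact h2 rfl
  have h4 : ∀ t, realDensity ν φ t * ENNReal.ofReal (Real.exp (-b * ‖t‖ ^ 2)) ≤
      ENNReal.ofReal (Real.exp (b * ‖s‖ ^ 2)) * (realDensity ν φ t * k (t - s)) := by
    intro t
    rw [mul_left_comm, hk, ofReal_exp_mul]
    gcongr
    have h5 : ‖t - s‖ ^ 2 ≤ 2 * (‖t‖ ^ 2 + ‖s‖ ^ 2) := by
      have := norm_sub_le t s
      nlinarith [norm_nonneg (t - s), norm_nonneg t, norm_nonneg s, sq_nonneg (‖t‖ - ‖s‖)]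
    nlinarith [mul_le_mul_of_nonneg_left h5 hb.le]
  refine ne_top_of_le_ne_top ?_ (lintegral_mono h4)
  rw [lintegral_const_mul' _ _ ENNReal.ofReal_ne_top]
  exact ENNReal.mul_ne_top ENNReal.ofReal_ne_top hs

/-- Finite Gaussian mass makes `φ(t) e^{-ν ‖t‖²}` decay faster than any exponential, in the
integrable and square integrable sense. -/
lemma integrable_and_memLp_exp_mul {ν : ℝ} (hν : 0 < ν) {φ : EuclideanSpace ℝ (Fin d) → ℂ}
    (hφ : AEStronglyMeasurable φ)
    (hfin : ∫⁻ t, realDensity ν φ t * ENNReal.ofReal (Real.exp (-(ν / 2) * ‖t‖ ^ 2)) ≠ ∞) (a : ℝ) :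
    Integrable (fun t => Real.exp (a * ‖t‖) * ‖gaussianWeighted ν φ t‖) ∧
      MemLp (fun t => Real.exp (a * ‖t‖) * ‖gaussianWeighted ν φ t‖) 2 := by
  -- the weight `e^{a ‖t‖ - ν ‖t‖²}` splits into a square integrable bounded factor and the
  -- factor `e^{-3ν ‖t‖² / 4}`, for which `hfin` says that the product with `φ` is square integrable
  set q : EuclideanSpace ℝ (Fin d) → ℝ := fun t => ‖φ t‖ * Real.exp (-(3 * ν / 4) * ‖t‖ ^ 2) with hq
  have hqm : MemLp q 2 := by
    refine ⟨hφ.norm.mul (Continuous.aestronglyMeasurable (by fun_prop)), ?_⟩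
    rw [eLpNorm_lt_top_iff_lintegral_rpow_enorm_lt_top (by norm_num) (by norm_num)]
    refine lt_of_le_of_lt (le_of_eq ?_) hfin.lt_top
    refine lintegral_congr fun t => ?_
    have : ‖q t‖ₑ = ‖φ t‖ₑ * ENNReal.ofReal (Real.exp (-(3 * ν / 4) * ‖t‖ ^ 2)) := by
      rw [hq, enorm_mul, enorm_norm, Real.enorm_eq_ofReal (Real.exp_pos _).le]
    rw [this, realDensity, mul_assoc, ofReal_exp_mul]
    simp only [ENNReal.toReal_ofNat, ENNReal.rpow_ofNat]
    rw [mul_pow, ofReal_sq_exp]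
    congr 3
    ring
  set f : EuclideanSpace ℝ (Fin d) → ℝ := fun t => Real.exp (a * ‖t‖ - ν / 4 * ‖t‖ ^ 2) with hf
  have hfc : Continuous f := by rw [hf]; fun_prop
  have hfb : ∀ t, ‖f t‖ ≤ Real.exp (2 * a ^ 2 / ν) * Real.exp (-(ν / 8) * ‖t‖ ^ 2) := by
    intro t
    rw [hf, Real.norm_of_nonneg (Real.exp_pos _).le, ← Real.exp_add, Real.exp_le_exp]
    have h1 : 2 * a ^ 2 / ν + -(ν / 8) * ‖t‖ ^ 2 - (a * ‖t‖ - ν / 4 * ‖t‖ ^ 2) =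
        2 / ν * (a - ν / 4 * ‖t‖) ^ 2 := by
      field_simp; ring
    have h2 : 0 ≤ 2 / ν * (a - ν / 4 * ‖t‖) ^ 2 := by positivity
    linarith
  have hf2 : MemLp f 2 := by
    have h := memLp_exp_neg_mul_sq_add_inner (d := d) (b := ν / 8) (by positivity) 0
    simp only [inner_zero_left, add_zero] at h
    refine (h.const_mul (Real.exp (2 * a ^ 2 / ν))).of_le hfc.aestronglyMeasurable
      (Filter.Eventually.of_forall fun t => (hfb t).trans (le_abs_self _))
  have hprod : (fun t => Real.exp (a * ‖t‖) * ‖gaussianWeighted ν φ t‖) = fun t => f t * q t := by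
    ext t
    rw [gaussianWeighted, norm_mul, Complex.norm_real, Real.norm_of_nonneg (Real.exp_pos _).le, hf,
      hq]
    have : Real.exp (a * ‖t‖) * Real.exp (-ν * ‖t‖ ^ 2) =
        Real.exp (a * ‖t‖ - ν / 4 * ‖t‖ ^ 2) * Real.exp (-(3 * ν / 4) * ‖t‖ ^ 2) := by
      rw [← Real.exp_add, ← Real.exp_add]; congr 1; ring
    linear_combination ‖φ t‖ * this
  rw [hprod]
  refine ⟨hf2.integrable_mul hqm, ?_⟩
  refine (hqm.const_mul (Real.exp (2 * a ^ 2 / ν))).of_le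
    (hfc.aestronglyMeasurable.mul hqm.1) (Filter.Eventually.of_forall fun t => ?_)
  rw [norm_mul, norm_mul (Real.exp _)]
  refine mul_le_mul_of_nonneg_right ((hfb t).trans ?_) (norm_nonneg (q t))
  rw [Real.norm_of_nonneg (Real.exp_pos _).le]
  refine mul_le_of_le_one_right (Real.exp_pos _).le (Real.exp_le_one_iff.2 ?_)
  nlinarith [sq_nonneg ‖t‖]

lemma norm_cexp_bilin_le (ζ : EuclideanSpace ℂ (Fin d)) (t : EuclideanSpace ℝ (Fin d)) :
    ‖Complex.exp (bilin ζ (complexify d t))‖ ≤ Real.exp (‖ζ‖ * ‖t‖) := by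
  rw [Complex.norm_exp, Real.exp_le_exp]
  refine (Complex.re_le_norm _).trans ((norm_bilin_le _ _).trans ?_)
  rw [norm_complexify]

lemma continuous_cexp_bilin (ζ : EuclideanSpace ℂ (Fin d)) :
    Continuous fun t => Complex.exp (bilin ζ (complexify d t)) :=
  Complex.continuous_exp.comp
    (continuous_bilin.comp (continuous_const.prodMk continuous_complexify))

lemma integrable_cexp_bilin_mul {m : EuclideanSpace ℝ (Fin d) → ℂ} (hm : AEStronglyMeasurable m)
    (h : ∀ a, Integrable fun t => Real.exp (a * ‖t‖) * ‖m t‖) (ζ : EuclideanSpace ℂ (Fin d)) :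
    Integrable fun t => Complex.exp (bilin ζ (complexify d t)) * m t := by
  refine (h ‖ζ‖).mono' ((continuous_cexp_bilin ζ).aestronglyMeasurable.mul hm)
    (Filter.Eventually.of_forall fun t => ?_)
  rw [norm_mul]
  exact mul_le_mul_of_nonneg_right (norm_cexp_bilin_le _ _) (norm_nonneg _)

lemma differentiable_laplaceTransform {m : EuclideanSpace ℝ (Fin d) → ℂ}
    (hm : AEStronglyMeasurable m)
    (h : ∀ a, Integrable fun t => Real.exp (a * ‖t‖) * ‖m t‖) :
    Differentiable ℂ (laplaceTransform m) := by
  intro ζ₀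
  have hfd : ∀ t : EuclideanSpace ℝ (Fin d), ∀ ζ, HasFDerivAt
      (fun ζ => Complex.exp (bilin ζ (complexify d t)) * m t)
      ((m t * Complex.exp (bilin ζ (complexify d t))) • bilinCLM (complexify d t)) ζ := by
    intro t ζ
    have h1 := ((bilinCLM (complexify d t)).hasFDerivAt (x := ζ)).cexp.mul_const (m t)
    rw [smul_smul] at h1
    exact h1
  have hclm : Continuous fun t : EuclideanSpace ℝ (Fin d) => bilinCLM (complexify d t) := by
    let T : EuclideanSpace ℝ (Fin d) →ₗ[ℝ] (EuclideanSpace ℂ (Fin d) →L[ℂ] ℂ) :=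
      { toFun := fun t => bilinCLM (complexify d t)
        map_add' := fun t t' => by ext z; simp [bilin_add_right]
        map_smul' := fun c t => by
          ext z
          have : complexify d (c • t) = (c : ℂ) • complexify d t := by ext i; simp
          rw [bilinCLM_apply, this, bilin_smul_right]
          rfl }
    exact T.continuous_of_finiteDimensional
  refine (hasFDerivAt_integral_of_dominated_of_fderiv_le (𝕜 := ℂ)
    (bound := fun t => Real.exp ((‖ζ₀‖ + 2) * ‖t‖) * ‖m t‖) (Metric.ball_mem_nhds ζ₀ one_pos)
    (Filter.Eventually.of_forall fun ζ =>
      (continuous_cexp_bilin ζ).aestronglyMeasurable.mul hm)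
    (integrable_cexp_bilin_mul hm h ζ₀) ?_ (Filter.Eventually.of_forall fun t ζ hζ => ?_)
    (h _) (Filter.Eventually.of_forall fun t ζ _ => hfd t ζ)).differentiableAt
  · exact (hm.mul (continuous_cexp_bilin ζ₀).aestronglyMeasurable).smul hclm.aestronglyMeasurable
  · rw [norm_smul, norm_mul]
    have h1 : ‖ζ‖ ≤ ‖ζ₀‖ + 1 := by
      rw [Metric.mem_ball, dist_eq_norm] at hζ
      linarith [norm_le_norm_add_norm_sub' ζ ζ₀]
    have h2 : ‖bilinCLM (complexify d t)‖ ≤ Real.exp ‖t‖ := by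
      refine (norm_bilinCLM_le _).trans ?_
      rw [norm_complexify]
      linarith [Real.add_one_le_exp ‖t‖]
    have h3 : ‖Complex.exp (bilin ζ (complexify d t))‖ ≤ Real.exp ((‖ζ₀‖ + 1) * ‖t‖) :=
      (norm_cexp_bilin_le _ _).trans (Real.exp_le_exp.2
        (mul_le_mul_of_nonneg_right h1 (norm_nonneg _)))
    calc _ ≤ ‖m t‖ * Real.exp ((‖ζ₀‖ + 1) * ‖t‖) * Real.exp ‖t‖ := by gcongr
      _ = _ := by
        rw [mul_assoc, ← Real.exp_add, mul_comm]
        congr 2; ring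

/-- A vertical slice of the Laplace transform is a Fourier transform. -/
lemma laplaceTransform_tubePoint (ν : ℝ) (φ : EuclideanSpace ℝ (Fin d) → ℂ)
    (x y : EuclideanSpace ℝ (Fin d)) :
    laplaceTransform (gaussianWeighted ν φ) (((√2 * ν : ℝ) : ℂ) • tubePoint x y) =
      𝓕 (laplaceSlice ν φ x) (-(√2 * ν / (2 * Real.pi)) • y) := by
  rw [laplaceTransform, Real.fourier_eq']
  congr 1
  ext t
  rw [laplaceSlice, gaussianWeighted, smul_eq_mul, bilin_smul_left, bilin_tubePoint_complexify,
    Complex.ofReal_exp (√2 * ν * inner ℝ x t), ← mul_assoc (Complex.exp _) (Complex.exp _),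
    ← Complex.exp_add]
  congr 2
  rw [inner_smul_right, real_inner_comm y t]
  have hpi : (Real.pi : ℂ) ≠ 0 := by exact_mod_cast Real.pi_ne_zero
  push_cast
  field_simp
  ring

lemma segalBargmann_eq (ν : ℝ) (φ : EuclideanSpace ℝ (Fin d) →ₘ[volume] ℂ)
    (z : EuclideanSpace ℂ (Fin d)) :
    segalBargmann ν φ z = (((ν / Real.pi) ^ (3 * (d : ℝ) / 4) : ℝ) : ℂ) *
      (Complex.exp (-(ν / 2 * bilin z z)) *
        laplaceTransform (gaussianWeighted ν φ) (((√2 * ν : ℝ) : ℂ) • z)) := by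
  rw [segalBargmann, laplaceTransform, ← integral_const_mul (Complex.exp _)]
  congr 1
  refine integral_congr_ae (Filter.Eventually.of_forall fun t => ?_)
  beta_reduce
  rw [bargmannIntegrand, gaussianWeighted, bilin_smul_left, sub_eq_add_neg, Complex.exp_add]
  push_cast
  ring

lemma laplaceLift_segalBargmann (ν : ℝ) (φ : EuclideanSpace ℝ (Fin d) →ₘ[volume] ℂ)
    (z : EuclideanSpace ℂ (Fin d)) :
    laplaceLift ν (segalBargmann ν φ) z = (((ν / Real.pi) ^ (3 * (d : ℝ) / 4) : ℝ) : ℂ) *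
        laplaceTransform (gaussianWeighted ν φ) (((√2 * ν : ℝ) : ℂ) • z) := by
  rw [laplaceLift, segalBargmann_eq]
  have : Complex.exp (-(ν / 2 * bilin z z)) * Complex.exp (ν / 2 * bilin z z) = 1 := by
    rw [← Complex.exp_add]; simp
  linear_combination (((ν / Real.pi) ^ (3 * (d : ℝ) / 4) : ℝ) : ℂ) *
    laplaceTransform (gaussianWeighted ν φ) (((√2 * ν : ℝ) : ℂ) • z) * this

lemma integrable_bargmannIntegrand {ν : ℝ} {φ : EuclideanSpace ℝ (Fin d) →ₘ[volume] ℂ}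
    (h : ∀ a, Integrable fun t => Real.exp (a * ‖t‖) * ‖gaussianWeighted ν φ t‖)
    (z : EuclideanSpace ℂ (Fin d)) : Integrable (bargmannIntegrand ν φ z) := by
  have h1 := (integrable_cexp_bilin_mul (aestronglyMeasurable_gaussianWeighted ν
    φ.aestronglyMeasurable) h (((√2 * ν : ℝ) : ℂ) • z)).const_mul
      (Complex.exp (-(ν / 2 * bilin z z)))
  refine h1.congr (Filter.Eventually.of_forall fun t => ?_)
  simp only [bargmannIntegrand, gaussianWeighted, bilin_smul_left, sub_eq_add_neg, Complex.exp_add]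
  push_cast
  ring

lemma differentiable_segalBargmann {ν : ℝ} {φ : EuclideanSpace ℝ (Fin d) →ₘ[volume] ℂ}
    (h : ∀ a, Integrable fun t => Real.exp (a * ‖t‖) * ‖gaussianWeighted ν φ t‖) :
    Differentiable ℂ (segalBargmann ν φ) := by
  have e : segalBargmann ν φ = fun z => (((ν / Real.pi) ^ (3 * (d : ℝ) / 4) : ℝ) : ℂ) *
      (Complex.exp (-(ν / 2 * bilin z z)) *
        laplaceTransform (gaussianWeighted ν φ) (((√2 * ν : ℝ) : ℂ) • z)) :=
    funext fun z => segalBargmann_eq ν φ z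
  rw [e]
  have h1 := (differentiable_laplaceTransform (aestronglyMeasurable_gaussianWeighted ν
    φ.aestronglyMeasurable) h).comp
      (differentiable_id.const_smul ((√2 * ν : ℝ) : ℂ))
  have h2 := ((differentiable_bilin_self (d := d)).const_mul ((ν : ℂ) / 2)).neg.cexp
  exact (h2.mul h1).const_mul _

lemma norm_laplaceSlice_le {ν : ℝ} (hν : 0 < ν) (φ : EuclideanSpace ℝ (Fin d) → ℂ)
    (x t : EuclideanSpace ℝ (Fin d)) :
    ‖laplaceSlice ν φ x t‖ ≤ Real.exp (√2 * ν * ‖x‖ * ‖t‖) * ‖gaussianWeighted ν φ t‖ := by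
  rw [laplaceSlice, norm_mul, Complex.norm_real, Real.norm_of_nonneg (Real.exp_pos _).le]
  refine mul_le_mul_of_nonneg_right (Real.exp_le_exp.2 ?_) (norm_nonneg _)
  rw [mul_assoc (√2 * ν)]
  exact mul_le_mul_of_nonneg_left (real_inner_le_norm _ _) (by positivity)

lemma aestronglyMeasurable_laplaceSlice (ν : ℝ) {φ : EuclideanSpace ℝ (Fin d) → ℂ}
    (hφ : AEStronglyMeasurable φ) (x : EuclideanSpace ℝ (Fin d)) :
    AEStronglyMeasurable (laplaceSlice ν φ x) :=
  (Continuous.aestronglyMeasurable (by fun_prop)).mul (aestronglyMeasurable_gaussianWeighted ν hφ)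

lemma integrable_laplaceSlice {ν : ℝ} (hν : 0 < ν) {φ : EuclideanSpace ℝ (Fin d) → ℂ}
    (hφ : AEStronglyMeasurable φ)
    (h : ∀ a, Integrable fun t => Real.exp (a * ‖t‖) * ‖gaussianWeighted ν φ t‖)
    (x : EuclideanSpace ℝ (Fin d)) : Integrable (laplaceSlice ν φ x) :=
  (h _).mono' (aestronglyMeasurable_laplaceSlice ν hφ x)
    (Filter.Eventually.of_forall fun t => norm_laplaceSlice_le hν φ x t)

lemma memLp_laplaceSlice {ν : ℝ} (hν : 0 < ν) {φ : EuclideanSpace ℝ (Fin d) → ℂ}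
    (hφ : AEStronglyMeasurable φ)
    (h : ∀ a, MemLp (fun t => Real.exp (a * ‖t‖) * ‖gaussianWeighted ν φ t‖) 2)
    (x : EuclideanSpace ℝ (Fin d)) : MemLp (laplaceSlice ν φ x) 2 :=
  (h _).of_le (aestronglyMeasurable_laplaceSlice ν hφ x)
    (Filter.Eventually.of_forall fun t => (norm_laplaceSlice_le hν φ x t).trans (le_abs_self _))

/-- Change of variables on a vertical slice, from the frequency scale of the Fourier transform. -/
lemma lintegral_vertical_scale {ν : ℝ} (hν : 0 < ν) (g : EuclideanSpace ℝ (Fin d) → ℝ≥0∞) :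
    ∫⁻ y, g (-(√2 * ν / (2 * Real.pi)) • y) =
      ENNReal.ofReal ((2 * Real.pi / (√2 * ν)) ^ d) * ∫⁻ w, g w := by
  have hpi := Real.pi_pos
  rw [lintegral_comp_smul_euclidean g (neg_ne_zero.2 (by positivity)), abs_inv, abs_pow, abs_neg,
    abs_of_pos (by positivity), ← inv_pow, inv_div]

/-- Plancherel's formula on the vertical slices of the transform. -/
lemma lintegral_slice_segalBargmann {ν : ℝ} (hν : 0 < ν)
    {φ : EuclideanSpace ℝ (Fin d) →ₘ[volume] ℂ}
    (h : ∀ a, Integrable (fun t => Real.exp (a * ‖t‖) * ‖gaussianWeighted ν φ t‖) ∧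
      MemLp (fun t => Real.exp (a * ‖t‖) * ‖gaussianWeighted ν φ t‖) 2)
    (x : EuclideanSpace ℝ (Fin d)) :
    ∫⁻ y, ‖laplaceLift ν (segalBargmann ν φ) (tubePoint x y)‖ₑ ^ 2 =
      ENNReal.ofReal (sliceConst d ν) * ∫⁻ t, ‖laplaceSlice ν φ x t‖ₑ ^ 2 := by
  have hpi := Real.pi_pos
  simp only [laplaceLift_segalBargmann, laplaceTransform_tubePoint, enorm_mul, mul_pow]
  rw [lintegral_const_mul' _ _ (by finiteness),
    lintegral_vertical_scale hν (fun w => ‖𝓕 (laplaceSlice ν φ x) w‖ₑ ^ 2),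
    lintegral_enorm_fourier_sq (integrable_laplaceSlice hν φ.aestronglyMeasurable
      (fun a => (h a).1) x) (memLp_laplaceSlice hν φ.aestronglyMeasurable (fun a => (h a).2) x),
    ← mul_assoc]
  congr 1
  rw [← ofReal_norm, Complex.norm_real, Real.norm_of_nonneg (by positivity),
    ← ENNReal.ofReal_pow (by positivity), ← ENNReal.ofReal_mul (by positivity)]
  rfl

/-- Quasi-periodicity of the transform, by the change of variables `t ↦ t + γ`. -/
lemma segalBargmann_add {ν : ℝ} {φ : EuclideanSpace ℝ (Fin d) →ₘ[volume] ℂ}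
    {γ : EuclideanSpace ℝ (Fin d)} {c : ℂ}
    (hφ : ∀ᵐ x, φ (x + γ) = c * Complex.exp (((ν * inner ℝ (x + (2⁻¹ : ℝ) • γ) γ : ℝ) : ℂ)) * φ x)
    (z : EuclideanSpace ℂ (Fin d)) :
    segalBargmann ν φ (z + complexify d ((√2 : ℝ)⁻¹ • γ)) =
      c * Complex.exp (ν * herm (z + (2⁻¹ : ℂ) • complexify d ((√2 : ℝ)⁻¹ • γ))
        (complexify d ((√2 : ℝ)⁻¹ • γ))) * segalBargmann ν φ z := by
  rw [segalBargmann, segalBargmann, mul_left_comm]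
  congr 1
  rw [← integral_const_mul, ← integral_add_right_eq_self _ γ]
  refine integral_congr_ae ?_
  filter_upwards [hφ] with t ht
  have hs : ((√2 : ℝ) : ℂ) ^ 2 = 2 := by
    rw [← Complex.ofReal_pow, Real.sq_sqrt (by norm_num)]; norm_num
  have hs0 : ((√2 : ℝ) : ℂ) ≠ 0 := by exact_mod_cast sqrt_two_ne_zero
  have hγ : complexify d ((√2 : ℝ)⁻¹ • γ) = ((√2 : ℝ) : ℂ)⁻¹ • complexify d γ := by
    ext i; simp
  simp only [bargmannIntegrand, ht, hγ, map_add, bilin_add_left, bilin_add_right, bilin_smul_left,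
    bilin_smul_right, bilin_complexify, bilin_comm (complexify d γ) z]
  have hherm : ∀ a b : EuclideanSpace ℂ (Fin d),
      herm a (((√2 : ℝ) : ℂ)⁻¹ • b) = ((√2 : ℝ) : ℂ)⁻¹ * herm a b := by
    intro a b
    simp only [herm, PiLp.smul_apply, smul_eq_mul, map_mul, map_inv₀, Complex.conj_ofReal,
      Finset.mul_sum]
    exact Finset.sum_congr rfl fun i _ => by ring
  rw [hherm, herm_complexify]
  simp only [bilin_add_left, bilin_smul_left, bilin_complexify]
  have hn : ‖t + γ‖ ^ 2 = ‖t‖ ^ 2 + 2 * inner ℝ t γ + ‖γ‖ ^ 2 := norm_add_sq_real t γ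
  rw [hn]
  simp only [Complex.ofReal_exp, inner_add_left, inner_smul_left, real_inner_self_eq_norm_sq,
    real_inner_comm t γ]
  have hexp : ∀ A B C D E G u : ℂ, A + B + C = D + E + G →
      Complex.exp A * (c * Complex.exp B * u) * Complex.exp C =
        c * Complex.exp D * (Complex.exp E * u * Complex.exp G) := by
    intro A B C D E G u h
    have h1 : Complex.exp A * Complex.exp B * Complex.exp C =
        Complex.exp D * Complex.exp E * Complex.exp G := by
      rw [← Complex.exp_add, ← Complex.exp_add, ← Complex.exp_add, ← Complex.exp_add, h]
    linear_combination c * u * h1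
  apply hexp
  push_cast
  simp
  field_simp
  linear_combination (2 * ν * √2 * bilin z (complexify d γ) + ν * ‖γ‖ ^ 2) * hs

end Forward

/-! ### Growth of entire quasi-periodic functions -/

section Invariance

variable {d : ℕ}

lemma tubePoint_add_complexify (x y γ : EuclideanSpace ℝ (Fin d)) :
    tubePoint x y + complexify d γ = tubePoint (x + γ) y := by
  rw [← tubePoint_zero_right, ← tubePoint_add, add_zero]

lemma herm_add_half_complexify (z : EuclideanSpace ℂ (Fin d)) (γ : EuclideanSpace ℝ (Fin d)) :
    herm (z + (2⁻¹ : ℂ) • complexify d γ) (complexify d γ) =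
      bilin z (complexify d γ) + ((‖γ‖ ^ 2 / 2 : ℝ) : ℂ) := by
  rw [herm_complexify, bilin_add_left, bilin_smul_left, bilin_complexify,
    real_inner_self_eq_norm_sq]
  push_cast
  ring

/-- The quasi-periodicity of `φ` with a unitary factor makes `|φ|² e^{-ν ‖x‖²}` periodic. -/
lemma realDensity_add {ν : ℝ} {φ : EuclideanSpace ℝ (Fin d) → ℂ} {x γ : EuclideanSpace ℝ (Fin d)}
    {c : ℂ} (hc : ‖c‖ = 1)
    (h : φ (x + γ) = c * Complex.exp (((ν * inner ℝ (x + (2⁻¹ : ℝ) • γ) γ : ℝ) : ℂ)) * φ x) :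
    realDensity ν φ (x + γ) = realDensity ν φ x := by
  have hc' : ‖c‖ₑ = 1 := by rw [← ofReal_norm, hc, ENNReal.ofReal_one]
  rw [realDensity, realDensity, h, enorm_mul, enorm_mul, hc', one_mul, enorm_cexp, mul_pow,
    ofReal_sq_exp, mul_comm _ (‖φ x‖ₑ ^ 2), mul_assoc, ofReal_exp_mul]
  congr 3
  rw [norm_add_sq_real, Complex.ofReal_re, inner_add_left, inner_smul_left,
    real_inner_self_eq_norm_sq]
  simp
  ring

/-- The quasi-periodicity of `F` with a unitary factor makes `|F|² e^{-ν ‖z‖²}` periodic. -/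
lemma complexDensity_add {ν : ℝ} {F : EuclideanSpace ℂ (Fin d) → ℂ} {z : EuclideanSpace ℂ (Fin d)}
    {γ : EuclideanSpace ℝ (Fin d)} {c : ℂ} (hc : ‖c‖ = 1)
    (h : F (z + complexify d γ) =
      c * Complex.exp (ν * herm (z + (2⁻¹ : ℂ) • complexify d γ) (complexify d γ)) * F z) :
    complexDensity ν F (z + complexify d γ) = complexDensity ν F z := by
  have hc' : ‖c‖ₑ = 1 := by rw [← ofReal_norm, hc, ENNReal.ofReal_one]
  rw [complexDensity, complexDensity, h, enorm_mul, enorm_mul, hc', one_mul, enorm_cexp, mul_pow,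
    ofReal_sq_exp, mul_comm _ (‖F z‖ₑ ^ 2), mul_assoc, ofReal_exp_mul]
  congr 3
  rw [herm_add_half_complexify, Complex.re_ofReal_mul, Complex.add_re, Complex.ofReal_re,
    ← tubePoint_rePart_imPart z, tubePoint_add_complexify, norm_tubePoint_sq, norm_tubePoint_sq,
    norm_add_sq_real, bilin_tubePoint_complexify]
  simp
  ring

end Invariance

section Growth

variable {d : ℕ}

lemma exists_pos_le_norm (Γ : AddSubgroup (EuclideanSpace ℝ (Fin d))) [DiscreteTopology Γ] :
    ∃ r > 0, ∀ γ ∈ shiftedLattice Γ, ‖γ‖ < 2 * r → γ = 0 := by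
  obtain ⟨ε, hε, h⟩ := Metric.isOpen_singleton_iff.1 (isOpen_discrete ({0} : Set Γ))
  refine ⟨(√2)⁻¹ * ε / 2, by positivity, fun γ hγ hn => ?_⟩
  obtain ⟨γ', hγ', rfl⟩ := exists_of_mem_shiftedLattice hγ
  have h2 : (⟨γ', hγ'⟩ : Γ) = 0 := by
    apply h
    rw [dist_zero_right]
    rw [norm_smul, Real.norm_of_nonneg (by positivity)] at hn
    have h3 : (√2 : ℝ)⁻¹ * ‖γ'‖ < (√2 : ℝ)⁻¹ * ε := by linarith
    exact lt_of_mul_lt_mul_left h3 (by positivity)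
  rw [show γ' = 0 from congrArg Subtype.val h2, smul_zero]

/-- The translates of a thin enough tube by the lattice are disjoint, so the mass of an invariant
density on the tube is at most its mass on a fundamental domain. -/
lemma setLIntegral_tube_le {Γ : AddSubgroup (EuclideanSpace ℝ (Fin d))} [Countable Γ]
    {r : ℝ} (hr : ∀ γ ∈ Γ, ‖γ‖ < 2 * r → γ = 0)
    {Λ' : Set (EuclideanSpace ℂ (Fin d))}
    (hΛ' : IsAddFundamentalDomain (Γ.map (complexify d)) Λ' volume)
    {D : EuclideanSpace ℂ (Fin d) → ℝ≥0∞} (hD : Measurable D)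
    (hinv : ∀ γ ∈ Γ, ∀ z, D (z + complexify d γ) = D z) (x₀ : EuclideanSpace ℝ (Fin d)) :
    ∫⁻ z in rePart ⁻¹' Metric.ball x₀ r, D z ≤ ∫⁻ z in Λ', D z := by
  have : Countable (Γ.map (complexify d)) := by
    have h1 : Function.Surjective (fun γ : Γ => (⟨complexify d γ,
      AddSubgroup.mem_map_of_mem _ γ.2⟩ : Γ.map (complexify d))) := by
      rintro ⟨w, hw⟩
      obtain ⟨x, hx, rfl⟩ := AddSubgroup.mem_map.1 hw
      exact ⟨⟨x, hx⟩, rfl⟩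
    exact h1.countable
  set S : Set (EuclideanSpace ℂ (Fin d)) := rePart ⁻¹' Metric.ball x₀ r with hS
  have hSm : MeasurableSet S := continuous_rePart.measurable Metric.isOpen_ball.measurableSet
  have hm : ∀ g : Γ.map (complexify d), AEMeasurable (fun z => S.indicator D (g +ᵥ z))
      (volume.restrict Λ') := fun g =>
    ((hD.indicator hSm).comp (measurable_const_vadd g)).aemeasurable
  rw [← lintegral_indicator hSm, hΛ'.lintegral_eq_tsum'', ← lintegral_tsum hm]
  refine lintegral_mono fun z => ?_
  have hval : ∀ g : Γ.map (complexify d), S.indicator D (g +ᵥ z) ≤ D z := by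
    rintro ⟨w, hw⟩
    obtain ⟨γ, hγ, rfl⟩ := AddSubgroup.mem_map.1 hw
    refine (Set.indicator_le_self _ _ _).trans ?_
    rw [AddSubgroup.vadd_def, vadd_eq_add, add_comm, hinv γ hγ]
  by_cases hex : ∃ g : Γ.map (complexify d), g +ᵥ z ∈ S
  · obtain ⟨g, hg⟩ := hex
    refine (tsum_eq_single g fun g' hg' => ?_).trans_le (hval g)
    refine Set.indicator_of_notMem (fun hgS => hg' ?_) _
    obtain ⟨w, hw⟩ := g
    obtain ⟨w', hw'⟩ := g'
    obtain ⟨γ, hγ, rfl⟩ := AddSubgroup.mem_map.1 hw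
    obtain ⟨γ', hγ', rfl⟩ := AddSubgroup.mem_map.1 hw'
    have hre : ∀ γ : EuclideanSpace ℝ (Fin d), rePart (complexify d γ + z) = γ + rePart z := by
      intro γ; ext i; simp [rePart]
    simp only [hS, Set.mem_preimage, AddSubgroup.vadd_def, vadd_eq_add, hre, Metric.mem_ball]
      at hg hgS
    have h0 := hr (γ' - γ) (Γ.sub_mem hγ' hγ) (by
      have h1 := dist_triangle_right (γ' + rePart z) (γ + rePart z) x₀
      rw [dist_eq_norm, add_sub_add_right_eq_sub] at h1
      linarith)
    simp [sub_eq_zero.1 h0]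
  · push Not at hex
    simp [Set.indicator_of_notMem (hex _)]

lemma enorm_laplaceLift_sq (ν : ℝ) (F : EuclideanSpace ℂ (Fin d) → ℂ)
    (z : EuclideanSpace ℂ (Fin d)) :
    ‖laplaceLift ν F z‖ₑ ^ 2 =
      ENNReal.ofReal (Real.exp (2 * ν * ‖rePart z‖ ^ 2)) * complexDensity ν F z := by
  have h := complexDensity_tubePoint ν F (rePart z) (imPart z)
  rw [tubePoint_rePart_imPart] at h
  rw [h, mul_left_comm, ofReal_exp_mul]
  ring_nf
  simp

lemma differentiable_laplaceLift (ν : ℝ) {F : EuclideanSpace ℂ (Fin d) → ℂ}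
    (hF : Differentiable ℂ F) : Differentiable ℂ (laplaceLift ν F) :=
  hF.mul ((differentiable_bilin_self.const_mul _).cexp)

lemma setLIntegral_laplaceLift_ne_top {ν : ℝ} (hν : 0 < ν) {F : EuclideanSpace ℂ (Fin d) → ℂ}
    {r : ℝ} {x₀ : EuclideanSpace ℝ (Fin d)}
    (h : ∫⁻ z in rePart ⁻¹' Metric.ball x₀ r, complexDensity ν F z ≠ ∞) :
    ∫⁻ z in rePart ⁻¹' Metric.ball x₀ r, ‖laplaceLift ν F z‖ₑ ^ 2 ≠ ∞ := by
  have hSm : MeasurableSet (rePart ⁻¹' Metric.ball x₀ r) :=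
    continuous_rePart.measurable Metric.isOpen_ball.measurableSet
  have h1 : ∫⁻ z in rePart ⁻¹' Metric.ball x₀ r, ‖laplaceLift ν F z‖ₑ ^ 2 ≤
      ∫⁻ z in rePart ⁻¹' Metric.ball x₀ r,
        ENNReal.ofReal (Real.exp (2 * ν * (‖x₀‖ + r) ^ 2)) * complexDensity ν F z := by
    refine setLIntegral_mono' hSm fun z hz => ?_
    rw [enorm_laplaceLift_sq]
    gcongr
    rw [Set.mem_preimage, Metric.mem_ball, dist_eq_norm] at hz
    linarith [norm_le_norm_add_norm_sub' (rePart z) x₀]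
  refine ne_top_of_le_ne_top ?_ h1
  rw [lintegral_const_mul' _ _ ENNReal.ofReal_ne_top]
  exact ENNReal.mul_ne_top ENNReal.ofReal_ne_top h

/-- Finite mass on tubes of a fixed radius bounds the lift pointwise, by the mean value inequality
for entire functions. -/
lemma boundedOnTubes_laplaceLift {ν : ℝ} (hν : 0 < ν) {F : EuclideanSpace ℂ (Fin d) → ℂ}
    (hF : Differentiable ℂ F) {r : ℝ} (hr : 0 < r)
    (h : ∀ x₀, ∫⁻ z in rePart ⁻¹' Metric.ball x₀ r, complexDensity ν F z ≠ ∞) :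
    BoundedOnTubes (laplaceLift ν F) := by
  intro x₀
  set M := (volume (Metric.ball (0 : EuclideanSpace ℂ (Fin d)) (r / 2)))⁻¹ *
    ∫⁻ z in rePart ⁻¹' Metric.ball x₀ r, ‖laplaceLift ν F z‖ₑ ^ 2 with hM
  have hMt : M ≠ ∞ := ENNReal.mul_ne_top
    (ENNReal.inv_ne_top.2 (Metric.measure_ball_pos _ _ (half_pos hr)).ne')
    (setLIntegral_laplaceLift_ne_top hν (h x₀))
  refine ⟨r / 2, half_pos hr, √M.toReal, fun x hx y => ?_⟩
  have h1 := enorm_sq_le_lintegral_ball (differentiable_laplaceLift ν hF) (tubePoint x y)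
    (half_pos hr)
  have h2 : ∫⁻ u in Metric.ball (tubePoint x y) (r / 2), ‖laplaceLift ν F u‖ₑ ^ 2 ≤
      ∫⁻ z in rePart ⁻¹' Metric.ball x₀ r, ‖laplaceLift ν F z‖ₑ ^ 2 := by
    refine lintegral_mono_set fun u hu => ?_
    rw [Metric.mem_ball, dist_eq_norm] at hu hx
    rw [Set.mem_preimage, Metric.mem_ball, dist_eq_norm]
    have h3 := norm_rePart_le (u - tubePoint x y)
    rw [rePart_sub, rePart_tubePoint] at h3
    linarith [norm_sub_le_norm_sub_add_norm_sub (rePart u) x x₀]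
  have h3 : ‖laplaceLift ν F (tubePoint x y)‖ₑ ^ 2 ≤ M := h1.trans (by rw [hM]; gcongr)
  refine Real.le_sqrt_of_sq_le ?_
  have h4 := ENNReal.toReal_mono hMt h3
  rwa [ENNReal.toReal_pow, toReal_enorm] at h4

/-- By Tonelli's theorem on tubes, almost all vertical slices of the lift are square integrable. -/
lemma ae_lintegral_vertical_ne_top {ν : ℝ} (hν : 0 < ν) {F : EuclideanSpace ℂ (Fin d) → ℂ}
    (hF : Differentiable ℂ F) {r : ℝ} (hr : 0 < r)
    (h : ∀ x₀, ∫⁻ z in rePart ⁻¹' Metric.ball x₀ r, complexDensity ν F z ≠ ∞) :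
    ∀ᵐ x, ∫⁻ y, ‖laplaceLift ν F (tubePoint x y)‖ₑ ^ 2 ≠ ∞ := by
  set N : EuclideanSpace ℝ (Fin d) → ℝ≥0∞ := fun x => ∫⁻ y, ‖laplaceLift ν F (tubePoint x y)‖ₑ ^ 2
    with hN
  have hKm : Measurable fun z => ‖laplaceLift ν F z‖ₑ ^ 2 :=
    (differentiable_laplaceLift ν hF).continuous.measurable.enorm.pow_const 2
  have hNm : Measurable N := (hKm.comp continuous_tubePoint.measurable).lintegral_prod_right'
  refine measure_null_of_locally_null _ fun x₀ _ => ?_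
  refine ⟨{x | ¬ N x ≠ ∞} ∩ Metric.ball x₀ r, ?_, ?_⟩
  · exact inter_mem_nhdsWithin _ (Metric.ball_mem_nhds _ hr)
  have hSm : MeasurableSet (rePart ⁻¹' Metric.ball x₀ r) :=
    continuous_rePart.measurable Metric.isOpen_ball.measurableSet
  have h1 := setLIntegral_laplaceLift_ne_top hν (h x₀)
  rw [← lintegral_indicator hSm, lintegral_tube (hKm.indicator hSm).aemeasurable] at h1
  have h2 : ∫⁻ x in Metric.ball x₀ r, N x ≠ ∞ := by
    rw [← lintegral_indicator Metric.isOpen_ball.measurableSet]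
    refine ne_top_of_le_ne_top h1 (lintegral_mono fun x => ?_)
    by_cases hx : x ∈ Metric.ball x₀ r
    · rw [Set.indicator_of_mem hx, hN]
      refine lintegral_mono fun y => ?_
      rw [Set.indicator_of_mem (by simpa using hx)]
    · simp [Set.indicator_of_notMem hx]
  have h3 := ae_lt_top hNm h2
  have hlt : MeasurableSet {x | ¬ N x < ∞} := (measurableSet_lt hNm measurable_const).compl
  rw [ae_iff, Measure.restrict_apply hlt] at h3
  convert h3 using 2
  ext x
  simp

end Growth

/-! ### Surjectivity -/

section Surjective

variable {d : ℕ}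

/-- The vertical slice of `K` over `x`, parametrized by the frequency `w` at which the Fourier
transform of `laplaceSlice ν φ x` has to be taken to obtain a multiple of `K`, when `K` is the lift
of the Segal–Bargmann transform of `φ`. -/
def frequencySlice (ν : ℝ) (K : EuclideanSpace ℂ (Fin d) → ℂ) (x w : EuclideanSpace ℝ (Fin d)) :
    ℂ :=
  K (tubePoint x (-(2 * Real.pi / (√2 * ν)) • w))

lemma frequencySlice_smul {ν : ℝ} (hν : 0 < ν) (K : EuclideanSpace ℂ (Fin d) → ℂ)
    (x y : EuclideanSpace ℝ (Fin d)) :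
    frequencySlice ν K x (-(√2 * ν / (2 * Real.pi)) • y) = K (tubePoint x y) := by
  have hpi := Real.pi_pos
  have h2 : (0 : ℝ) < √2 := by positivity
  rw [frequencySlice, smul_smul]
  have : -(2 * Real.pi / (√2 * ν)) * -(√2 * ν / (2 * Real.pi)) = 1 := by field_simp
  rw [this, one_smul]

lemma lintegral_frequencySlice {ν : ℝ} (hν : 0 < ν) (K : EuclideanSpace ℂ (Fin d) → ℂ)
    (x : EuclideanSpace ℝ (Fin d)) :
    ∫⁻ y, ‖K (tubePoint x y)‖ₑ ^ 2 =
      ENNReal.ofReal ((2 * Real.pi / (√2 * ν)) ^ d) * ∫⁻ w, ‖frequencySlice ν K x w‖ₑ ^ 2 := by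
  rw [← lintegral_vertical_scale hν fun w => ‖frequencySlice ν K x w‖ₑ ^ 2]
  simp only [frequencySlice_smul hν]

lemma continuous_frequencySlice (ν : ℝ) {K : EuclideanSpace ℂ (Fin d) → ℂ} (hK : Continuous K)
    (x : EuclideanSpace ℝ (Fin d)) : Continuous (frequencySlice ν K x) :=
  hK.comp (continuous_tubePoint.comp (continuous_const.prodMk (continuous_const_smul _)))

lemma memLp_frequencySlice {ν : ℝ} (hν : 0 < ν) {K : EuclideanSpace ℂ (Fin d) → ℂ}
    (hK : Continuous K) {x : EuclideanSpace ℝ (Fin d)}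
    (h : ∫⁻ y, ‖K (tubePoint x y)‖ₑ ^ 2 ≠ ∞) : MemLp (frequencySlice ν K x) 2 := by
  refine ⟨(continuous_frequencySlice ν hK x).aestronglyMeasurable, ?_⟩
  rw [eLpNorm_lt_top_iff_lintegral_rpow_enorm_lt_top (by norm_num) (by norm_num)]
  rw [lintegral_frequencySlice hν] at h
  have hpi := Real.pi_pos
  have hpos : ENNReal.ofReal ((2 * Real.pi / (√2 * ν)) ^ d) ≠ 0 := by
    rw [ENNReal.ofReal_ne_zero_iff]; positivity
  simpa using (ENNReal.lt_top_of_mul_ne_top_right h hpos)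

/-- The inverse Fourier transform turns modulation into translation, for `L²` classes. -/
lemma coeFn_fourierInv_modulate {u u' : Lp ℂ 2 (volume : Measure (EuclideanSpace ℝ (Fin d)))}
    {A : ℂ} {γ : EuclideanSpace ℝ (Fin d)}
    (h : ∀ᵐ w, u' w = A * Complex.exp (-(2 * Real.pi * Complex.I * (inner ℝ w γ : ℝ))) * u w) :
    ∀ᵐ t, (𝓕⁻ u' : Lp ℂ 2 (volume : Measure _)) (t + γ) =
      A * (𝓕⁻ u : Lp ℂ 2 (volume : Measure _)) t := by
  have hmem : MemLp (fun t => (𝓕⁻ u' : Lp ℂ 2 (volume : Measure _)) (t + γ)) 2 :=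
    (Lp.memLp _).comp_measurePreserving (measurePreserving_add_right volume γ)
  refine ae_eq_of_integral_schwartz_mul_eq (hmem.locallyIntegrable (by norm_num))
    (((Lp.memLp (𝓕⁻ u : Lp ℂ 2 (volume : Measure _))).const_mul A).locallyIntegrable
      (by norm_num)) fun ψ => ?_
  have hψ1 : Integrable fun t => ψ (t - γ) := ψ.integrable.comp_sub_right γ
  have hψ2 : MemLp (fun t => ψ (t - γ)) 2 :=
    (ψ.memLp 2 volume).comp_measurePreserving (measurePreserving_sub_right volume γ)
  have h1 := integral_fourierInv_mul (u := u') hψ1 hψ2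
  have h2 := integral_fourierInv_mul (u := u) ψ.integrable (ψ.memLp 2 volume)
  have hF : ∀ w, 𝓕⁻ (fun t => ψ (t - γ)) w =
      Complex.exp (2 * Real.pi * Complex.I * (inner ℝ w γ : ℝ)) * 𝓕⁻ (ψ : _ → ℂ) w := by
    intro w
    rw [Real.fourierInv_eq', Real.fourierInv_eq', ← integral_add_right_eq_self _ γ,
      ← integral_const_mul]
    congr 1
    ext t
    rw [add_sub_cancel_right, smul_eq_mul, smul_eq_mul, ← mul_assoc, ← Complex.exp_add,
      inner_add_left, real_inner_comm w γ]
    congr 2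
    push_cast
    ring
  calc ∫ t, ψ t * (𝓕⁻ u' : Lp ℂ 2 (volume : Measure _)) (t + γ)
      = ∫ t, (𝓕⁻ u' : Lp ℂ 2 (volume : Measure _)) t * ψ (t - γ) := by
        rw [← integral_add_right_eq_self
          (fun t => (𝓕⁻ u' : Lp ℂ 2 (volume : Measure _)) t * ψ (t - γ)) γ]
        simp [mul_comm]
    _ = ∫ w, A * (u w * 𝓕⁻ (ψ : _ → ℂ) w) := by
        rw [h1]
        refine integral_congr_ae ?_
        filter_upwards [h] with w hw
        have : Complex.exp (-(2 * Real.pi * Complex.I * (inner ℝ w γ : ℝ))) *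
            Complex.exp (2 * Real.pi * Complex.I * (inner ℝ w γ : ℝ)) = 1 := by
          rw [← Complex.exp_add]; simp
        rw [hw, hF]
        linear_combination (A * u w * 𝓕⁻ (ψ : _ → ℂ) w) * this
    _ = ∫ t, ψ t * (A * (𝓕⁻ u : Lp ℂ 2 (volume : Measure _)) t) := by
        rw [integral_const_mul, ← h2, ← integral_const_mul]
        congr 1
        ext t
        ring

/-- The Paley–Wiener lemma in the scale of the Segal–Bargmann transform: up to a real exponential,
the inverse Fourier transform of a slice does not depend on the slice. -/
lemma fourierInv_frequencySlice_ae_eq {ν : ℝ} (hν : 0 < ν) {K : EuclideanSpace ℂ (Fin d) → ℂ}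
    (hK : Differentiable ℂ K) (hb : BoundedOnTubes K) {x x' : EuclideanSpace ℝ (Fin d)}
    (hx : MemLp (frequencySlice ν K x) 2) (hx' : MemLp (frequencySlice ν K x') 2) :
    ∀ᵐ t, Real.exp (-(√2 * ν * inner ℝ x t)) * (𝓕⁻ (hx.toLp _) : Lp ℂ 2 (volume : Measure _)) t =
      Real.exp (-(√2 * ν * inner ℝ x' t)) * (𝓕⁻ (hx'.toLp _) : Lp ℂ 2 (volume : Measure _)) t := by
  have h2 : (0 : ℝ) < √2 := by positivity
  have hc : 0 < √2 * ν := by positivity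
  set L : EuclideanSpace ℂ (Fin d) → ℂ := fun ζ => K (((√2 * ν)⁻¹ : ℝ) • ζ) with hL
  have hLd : Differentiable ℂ L := by fun_prop
  have hLtube : ∀ s y, L (tubePoint s y) = K (tubePoint ((√2 * ν)⁻¹ • s) ((√2 * ν)⁻¹ • y)) := by
    intro s y
    simp only [hL]
    rw [tubePoint_smul]
    rfl
  have hLb : BoundedOnTubes L := by
    intro s₀
    obtain ⟨r, hr, C, hC⟩ := hb ((√2 * ν)⁻¹ • s₀)
    refine ⟨√2 * ν * r, by positivity, C, fun s hs y => ?_⟩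
    rw [hLtube]
    refine hC _ ?_ _
    rw [Metric.mem_ball] at hs ⊢
    rw [dist_smul₀, Real.norm_of_nonneg (by positivity), inv_mul_lt_iff₀ hc]
    exact hs
  have e : ∀ x, (fun w => L (tubePoint ((√2 * ν) • x) (-(2 * Real.pi) • w))) =
      frequencySlice ν K x := by
    intro x
    ext w
    rw [hLtube, frequencySlice, smul_smul, inv_mul_cancel₀ hc.ne', one_smul, smul_smul]
    congr 3
    field_simp
  have hx1 : MemLp (fun w => L (tubePoint ((√2 * ν) • x) (-(2 * Real.pi) • w))) 2 := by rwa [e]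
  have hx1' : MemLp (fun w => L (tubePoint ((√2 * ν) • x') (-(2 * Real.pi) • w))) 2 := by rwa [e]
  have key := fourierInv_slice_ae_eq hLd hLb hx1 hx1'
  rw [MemLp.toLp_congr hx1 hx (Filter.EventuallyEq.of_eq (e x)),
    MemLp.toLp_congr hx1' hx' (Filter.EventuallyEq.of_eq (e x'))] at key
  simpa only [inner_smul_left, conj_trivial] using key

lemma frequencySlice_laplaceLift_add {ν : ℝ} (hν : 0 < ν) {F : EuclideanSpace ℂ (Fin d) → ℂ}
    {γ : EuclideanSpace ℝ (Fin d)} {c : ℂ}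
    (hF : ∀ z, F (z + complexify d ((√2 : ℝ)⁻¹ • γ)) =
      c * Complex.exp (ν * herm (z + (2⁻¹ : ℂ) • complexify d ((√2 : ℝ)⁻¹ • γ))
        (complexify d ((√2 : ℝ)⁻¹ • γ))) * F z) (x w : EuclideanSpace ℝ (Fin d)) :
    frequencySlice ν (laplaceLift ν F) (x + (√2 : ℝ)⁻¹ • γ) w =
      c * Real.exp (√2 * ν * inner ℝ x γ + ν / 2 * ‖γ‖ ^ 2) *
        Complex.exp (-(2 * Real.pi * Complex.I * (inner ℝ w γ : ℝ))) *
          frequencySlice ν (laplaceLift ν F) x w := by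
  simp only [frequencySlice]
  set y := -(2 * Real.pi / (√2 * ν)) • w with hy
  rw [← tubePoint_add_complexify, laplaceLift, laplaceLift, hF, Complex.ofReal_exp]
  have hexp : ∀ A B D E G f : ℂ, A + B = D + E + G →
      c * Complex.exp A * f * Complex.exp B =
        c * Complex.exp D * Complex.exp E * (f * Complex.exp G) := by
    intro A B D E G f h
    have h1 : Complex.exp A * Complex.exp B = Complex.exp D * Complex.exp E * Complex.exp G := by
      rw [← Complex.exp_add, ← Complex.exp_add, ← Complex.exp_add, h]
    linear_combination c * f * h1
  apply hexp
  rw [herm_add_half_complexify, bilin_add_left, bilin_add_right, bilin_add_right,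
    bilin_comm (complexify d ((√2 : ℝ)⁻¹ • γ)) (tubePoint x y), bilin_complexify,
    bilin_tubePoint_complexify, hy]
  simp only [inner_smul_left, inner_smul_right, real_inner_self_eq_norm_sq, norm_smul]
  have hs : ((√2 : ℝ) : ℂ) ^ 2 = 2 := by
    rw [← Complex.ofReal_pow, Real.sq_sqrt (by norm_num)]; norm_num
  have hs0 : ((√2 : ℝ) : ℂ) ≠ 0 := by exact_mod_cast sqrt_two_ne_zero
  have hν0 : (ν : ℂ) ≠ 0 := by exact_mod_cast hν.ne'
  have hn : ‖(√2 : ℝ)⁻¹‖ = (√2 : ℝ)⁻¹ := Real.norm_of_nonneg (by positivity)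
  rw [hn]
  simp only [conj_trivial]
  push_cast
  generalize bilin (tubePoint x (-(2 * Real.pi / (√2 * ν)) • w))
    (tubePoint x (-(2 * Real.pi / (√2 * ν)) • w)) = Q
  field_simp
  linear_combination (-(2 * ν * √2 * (inner ℝ x γ : ℝ) + ν * (‖γ‖ : ℂ) ^ 2 -
    4 * Complex.I * Real.pi * (inner ℝ w γ : ℝ))) * hs

/-- The function whose Segal–Bargmann transform has lift `K`, computed from the vertical slice of
`K` over one point `x` where this slice is square integrable. By the Paley–Wiener lemma the result
does not depend on `x`. -/
def inverseBargmann (ν : ℝ) {K : EuclideanSpace ℂ (Fin d) → ℂ} {x : EuclideanSpace ℝ (Fin d)}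
    (hx : MemLp (frequencySlice ν K x) 2) (t : EuclideanSpace ℝ (Fin d)) : ℂ :=
  (((ν / Real.pi) ^ (3 * (d : ℝ) / 4))⁻¹ * Real.exp (ν * ‖t‖ ^ 2 - √2 * ν * inner ℝ x t) : ℝ) *
    (𝓕⁻ (hx.toLp _) : Lp ℂ 2 (volume : Measure _)) t

lemma aestronglyMeasurable_inverseBargmann (ν : ℝ) {K : EuclideanSpace ℂ (Fin d) → ℂ}
    {x : EuclideanSpace ℝ (Fin d)} (hx : MemLp (frequencySlice ν K x) 2) :
    AEStronglyMeasurable (inverseBargmann ν hx) :=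
  (Continuous.aestronglyMeasurable (by fun_prop)).mul (Lp.aestronglyMeasurable _)

lemma laplaceSlice_inverseBargmann {ν : ℝ} (hν : 0 < ν) {K : EuclideanSpace ℂ (Fin d) → ℂ}
    (hK : Differentiable ℂ K) (hb : BoundedOnTubes K) {x x' : EuclideanSpace ℝ (Fin d)}
    (hx : MemLp (frequencySlice ν K x) 2) (hx' : MemLp (frequencySlice ν K x') 2) :
    ∀ᵐ t, laplaceSlice ν (inverseBargmann ν hx) x' t =
      (((ν / Real.pi) ^ (3 * (d : ℝ) / 4))⁻¹ : ℝ) *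
        (𝓕⁻ (hx'.toLp _) : Lp ℂ 2 (volume : Measure _)) t := by
  filter_upwards [fourierInv_frequencySlice_ae_eq hν hK hb hx hx'] with t ht
  rw [laplaceSlice, inverseBargmann]
  have h1 : Real.exp (√2 * ν * inner ℝ x' t) * Real.exp (-(√2 * ν * inner ℝ x' t)) = 1 := by
    rw [← Real.exp_add]; simp
  have h2 : Real.exp (ν * ‖t‖ ^ 2 - √2 * ν * inner ℝ x t) * Real.exp (-ν * ‖t‖ ^ 2) =
      Real.exp (-(√2 * ν * inner ℝ x t)) := by
    rw [← Real.exp_add]; congr 1; ring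
  have h1' : (Real.exp (√2 * ν * inner ℝ x' t) : ℂ) * Real.exp (-(√2 * ν * inner ℝ x' t)) = 1 := by
    exact_mod_cast h1
  have h2' : (Real.exp (ν * ‖t‖ ^ 2 - √2 * ν * inner ℝ x t) : ℂ) * Real.exp (-ν * ‖t‖ ^ 2) =
      Real.exp (-(√2 * ν * inner ℝ x t)) := by
    exact_mod_cast h2
  rw [Complex.ofReal_mul]
  set C : ℂ := ((((ν / Real.pi) ^ (3 * (d : ℝ) / 4))⁻¹ : ℝ) : ℂ)
  set u := (𝓕⁻ (hx.toLp _) : Lp ℂ 2 (volume : Measure _)) t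
  set u' := (𝓕⁻ (hx'.toLp _) : Lp ℂ 2 (volume : Measure _)) t
  linear_combination (Real.exp (√2 * ν * inner ℝ x' t) : ℂ) * C * u * h2' +
    (Real.exp (√2 * ν * inner ℝ x' t) : ℂ) * C * ht + C * u' * h1'

/-- Quasi-periodicity of the inverse transform: `F` relates its slices over `x` and `x + γ/√2` by a
modulation, hence their inverse Fourier transforms by a translation, and the Paley–Wiener lemma
compares the two slices. -/
lemma inverseBargmann_add {ν : ℝ} (hν : 0 < ν) {F : EuclideanSpace ℂ (Fin d) → ℂ}
    (hF : Differentiable ℂ F) (hb : BoundedOnTubes (laplaceLift ν F))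
    {γ : EuclideanSpace ℝ (Fin d)} {c : ℂ}
    (hγ : ∀ z, F (z + complexify d ((√2 : ℝ)⁻¹ • γ)) =
      c * Complex.exp (ν * herm (z + (2⁻¹ : ℂ) • complexify d ((√2 : ℝ)⁻¹ • γ))
        (complexify d ((√2 : ℝ)⁻¹ • γ))) * F z) {x : EuclideanSpace ℝ (Fin d)}
    (hx : MemLp (frequencySlice ν (laplaceLift ν F) x) 2) :
    ∀ᵐ t, inverseBargmann ν hx (t + γ) =
      c * Complex.exp (((ν * inner ℝ (t + (2⁻¹ : ℝ) • γ) γ : ℝ) : ℂ)) *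
        inverseBargmann ν hx t := by
  have hslice := frequencySlice_laplaceLift_add hν hγ x
  set A : ℂ := c * Real.exp (√2 * ν * inner ℝ x γ + ν / 2 * ‖γ‖ ^ 2) with hA
  have hKd := differentiable_laplaceLift ν hF
  have hx' : MemLp (frequencySlice ν (laplaceLift ν F) (x + (√2 : ℝ)⁻¹ • γ)) 2 := by
    refine (hx.const_mul A).of_le
      (continuous_frequencySlice ν hKd.continuous _).aestronglyMeasurable
      (Filter.Eventually.of_forall fun w => ?_)
    rw [hslice, norm_mul, norm_mul A, norm_mul A, Complex.norm_exp]
    simp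
  have h1 := coeFn_fourierInv_modulate (u := hx.toLp _) (u' := hx'.toLp _) (A := A) (γ := γ) (by
    filter_upwards [hx.coeFn_toLp, hx'.coeFn_toLp] with w hw hw'
    rw [hw, hw', hslice])
  have h2 := (measurePreserving_add_right volume γ).quasiMeasurePreserving.ae
    (fourierInv_frequencySlice_ae_eq hν hKd hb hx hx')
  filter_upwards [h1, h2] with t ht1 ht2
  rw [ht1, hA] at ht2
  rw [inverseBargmann, inverseBargmann]
  set u := (𝓕⁻ (hx.toLp _) : Lp ℂ 2 (volume : Measure _)) t
  set u' := (𝓕⁻ (hx.toLp _) : Lp ℂ 2 (volume : Measure _)) (t + γ)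
  have hsplit : ∀ a : ℝ, ((((ν / Real.pi) ^ (3 * (d : ℝ) / 4))⁻¹ * a : ℝ) : ℂ) =
      ((((ν / Real.pi) ^ (3 * (d : ℝ) / 4))⁻¹ : ℝ) : ℂ) * a := fun a => Complex.ofReal_mul _ _
  rw [hsplit, hsplit]
  set C : ℂ := ((((ν / Real.pi) ^ (3 * (d : ℝ) / 4))⁻¹ : ℝ) : ℂ)
  have h3 : (Real.exp (ν * ‖t + γ‖ ^ 2 - √2 * ν * inner ℝ x (t + γ)) : ℂ) =
      Real.exp (ν * ‖t + γ‖ ^ 2) * Real.exp (-(√2 * ν * inner ℝ x (t + γ))) := by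
    rw [← Complex.ofReal_mul, ← Real.exp_add]; rfl
  have h4 : (Real.exp (ν * ‖t + γ‖ ^ 2) : ℂ) *
      Real.exp (-(√2 * ν * inner ℝ (x + (√2 : ℝ)⁻¹ • γ) (t + γ))) *
      Real.exp (√2 * ν * inner ℝ x γ + ν / 2 * ‖γ‖ ^ 2) =
      Complex.exp (((ν * inner ℝ (t + (2⁻¹ : ℝ) • γ) γ : ℝ) : ℂ)) *
        Real.exp (ν * ‖t‖ ^ 2 - √2 * ν * inner ℝ x t) := by
    rw [← Complex.ofReal_exp]
    rw [← Complex.ofReal_mul, ← Complex.ofReal_mul, ← Complex.ofReal_mul, ← Real.exp_add,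
      ← Real.exp_add, ← Real.exp_add]
    congr 2
    rw [norm_add_sq_real]
    simp only [inner_add_left, inner_add_right, inner_smul_left, real_inner_self_eq_norm_sq,
      conj_trivial, real_inner_comm t γ]
    have h2 : √2 * (√2 : ℝ)⁻¹ = 1 := mul_inv_cancel₀ sqrt_two_ne_zero
    linear_combination (-ν * (inner ℝ t γ + ‖γ‖ ^ 2)) * h2
  rw [h3]
  linear_combination C * (Real.exp (ν * ‖t + γ‖ ^ 2) : ℂ) * ht2 + C * c * u * h4

/-- Surjectivity of the transform onto the quasi-periodic entire functions of finite norm. -/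
lemma exists_segalBargmann_eq {ν : ℝ} (hν : 0 < ν) {Γ : AddSubgroup (EuclideanSpace ℝ (Fin d))}
    [DiscreteTopology Γ] {χ : Γ → ℂ} (hχ : ∀ γ, ‖χ γ‖ = 1)
    {Λ : Set (EuclideanSpace ℝ (Fin d))} (hΛ : IsAddFundamentalDomain Γ Λ volume)
    {Λ' : Set (EuclideanSpace ℂ (Fin d))}
    (hΛ' : IsAddFundamentalDomain ((shiftedLattice Γ).map (complexify d)) Λ' volume)
    {F : EuclideanSpace ℂ (Fin d) → ℂ} (hF : Differentiable ℂ F)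
    (hγ : ∀ (γ : Γ) z, F (z + complexify d ((√2 : ℝ)⁻¹ • (γ : EuclideanSpace ℝ (Fin d)))) =
      χ γ * Complex.exp (ν * herm (z + (2⁻¹ : ℂ) •
        complexify d ((√2 : ℝ)⁻¹ • (γ : EuclideanSpace ℝ (Fin d))))
        (complexify d ((√2 : ℝ)⁻¹ • (γ : EuclideanSpace ℝ (Fin d))))) * F z)
    (hfin : ∫⁻ z in Λ', complexDensity ν F z ≠ ∞) :
    ∃ φ : EuclideanSpace ℝ (Fin d) →ₘ[volume] ℂ,
      (∀ γ : Γ, ∀ᵐ x : EuclideanSpace ℝ (Fin d), φ (x + (γ : EuclideanSpace ℝ (Fin d))) =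
        χ γ * Complex.exp (((ν * inner ℝ (x + (2⁻¹ : ℝ) • (γ : EuclideanSpace ℝ (Fin d)))
          (γ : EuclideanSpace ℝ (Fin d)) : ℝ) : ℂ)) * φ x) ∧
      ∫⁻ x in Λ, realDensity ν φ x ≠ ∞ ∧ segalBargmann ν φ = F := by
  have := countable_of_discreteTopology Γ
  have : Countable (shiftedLattice Γ) := by
    have h1 : Function.Surjective (fun γ : Γ => (⟨(√2 : ℝ)⁻¹ • (γ : EuclideanSpace ℝ (Fin d)),
        inv_sqrt_two_smul_mem γ.2⟩ : shiftedLattice Γ)) := by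
      rintro ⟨w, hw⟩
      obtain ⟨γ, hγ, rfl⟩ := exists_of_mem_shiftedLattice hw
      exact ⟨⟨γ, hγ⟩, rfl⟩
    exact h1.countable
  have hpi := Real.pi_pos
  set K := laplaceLift ν F with hKdef
  have hKd : Differentiable ℂ K := differentiable_laplaceLift ν hF
  have hinvF : ∀ γ ∈ shiftedLattice Γ, ∀ z,
      complexDensity ν F (z + complexify d γ) = complexDensity ν F z := by
    intro γ hγ' z
    obtain ⟨γ', h1, rfl⟩ := exists_of_mem_shiftedLattice hγ'
    exact complexDensity_add (hχ ⟨γ', h1⟩) (hγ ⟨γ', h1⟩ z)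
  -- regularity of the lift `K` of `F`: bounded on tubes, with square integrable slices
  obtain ⟨r, hr, hrΓ⟩ := exists_pos_le_norm Γ
  have htube : ∀ x₀, ∫⁻ z in rePart ⁻¹' Metric.ball x₀ r, complexDensity ν F z ≠ ∞ := fun x₀ =>
    ne_top_of_le_ne_top hfin
      (setLIntegral_tube_le hrΓ hΛ' (measurable_complexDensity hF.continuous) hinvF x₀)
  have hb : BoundedOnTubes K := boundedOnTubes_laplaceLift hν hF hr htube
  have hgood : ∀ᵐ x, MemLp (frequencySlice ν K x) 2 := by
    filter_upwards [ae_lintegral_vertical_ne_top hν hF hr htube] with x hx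
    exact memLp_frequencySlice hν hKd.continuous hx
  obtain ⟨x₀, hx₀⟩ := hgood.exists
  set φ := AEEqFun.mk _ (aestronglyMeasurable_inverseBargmann ν hx₀) with hφ
  have hφae : φ =ᵐ[volume] inverseBargmann ν hx₀ := AEEqFun.coeFn_mk _ _
  have hquasi : ∀ γ : Γ, ∀ᵐ x : EuclideanSpace ℝ (Fin d), φ (x + (γ : EuclideanSpace ℝ (Fin d))) =
      χ γ * Complex.exp (((ν * inner ℝ (x + (2⁻¹ : ℝ) • (γ : EuclideanSpace ℝ (Fin d)))
        (γ : EuclideanSpace ℝ (Fin d)) : ℝ) : ℂ)) * φ x := by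
    intro γ
    filter_upwards [hφae, (measurePreserving_add_right volume
      (γ : EuclideanSpace ℝ (Fin d))).quasiMeasurePreserving.ae hφae,
      inverseBargmann_add hν hF hb (hγ γ) hx₀] with x h1 h2 h3
    rw [h1, h2, h3]
  set C : ℝ := (ν / Real.pi) ^ (3 * (d : ℝ) / 4) with hC
  have hCpos : 0 < C := by rw [hC]; positivity
  have hslice : ∀ x (hx : MemLp (frequencySlice ν K x) 2),
      ∀ᵐ t, laplaceSlice ν φ x t =
        (C⁻¹ : ℝ) * (𝓕⁻ (hx.toLp _) : Lp ℂ 2 (volume : Measure _)) t := by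
    intro x hx
    filter_upwards [hφae, laplaceSlice_inverseBargmann hν hKd hb hx₀ hx] with t h1 h2
    rw [← h2, laplaceSlice, laplaceSlice, h1]
  have hrinv : ∀ γ : Γ, ∀ᵐ x, realDensity ν φ (x + γ) = realDensity ν φ x := fun γ =>
    (hquasi γ).mono fun x hx => realDensity_add (hχ γ) hx
  -- the norm identity applies to `φ` and `F` before it is known that `F` is the transform of `φ`,
  -- so `φ` has finite norm
  have hnorm : ∀ᵐ x, ∫⁻ y, ‖K (tubePoint x y)‖ₑ ^ 2 =
      ENNReal.ofReal (sliceConst d ν) * ∫⁻ t, ‖laplaceSlice ν φ x t‖ₑ ^ 2 := by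
    filter_upwards [hgood] with x hx
    have h1 : ∫⁻ t, ‖laplaceSlice ν φ x t‖ₑ ^ 2 =
        ENNReal.ofReal (C⁻¹ ^ 2) * ∫⁻ w, ‖frequencySlice ν K x w‖ₑ ^ 2 := by
      have h2 : ∀ u : Lp ℂ 2 (volume : Measure (EuclideanSpace ℝ (Fin d))),
          ∫⁻ t, ‖u t‖ₑ ^ 2 = ‖u‖ₑ ^ 2 := by
        intro u
        rw [Lp.enorm_def, eLpNorm_eq_lintegral_rpow_enorm_toReal (by norm_num) (by norm_num)]
        rw [← ENNReal.rpow_natCast, ← ENNReal.rpow_mul]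
        simp
      have h3 : ‖(𝓕⁻ (hx.toLp _) : Lp ℂ 2 (volume : Measure (EuclideanSpace ℝ (Fin d))))‖ₑ =
          ‖hx.toLp _‖ₑ := by
        rw [← ofReal_norm, ← ofReal_norm,
          ← Lp.norm_fourier_eq (𝓕⁻ (hx.toLp _) : Lp ℂ 2 (volume : Measure _)),
          FourierTransform.fourier_fourierInv_eq]
      calc _ = ∫⁻ t, ENNReal.ofReal (C⁻¹ ^ 2) *
            ‖(𝓕⁻ (hx.toLp _) : Lp ℂ 2 (volume : Measure _)) t‖ₑ ^ 2 := by
            refine lintegral_congr_ae ?_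
            filter_upwards [hslice x hx] with t ht
            rw [ht, enorm_mul, mul_pow, ← ofReal_norm ((C⁻¹ : ℝ) : ℂ), Complex.norm_real,
              Real.norm_of_nonneg (by positivity), ENNReal.ofReal_pow (by positivity)]
        _ = _ := by
            rw [lintegral_const_mul' _ _ ENNReal.ofReal_ne_top, h2, h3, ← h2]
            congr 1
            refine lintegral_congr_ae ?_
            filter_upwards [hx.coeFn_toLp] with w hw
            rw [hw]
    rw [lintegral_frequencySlice hν, h1, ← mul_assoc,
      ← ENNReal.ofReal_mul (sliceConst_pos hν).le, sliceConst, ← hC]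
    congr 2
    field_simp
  have hden := setLIntegral_density_eq hν hΛ hΛ' φ.aestronglyMeasurable hrinv hF.continuous hinvF
    hnorm
  have hφfin : ∫⁻ x in Λ, realDensity ν φ x ≠ ∞ := hden ▸ hfin
  refine ⟨φ, hquasi, hφfin, ?_⟩
  have hdecay := integrable_and_memLp_exp_mul hν φ.aestronglyMeasurable
    (lintegral_realDensity_mul_gaussian_ne_top hΛ φ.aestronglyMeasurable hrinv hφfin (half_pos hν))
  have hBd := differentiable_segalBargmann fun a => (hdecay a).1
  have hBKc := (differentiable_laplaceLift ν hBd).continuous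
  -- the slices of the transform of `φ` agree with those of `F` wherever the latter are square
  -- integrable, hence everywhere by continuity
  have hgoodeq : ∀ᵐ x, ∀ y, laplaceLift ν (segalBargmann ν φ) (tubePoint x y) =
      K (tubePoint x y) := by
    filter_upwards [hgood] with x hx
    have hint := integrable_laplaceSlice hν φ.aestronglyMeasurable (fun a => (hdecay a).1) x
    have hmem := memLp_laplaceSlice hν φ.aestronglyMeasurable (fun a => (hdecay a).2) x
    have h1 : hmem.toLp _ = ((C⁻¹ : ℝ) : ℂ) • (𝓕⁻ (hx.toLp _) : Lp ℂ 2 (volume : Measure _)) := by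
      apply Lp.ext
      filter_upwards [hmem.coeFn_toLp, hslice x hx, Lp.coeFn_smul ((C⁻¹ : ℝ) : ℂ)
        (𝓕⁻ (hx.toLp _) : Lp ℂ 2 (volume : Measure _))] with t h2 h3 h4
      rw [h2, h3, h4, Pi.smul_apply, smul_eq_mul]
    have h2 := coeFn_fourier_toLp hint hmem
    rw [h1, FourierTransform.fourier_smul, FourierTransform.fourier_fourierInv_eq] at h2
    have h3 : 𝓕 (laplaceSlice ν φ x) = fun w => ((C⁻¹ : ℝ) : ℂ) * frequencySlice ν K x w := by
      refine (Continuous.ae_eq_iff_eq volume (continuous_fourier hint)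
        (continuous_const.mul (continuous_frequencySlice ν hKd.continuous x))).1 ?_
      filter_upwards [h2, Lp.coeFn_smul ((C⁻¹ : ℝ) : ℂ) (hx.toLp _), hx.coeFn_toLp] with w h4 h5 h6
      rw [← h4, h5, Pi.smul_apply, smul_eq_mul, h6]
      rfl
    intro y
    rw [laplaceLift_segalBargmann, laplaceTransform_tubePoint, h3]
    beta_reduce
    rw [frequencySlice_smul hν, ← mul_assoc, ← Complex.ofReal_mul, mul_inv_cancel₀ hCpos.ne',
      Complex.ofReal_one, one_mul]
  have hall : ∀ y, (fun x => laplaceLift ν (segalBargmann ν φ) (tubePoint x y)) =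
      fun x => K (tubePoint x y) := by
    intro y
    have hc : Continuous fun x : EuclideanSpace ℝ (Fin d) => tubePoint x y :=
      continuous_tubePoint.comp (continuous_id.prodMk continuous_const)
    exact (Continuous.ae_eq_iff_eq volume (hBKc.comp hc) (hKd.continuous.comp hc)).1
      (hgoodeq.mono fun x hx => hx y)
  ext z
  have h := congrFun (hall (imPart z)) (rePart z)
  beta_reduce at h
  rw [tubePoint_rePart_imPart, hKdef, laplaceLift, laplaceLift] at h
  exact mul_right_cancel₀ (Complex.exp_ne_zero _) h

end Surjective

/-! ### The vector of a character -/

/-- A unitary character of a discrete subgroup is induced by a vector of its real span: a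
`ℤ`-basis of the subgroup is an `ℝ`-basis of the span, so the arguments of the character on the
basis define a linear form, which the scalar product represents. -/
lemma exists_vector_of_character {d : ℕ} (Γ : AddSubgroup (EuclideanSpace ℝ (Fin d)))
    [DiscreteTopology Γ] (χ : AddChar Γ Circle) :
    ∃ v ∈ Submodule.span ℝ (Γ : Set (EuclideanSpace ℝ (Fin d))),
      ∀ γ : Γ, (χ γ : ℂ) = Complex.exp (2 * Complex.I * Real.pi *
        ((inner ℝ (γ : EuclideanSpace ℝ (Fin d)) v : ℝ) : ℂ)) := by
  set S := Submodule.span ℝ (Γ : Set (EuclideanSpace ℝ (Fin d))) with hS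
  -- `Γ` as a full lattice of the subspace that it spans
  let M : Submodule ℤ S := Submodule.comap (S.subtype.restrictScalars ℤ) Γ.toIntSubmodule
  have : DiscreteTopology M := by
    have hc : Continuous (fun x : M => (⟨(x : S), x.2⟩ : Γ)) := by fun_prop
    refine DiscreteTopology.of_continuous_injective hc fun x y h => ?_
    exact Subtype.ext (Subtype.ext (congrArg (fun g : Γ => (g : EuclideanSpace ℝ (Fin d))) h))
  have : IsZLattice ℝ M := ⟨by
    have h := Submodule.span_span_coe_preimage (R := ℝ)
      (s := (Γ : Set (EuclideanSpace ℝ (Fin d))))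
    exact h⟩
  let b := Module.Free.chooseBasis ℤ M
  let B := b.ofZLatticeBasis ℝ M
  let toΓ : M →+ Γ :=
    { toFun := fun x => ⟨(x : S), x.2⟩
      map_zero' := rfl
      map_add' := fun _ _ => rfl }
  have harg : ∀ i, (χ (toΓ (b i)) : ℂ) =
      Complex.exp (2 * Complex.I * Real.pi *
        (Complex.arg (χ (toΓ (b i)) : ℂ) / (2 * Real.pi) : ℝ)) := by
    intro i
    have h := Complex.norm_mul_exp_arg_mul_I (χ (toΓ (b i)) : ℂ)
    rw [Circle.norm_coe] at h
    conv_lhs => rw [← h]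
    push_cast
    rw [one_mul]
    congr 1
    have : (Real.pi : ℂ) ≠ 0 := by exact_mod_cast Real.pi_ne_zero
    field_simp
  let ℓ : S →ₗ[ℝ] ℝ := B.constr ℝ fun i => Complex.arg (χ (toΓ (b i)) : ℂ) / (2 * Real.pi)
  obtain ⟨v, hv⟩ := (InnerProductSpace.toDual ℝ S).surjective (LinearMap.toContinuousLinearMap ℓ)
  have hv' : ∀ x : S,
      inner ℝ (x : EuclideanSpace ℝ (Fin d)) (v : EuclideanSpace ℝ (Fin d)) = ℓ x := by
    intro x
    have := congrArg (fun T => T x) hv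
    simp only [InnerProductSpace.toDual_apply_apply] at this
    rw [real_inner_comm]
    exact this
  refine ⟨v, v.2, fun γ => ?_⟩
  -- both sides are characters of the lattice, so it suffices to compare them on the basis
  let e : M →+ Additive ℂˣ :=
    { toFun := fun x => Additive.ofMul (Units.mk0
        (Complex.exp (2 * Complex.I * Real.pi * (ℓ x : ℝ))) (Complex.exp_ne_zero _))
      map_zero' := by
        apply Additive.toMul.injective; ext; simp
      map_add' := fun x y => by
        apply Additive.toMul.injective; ext
        simp [mul_add, Complex.exp_add] }
  let e' : M →+ Additive ℂˣ :=
    { toFun := fun x => Additive.ofMul (Circle.toUnits (χ (toΓ x)))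
      map_zero' := by simp
      map_add' := fun x y => by simp [AddChar.map_add_eq_mul] }
  have hee : e'.toIntLinearMap = e.toIntLinearMap := by
    refine b.ext fun i => ?_
    apply Additive.toMul.injective
    ext
    have : ℓ (b i) = Complex.arg (χ (toΓ (b i)) : ℂ) / (2 * Real.pi) := by
      have h : B i = b i := Module.Basis.ofZLatticeBasis_apply ℝ M b i
      rw [← h]
      simp [ℓ]
    simp only [AddMonoidHom.coe_toIntLinearMap, e, e', AddMonoidHom.coe_mk, ZeroHom.coe_mk]
    simp only [toMul_ofMul, Units.val_mk0, this]
    exact harg i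
  let x : M := ⟨⟨γ, Submodule.subset_span γ.2⟩, γ.2⟩
  have h := congrArg (fun T : M →ₗ[ℤ] Additive ℂˣ => ((Additive.toMul (T x) : ℂˣ) : ℂ)) hee
  have h2 := hv' x
  simp only [AddMonoidHom.coe_toIntLinearMap, e, e', AddMonoidHom.coe_mk, ZeroHom.coe_mk,
    toMul_ofMul, Units.val_mk0] at h
  have h3 : (χ γ : ℂ) = Complex.exp (2 * Complex.I * Real.pi * (ℓ x : ℝ)) := h
  rw [h3, ← h2]

/-! ### Norms and scalar products -/

section Unitary

variable {d : ℕ}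

lemma lintegral_enorm_sq_mul_eq {X : Type*} [MeasurableSpace X] {μ : Measure X} {f : X → ℂ}
    {w : X → ℝ} :
    ∫⁻ x, ‖f x‖ₑ ^ 2 * ENNReal.ofReal (w x) ∂μ = ∫⁻ x, ENNReal.ofReal (‖f x‖ ^ 2 * w x) ∂μ := by
  refine lintegral_congr fun x => ?_
  rw [ENNReal.ofReal_mul (sq_nonneg _), ENNReal.ofReal_pow (norm_nonneg _), ofReal_norm]

lemma integrable_norm_sq_mul_iff {X : Type*} [MeasurableSpace X] {μ : Measure X} {f : X → ℂ}
    {w : X → ℝ} (hf : AEStronglyMeasurable f μ) (hwm : AEStronglyMeasurable w μ)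
    (hw : ∀ x, 0 ≤ w x) :
    Integrable (fun x => ‖f x‖ ^ 2 * w x) μ ↔
      ∫⁻ x, ‖f x‖ₑ ^ 2 * ENNReal.ofReal (w x) ∂μ ≠ ∞ := by
  rw [lintegral_enorm_sq_mul_eq, ← lt_top_iff_ne_top,
    ← hasFiniteIntegral_iff_ofReal
      (Filter.Eventually.of_forall fun x => mul_nonneg (sq_nonneg _) (hw x))]
  exact ⟨fun h => h.2, fun h => ⟨(hf.norm.pow 2).mul hwm, h⟩⟩

lemma integral_norm_sq_mul_eq {X : Type*} [MeasurableSpace X] {μ : Measure X} {f : X → ℂ}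
    {w : X → ℝ} (hf : AEStronglyMeasurable f μ) (hwm : AEStronglyMeasurable w μ)
    (hw : ∀ x, 0 ≤ w x) :
    ∫ x, ‖f x‖ ^ 2 * w x ∂μ = (∫⁻ x, ‖f x‖ₑ ^ 2 * ENNReal.ofReal (w x) ∂μ).toReal := by
  rw [lintegral_enorm_sq_mul_eq]
  exact integral_eq_lintegral_of_nonneg_ae
    (Filter.Eventually.of_forall fun x => mul_nonneg (sq_nonneg _) (hw x))
    ((hf.norm.pow 2).mul hwm)

lemma norm_add_smul_sq_polarization (a b : ℂ) :
    4 * (a * starRingEnd ℂ b) =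
      (‖a + 1 * b‖ ^ 2 : ℝ) - (‖a + -1 * b‖ ^ 2 : ℝ) +
        Complex.I * (‖a + Complex.I * b‖ ^ 2 : ℝ) - Complex.I * (‖a + -Complex.I * b‖ ^ 2 : ℝ) := by
  simp only [Complex.sq_norm, ← Complex.mul_conj, map_add, map_mul, map_neg, map_one,
    Complex.conj_I]
  linear_combination (2 * a * starRingEnd ℂ b - 2 * b * starRingEnd ℂ a) * Complex.I_sq

/-- Polarization for the weighted scalar product. -/
lemma four_mul_integral_mul_conj {X : Type*} [MeasurableSpace X] {μ : Measure X} {f g : X → ℂ}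
    {w : X → ℝ} (h : ∀ c : ℂ, Integrable (fun x => ‖f x + c * g x‖ ^ 2 * w x) μ) :
    4 * ∫ x, f x * starRingEnd ℂ (g x) * w x ∂μ =
      ((∫ x, ‖f x + 1 * g x‖ ^ 2 * w x ∂μ : ℝ) : ℂ) -
        ((∫ x, ‖f x + -1 * g x‖ ^ 2 * w x ∂μ : ℝ) : ℂ) +
        Complex.I * ((∫ x, ‖f x + Complex.I * g x‖ ^ 2 * w x ∂μ : ℝ) : ℂ) -
        Complex.I * ((∫ x, ‖f x + -Complex.I * g x‖ ^ 2 * w x ∂μ : ℝ) : ℂ) := by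
  have h' : ∀ c : ℂ, Integrable (fun x => ((‖f x + c * g x‖ ^ 2 * w x : ℝ) : ℂ)) μ :=
    fun c => (h c).ofReal
  simp only [← integral_complex_ofReal, ← integral_const_mul]
  have h1 : ∀ c, Integrable (fun x => Complex.I * ((‖f x + c * g x‖ ^ 2 * w x : ℝ) : ℂ)) μ :=
    fun c => (h' c).const_mul _
  rw [← integral_sub' (h' 1) (h' (-1)), ← integral_add' ((h' 1).sub (h' (-1))) (h1 Complex.I),
    ← integral_sub' (((h' 1).sub (h' (-1))).add (h1 Complex.I)) (h1 (-Complex.I))]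
  refine integral_congr_ae (Filter.Eventually.of_forall fun x => ?_)
  simp only [Pi.sub_apply, Pi.add_apply, Complex.ofReal_mul]
  linear_combination (w x : ℂ) * norm_add_smul_sq_polarization (f x) (g x)

lemma continuous_gaussianWeight (ν : ℝ) {E : Type*} [NormedAddCommGroup E] :
    Continuous fun x : E => Real.exp (-ν * ‖x‖ ^ 2) := by fun_prop

lemma exp_neg_mul_herm_self_re (ν : ℝ) (z : EuclideanSpace ℂ (Fin d)) :
    Real.exp (-ν * (herm z z).re) = Real.exp (-ν * ‖z‖ ^ 2) := by
  rw [herm_self, Complex.ofReal_re]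

lemma mem_likewiseThetaSpace_iff {ν : ℝ} {Γ : AddSubgroup (EuclideanSpace ℝ (Fin d))} {χ : Γ → ℂ}
    {Λ : Set (EuclideanSpace ℝ (Fin d))} {φ : EuclideanSpace ℝ (Fin d) →ₘ[volume] ℂ} :
    φ ∈ likewiseThetaSpace ν Γ χ Λ ↔
      (∀ γ : Γ, ∀ᵐ x : EuclideanSpace ℝ (Fin d), φ (x + (γ : EuclideanSpace ℝ (Fin d))) =
        χ γ * Complex.exp (((ν * inner ℝ (x + (2⁻¹ : ℝ) • (γ : EuclideanSpace ℝ (Fin d)))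
          (γ : EuclideanSpace ℝ (Fin d)) : ℝ) : ℂ)) * φ x) ∧
      ∫⁻ x in Λ, realDensity ν φ x ≠ ∞ :=
  and_congr_right fun _ => integrable_norm_sq_mul_iff φ.aestronglyMeasurable.restrict
    (continuous_gaussianWeight ν).aestronglyMeasurable fun _ => (Real.exp_pos _).le

lemma likewiseThetaNorm_eq (ν : ℝ) (Λ : Set (EuclideanSpace ℝ (Fin d)))
    (φ : EuclideanSpace ℝ (Fin d) →ₘ[volume] ℂ) :
    likewiseThetaNorm ν Λ φ = √(∫⁻ x in Λ, realDensity ν φ x).toReal :=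
  congrArg Real.sqrt (integral_norm_sq_mul_eq φ.aestronglyMeasurable.restrict
    (continuous_gaussianWeight ν).aestronglyMeasurable fun _ => (Real.exp_pos _).le)

lemma integrableOn_fock_iff {ν : ℝ} {Λ : Set (EuclideanSpace ℂ (Fin d))}
    {F : EuclideanSpace ℂ (Fin d) → ℂ} (hF : Continuous F) :
    IntegrableOn (fun z => ‖F z‖ ^ 2 * Real.exp (-ν * (herm z z).re)) Λ ↔
      ∫⁻ z in Λ, complexDensity ν F z ≠ ∞ := by
  simp only [exp_neg_mul_herm_self_re]
  exact integrable_norm_sq_mul_iff hF.aestronglyMeasurable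
    (continuous_gaussianWeight ν).aestronglyMeasurable fun _ => (Real.exp_pos _).le

lemma thetaFockNorm_eq (ν : ℝ) (Λ : Set (EuclideanSpace ℂ (Fin d)))
    {F : EuclideanSpace ℂ (Fin d) → ℂ} (hF : Continuous F) :
    thetaFockNorm ν Λ F = √(∫⁻ z in Λ, complexDensity ν F z).toReal := by
  rw [thetaFockNorm]
  simp only [exp_neg_mul_herm_self_re]
  exact congrArg Real.sqrt (integral_norm_sq_mul_eq hF.aestronglyMeasurable
    (continuous_gaussianWeight ν).aestronglyMeasurable fun _ => (Real.exp_pos _).le)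

lemma four_mul_likewiseThetaInner {ν : ℝ} {Γ : AddSubgroup (EuclideanSpace ℝ (Fin d))} {χ : Γ → ℂ}
    {Λ : Set (EuclideanSpace ℝ (Fin d))} (φ ψ : likewiseThetaSpace ν Γ χ Λ) :
    4 * likewiseThetaInner ν Λ φ.1 ψ.1 =
      ((likewiseThetaNorm ν Λ (φ + (1 : ℂ) • ψ).1 ^ 2 : ℝ) : ℂ) -
      ((likewiseThetaNorm ν Λ (φ + (-1 : ℂ) • ψ).1 ^ 2 : ℝ) : ℂ) +
      Complex.I * ((likewiseThetaNorm ν Λ (φ + Complex.I • ψ).1 ^ 2 : ℝ) : ℂ) -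
      Complex.I * ((likewiseThetaNorm ν Λ (φ + (-Complex.I) • ψ).1 ^ 2 : ℝ) : ℂ) := by
  have hcoe : ∀ c : ℂ, ∀ᵐ x ∂(volume.restrict Λ),
      ‖(φ + c • ψ).1 x‖ ^ 2 * Real.exp (-ν * ‖x‖ ^ 2) =
        ‖φ.1 x + c * ψ.1 x‖ ^ 2 * Real.exp (-ν * ‖x‖ ^ 2) := by
    intro c
    filter_upwards [ae_restrict_of_ae (AEEqFun.coeFn_add φ.1 (c • ψ.1)),
      ae_restrict_of_ae (AEEqFun.coeFn_smul c ψ.1)] with x h1 h2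
    rw [Submodule.coe_add, Submodule.coe_smul, h1, Pi.add_apply, h2, Pi.smul_apply, smul_eq_mul]
  have hn : ∀ c : ℂ, likewiseThetaNorm ν Λ (φ + c • ψ).1 ^ 2 =
      ∫ x in Λ, ‖φ.1 x + c * ψ.1 x‖ ^ 2 * Real.exp (-ν * ‖x‖ ^ 2) := fun c => by
    rw [likewiseThetaNorm, Real.sq_sqrt (integral_nonneg fun x => by positivity)]
    exact integral_congr_ae (hcoe c)
  rw [hn, hn, hn, hn, likewiseThetaInner]
  exact four_mul_integral_mul_conj fun c => (φ + c • ψ).2.2.congr (hcoe c)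

lemma four_mul_thetaFockInner {ν : ℝ} {Γ : AddSubgroup (EuclideanSpace ℝ (Fin d))} {χ : Γ → ℂ}
    {Λ : Set (EuclideanSpace ℂ (Fin d))} (F G : thetaFockSpace ν Γ χ Λ) :
    4 * thetaFockInner ν Λ F.1 G.1 =
      ((thetaFockNorm ν Λ (F + (1 : ℂ) • G).1 ^ 2 : ℝ) : ℂ) -
      ((thetaFockNorm ν Λ (F + (-1 : ℂ) • G).1 ^ 2 : ℝ) : ℂ) +
      Complex.I * ((thetaFockNorm ν Λ (F + Complex.I • G).1 ^ 2 : ℝ) : ℂ) -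
      Complex.I * ((thetaFockNorm ν Λ (F + (-Complex.I) • G).1 ^ 2 : ℝ) : ℂ) := by
  have hn : ∀ c : ℂ, thetaFockNorm ν Λ (F + c • G).1 ^ 2 =
      ∫ z in Λ, ‖F.1 z + c * G.1 z‖ ^ 2 * Real.exp (-ν * (herm z z).re) := fun c => by
    rw [thetaFockNorm, Real.sq_sqrt (integral_nonneg fun x => by positivity)]
    rfl
  rw [hn, hn, hn, hn, thetaFockInner]
  exact four_mul_integral_mul_conj fun c => (F + c • G).2.2.2

/-- Under `γ ↦ γ/√2`, the character of `Γ/√2` induced by `√2 v` becomes the character of `Γ` induced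
by `v`. -/
lemma shiftedChar_inv_sqrt_two_smul (Γ : AddSubgroup (EuclideanSpace ℝ (Fin d)))
    (v : EuclideanSpace ℝ (Fin d)) {γ : EuclideanSpace ℝ (Fin d)}
    (h : (√2 : ℝ)⁻¹ • γ ∈ shiftedLattice Γ) :
    shiftedChar Γ v ⟨(√2 : ℝ)⁻¹ • γ, h⟩ =
      Complex.exp (2 * Complex.I * Real.pi * ((inner ℝ γ v : ℝ) : ℂ)) := by
  rw [shiftedChar, real_inner_smul_left, real_inner_smul_right,
    inv_mul_cancel_left₀ sqrt_two_ne_zero]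

/-! ### The transform as a linear isometry -/

section Transform

variable {ν : ℝ} {Γ : AddSubgroup (EuclideanSpace ℝ (Fin d))} [DiscreteTopology Γ] {χ : Γ → ℂ}
  {Λ : Set (EuclideanSpace ℝ (Fin d))} {φ : EuclideanSpace ℝ (Fin d) →ₘ[volume] ℂ}

lemma exp_mul_gaussianWeighted_of_mem (hν : 0 < ν) (hχ : ∀ γ, ‖χ γ‖ = 1)
    (hΛ : IsAddFundamentalDomain Γ Λ volume) (hφ : φ ∈ likewiseThetaSpace ν Γ χ Λ) (a : ℝ) :
    Integrable (fun t => Real.exp (a * ‖t‖) * ‖gaussianWeighted ν φ t‖) ∧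
      MemLp (fun t => Real.exp (a * ‖t‖) * ‖gaussianWeighted ν φ t‖) 2 := by
  have := countable_of_discreteTopology Γ
  obtain ⟨hquasi, hfin⟩ := mem_likewiseThetaSpace_iff.1 hφ
  exact integrable_and_memLp_exp_mul hν φ.aestronglyMeasurable
    (lintegral_realDensity_mul_gaussian_ne_top hΛ φ.aestronglyMeasurable
      (fun γ => (hquasi γ).mono fun x hx => realDensity_add (hχ γ) hx) hfin (half_pos hν)) a

lemma lintegral_complexDensity_segalBargmann (hν : 0 < ν) (hχ : ∀ γ, ‖χ γ‖ = 1)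
    (hΛ : IsAddFundamentalDomain Γ Λ volume) {Λ' : Set (EuclideanSpace ℂ (Fin d))}
    (hΛ' : IsAddFundamentalDomain ((shiftedLattice Γ).map (complexify d)) Λ' volume)
    (hφ : φ ∈ likewiseThetaSpace ν Γ χ Λ) :
    ∫⁻ z in Λ', complexDensity ν (segalBargmann ν φ) z = ∫⁻ x in Λ, realDensity ν φ x := by
  have := countable_of_discreteTopology Γ
  have hdecay := exp_mul_gaussianWeighted_of_mem hν hχ hΛ hφ
  have hquasi := hφ.1
  refine setLIntegral_density_eq hν hΛ hΛ' φ.aestronglyMeasurable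
    (fun γ => (hquasi γ).mono fun x hx => realDensity_add (hχ γ) hx)
    (differentiable_segalBargmann fun a => (hdecay a).1).continuous ?_
    (Filter.Eventually.of_forall fun x => lintegral_slice_segalBargmann hν hdecay x)
  intro γ h z
  obtain ⟨γ', h1, rfl⟩ := exists_of_mem_shiftedLattice h
  exact complexDensity_add (hχ ⟨γ', h1⟩) (segalBargmann_add (hquasi ⟨γ', h1⟩) z)

lemma segalBargmann_mem_thetaFockSpace (hν : 0 < ν) (hχ : ∀ γ, ‖χ γ‖ = 1)
    (hΛ : IsAddFundamentalDomain Γ Λ volume) {Λ' : Set (EuclideanSpace ℂ (Fin d))}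
    (hΛ' : IsAddFundamentalDomain ((shiftedLattice Γ).map (complexify d)) Λ' volume)
    {χ' : shiftedLattice Γ → ℂ}
    (hχ' : ∀ γ : Γ, χ' ⟨(√2 : ℝ)⁻¹ • γ, inv_sqrt_two_smul_mem γ.2⟩ = χ γ)
    (hφ : φ ∈ likewiseThetaSpace ν Γ χ Λ) :
    segalBargmann ν φ ∈ thetaFockSpace ν (shiftedLattice Γ) χ' Λ' := by
  have hB : Differentiable ℂ (segalBargmann ν φ) :=
    differentiable_segalBargmann fun a => (exp_mul_gaussianWeighted_of_mem hν hχ hΛ hφ a).1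
  refine ⟨hB, ?_, ?_⟩
  · rintro ⟨γ, h⟩ z
    obtain ⟨γ', h1, rfl⟩ := exists_of_mem_shiftedLattice h
    rw [hχ' ⟨γ', h1⟩]
    exact segalBargmann_add (hφ.1 ⟨γ', h1⟩) z
  · rw [integrableOn_fock_iff hB.continuous,
      lintegral_complexDensity_segalBargmann hν hχ hΛ hΛ' hφ]
    exact (mem_likewiseThetaSpace_iff.1 hφ).2

lemma segalBargmann_add_apply {ψ : EuclideanSpace ℝ (Fin d) →ₘ[volume] ℂ}
    {z : EuclideanSpace ℂ (Fin d)} (hφ : Integrable (bargmannIntegrand ν φ z))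
    (hψ : Integrable (bargmannIntegrand ν ψ z)) :
    segalBargmann ν (φ + ψ) z = segalBargmann ν φ z + segalBargmann ν ψ z := by
  rw [segalBargmann, segalBargmann, segalBargmann, ← mul_add, ← integral_add hφ hψ]
  congr 1
  refine integral_congr_ae ?_
  filter_upwards [AEEqFun.coeFn_add φ ψ] with x hx
  rw [bargmannIntegrand, bargmannIntegrand, bargmannIntegrand, hx, Pi.add_apply]
  ring

lemma segalBargmann_smul_apply (ν : ℝ) (c : ℂ) (φ : EuclideanSpace ℝ (Fin d) →ₘ[volume] ℂ)
    (z : EuclideanSpace ℂ (Fin d)) :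
    segalBargmann ν (c • φ) z = c * segalBargmann ν φ z := by
  rw [segalBargmann, segalBargmann, mul_left_comm, ← integral_const_mul c]
  congr 1
  refine integral_congr_ae ?_
  filter_upwards [AEEqFun.coeFn_smul c φ] with x hx
  rw [bargmannIntegrand, bargmannIntegrand, hx, Pi.smul_apply, smul_eq_mul]
  ring

/-- Injectivity: Plancherel's formula on the single slice over `0`. -/
lemma eq_zero_of_segalBargmann_eq_zero (hν : 0 < ν) (hχ : ∀ γ, ‖χ γ‖ = 1)
    (hΛ : IsAddFundamentalDomain Γ Λ volume) (hφ : φ ∈ likewiseThetaSpace ν Γ χ Λ)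
    (h : segalBargmann ν φ = 0) : φ = 0 := by
  have h1 := lintegral_slice_segalBargmann hν (exp_mul_gaussianWeighted_of_mem hν hχ hΛ hφ) 0
  have h2 : ∫⁻ t, ‖laplaceSlice ν φ 0 t‖ₑ ^ 2 = 0 := by
    have h3 : ∀ z, laplaceLift ν (segalBargmann ν φ) z = 0 := fun z => by
      rw [laplaceLift, h]; simp
    simp only [h3, enorm_zero, ne_eq, OfNat.ofNat_ne_zero, not_false_eq_true, zero_pow,
      lintegral_zero] at h1
    refine (mul_eq_zero.1 h1.symm).resolve_left ?_
    exact (ENNReal.ofReal_pos.2 (sliceConst_pos hν)).ne'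
  rw [lintegral_eq_zero_iff'
    ((aestronglyMeasurable_laplaceSlice ν φ.aestronglyMeasurable 0).enorm.pow_const 2)] at h2
  refine AEEqFun.ext ?_
  filter_upwards [h2, AEEqFun.coeFn_zero (α := EuclideanSpace ℝ (Fin d)) (β := ℂ) (μ := volume)]
    with t ht h0
  rw [h0]
  simpa [laplaceSlice, Real.exp_ne_zero] using ht

lemma exists_linearEquiv_segalBargmann (hν : 0 < ν) (hχ : ∀ γ, ‖χ γ‖ = 1)
    (hΛ : IsAddFundamentalDomain Γ Λ volume) {Λ' : Set (EuclideanSpace ℂ (Fin d))}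
    (hΛ' : IsAddFundamentalDomain ((shiftedLattice Γ).map (complexify d)) Λ' volume)
    {χ' : shiftedLattice Γ → ℂ}
    (hχ' : ∀ γ : Γ, χ' ⟨(√2 : ℝ)⁻¹ • γ, inv_sqrt_two_smul_mem γ.2⟩ = χ γ) :
    ∃ B : likewiseThetaSpace ν Γ χ Λ ≃ₗ[ℂ] thetaFockSpace ν (shiftedLattice Γ) χ' Λ',
      ∀ φ, (B φ).1 = segalBargmann ν φ.1 := by
  have hint : ∀ (φ : likewiseThetaSpace ν Γ χ Λ) z, Integrable (bargmannIntegrand ν φ.1 z) :=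
    fun φ z => integrable_bargmannIntegrand
      (fun a => (exp_mul_gaussianWeighted_of_mem hν hχ hΛ φ.2 a).1) z
  let B : likewiseThetaSpace ν Γ χ Λ →ₗ[ℂ] thetaFockSpace ν (shiftedLattice Γ) χ' Λ' :=
    { toFun := fun φ => ⟨segalBargmann ν φ.1,
        segalBargmann_mem_thetaFockSpace hν hχ hΛ hΛ' hχ' φ.2⟩
      map_add' := fun φ ψ => Subtype.ext <| funext fun z =>
        segalBargmann_add_apply (hint φ z) (hint ψ z)
      map_smul' := fun c φ => Subtype.ext <| funext fun z => segalBargmann_smul_apply ν c φ.1 z }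
  have hinj : Function.Injective B := by
    rw [injective_iff_map_eq_zero]
    exact fun φ h => Subtype.ext
      (eq_zero_of_segalBargmann_eq_zero hν hχ hΛ φ.2 (congrArg Subtype.val h))
  have hsurj : Function.Surjective B := by
    rintro ⟨F, hF, hquasi, hfin⟩
    obtain ⟨φ, h1, h2, h3⟩ := exists_segalBargmann_eq hν hχ hΛ hΛ' hF
      (fun γ z => by rw [← hχ' γ]; exact hquasi ⟨_, inv_sqrt_two_smul_mem γ.2⟩ z)
      ((integrableOn_fock_iff hF.continuous).1 hfin)
    exact ⟨⟨φ, mem_likewiseThetaSpace_iff.2 ⟨h1, h2⟩⟩, Subtype.ext h3⟩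
  exact ⟨LinearEquiv.ofBijective B ⟨hinj, hsurj⟩, fun φ => rfl⟩

end Transform

end Unitary

end

theorem theorem2p2 (d : ℕ) (ν : ℝ) (hν : 0 < ν)
    (Γ : AddSubgroup (EuclideanSpace ℝ (Fin d))) [DiscreteTopology Γ] (χ : AddChar Γ Circle) :
    (∃ v ∈ Submodule.span ℝ (Γ : Set (EuclideanSpace ℝ (Fin d))),
      ∀ γ : Γ, (χ γ : ℂ) = Complex.exp (2 * Complex.I * Real.pi *
        ((inner ℝ (γ : EuclideanSpace ℝ (Fin d)) v : ℝ) : ℂ))) ∧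
    ∀ v : EuclideanSpace ℝ (Fin d),
      (∀ γ : Γ, (χ γ : ℂ) = Complex.exp (2 * Complex.I * Real.pi *
        ((inner ℝ (γ : EuclideanSpace ℝ (Fin d)) v : ℝ) : ℂ))) →
      ∀ Λ : Set (EuclideanSpace ℝ (Fin d)), IsAddFundamentalDomain Γ Λ volume →
      ∀ Λ' : Set (EuclideanSpace ℂ (Fin d)),
        IsAddFundamentalDomain ((shiftedLattice Γ).map (complexify d)) Λ' volume →
      ∃ B : likewiseThetaSpace ν Γ (fun γ => (χ γ : ℂ)) Λ ≃ₗ[ℂ]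
          thetaFockSpace ν (shiftedLattice Γ) (shiftedChar Γ v) Λ',
        (∀ φ z, Integrable (bargmannIntegrand ν φ.1 z) volume ∧
          (B φ).1 z = segalBargmann ν φ.1 z) ∧
        (∀ φ, thetaFockNorm ν Λ' (B φ).1 = likewiseThetaNorm ν Λ φ.1) ∧
        (∀ φ ψ, thetaFockInner ν Λ' (B φ).1 (B ψ).1 = likewiseThetaInner ν Λ φ.1 ψ.1) := by
  refine ⟨exists_vector_of_character Γ χ, fun v hv Λ hΛ Λ' hΛ' => ?_⟩
  have hχ : ∀ γ : Γ, ‖(χ γ : ℂ)‖ = 1 := fun γ => Circle.norm_coe _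
  obtain ⟨B, hB⟩ := exists_linearEquiv_segalBargmann (χ' := shiftedChar Γ v) hν hχ hΛ hΛ'
    (fun γ => by rw [shiftedChar_inv_sqrt_two_smul, hv])
  have hnorm : ∀ φ, thetaFockNorm ν Λ' (B φ).1 = likewiseThetaNorm ν Λ φ.1 := fun φ => by
    rw [thetaFockNorm_eq ν Λ' (B φ).2.1.continuous, likewiseThetaNorm_eq, hB,
      lintegral_complexDensity_segalBargmann hν hχ hΛ hΛ' φ.2]
  refine ⟨B, fun φ z => ⟨integrable_bargmannIntegrand
    (fun a => (exp_mul_gaussianWeighted_of_mem hν hχ hΛ φ.2 a).1) z, congrFun (hB φ) z⟩, hnorm,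
    fun φ ψ => ?_⟩
  -- the scalar products by polarization
  refine mul_left_cancel₀ (by norm_num : (4 : ℂ) ≠ 0) ?_
  rw [four_mul_thetaFockInner, four_mul_likewiseThetaInner]
  simp only [← map_smul, ← map_add, hnorm]
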